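/- Let $G$ be a connected, simply connected nilpotent (real) Lie group of dimension $n$ whose Lie algebra $\mathfrak g$ is nonabelian and has an abelian ideal of codimension one (a one-parameter metabelian nilpotent Lie group). Let $\Gamma$ be a discrete subgroup of $G$ with $G/\Gamma$ compact, let $\mathfrak m$ be an abelian ideal of $\mathfrak g$ of codimension one which is rational (i.e. spanned over $\mathbb R$ by $\mathfrak m\cap \mathbb Q\text{-span}(\log\Gamma)$), and let $M=\exp\mathfrak m$. Let $(X_1,\dots,X_n)$ be a strong Malcev basis of $\mathfrak g$ (each $\mathrm{span}\{X_1,\dots,X_i\}$ is an ideal) strongly based on $\Gamma$ ($\Gamma=\exp(\mathbb ZX_1)\cdots\exp(\mathbb ZX_n)$), with $[\mathfrak g,\mathfrak g]=\mathrm{span}\{X_1,\dots,X_p\}$ and $\mathfrak m=\mathrm{span}\{X_1,\dots,X_{n-1}\}$; let $(X_1^*,\dots,X_n^*)$ be the dual basis of $\mathfrak g^*$. Put $$\Lambda=\mathbb ZX_{p+1}^*+\cdots+\mathbb ZX_n^*,\qquad \mathcal V=\{l\in\mathbb ZX_1^*+\cdots+\mathbb ZX_{n-1}^*:\ l|_{[\mathfrak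 g,\mathfrak g]}\neq0\},$$ and let $\Sigma\subset\mathcal V$ be a cross-section for the orbits of $\Gamma$ in $\mathcal V$ under $\gamma\cdot l=(\mathrm{Ad}^*(\gamma)l)|_{\mathfrak m}$ (functionals on $\mathfrak m$ being extended by $0$ on $X_n$). Put $\chi_l(\exp X)=e^{2\pi i\langle l,X\rangle}$, a character of $M$ if $l\in\Sigma$ and of $G$ if $l\in\Lambda$. Equip $G/\Gamma$ and $M/(M\cap\Gamma)$ with their invariant probability measures, and $G/M$ with the $G$-invariant measure for which $\{\exp(tX_n)M: 0\le t<1\}$ has measure $1$. For $l\in\Sigma$ the representation $\mathrm{Ind}_M^G\chi_l$ acts by left translations, $F\mapsto F(a^{-1}\,\cdot)$, on the completion of the space of continuous functions $F:G\to\mathbb C$ with compact support modulo $M$ and $F(gm)=\chi_l(m)^{-1}F(g)$ for $g\in G$, $m\in M$, for the norm $\|F\|^2=\int_{G/M}|F|^2$. For $l\in\Lambda$, the representation $\chi_l$ acts on $\mathbb C$, where $v\in\mathbb C$ is identified with the function $g\mapsto\chi_l(g)^{-1}v$ on $G$. Let $$\rho=\bigoplus_{l\in\Sigma}\mathrm{Ind}_M^G\chi_l\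 \oplus\ \bigoplus_{l\in\Lambda}\chi_l$$ on the Hilbert direct sum $\mathcal H_\rho$, and let $\tau=\mathrm{Ind}_\Gamma^G1$ be the representation $(\tau(a)f)(g)=f(a^{-1}g)$ on $L^2(G/\Gamma)$. For every continuous right $\Gamma$-invariant function $\xi:G\to\mathbb C$ (that is, $\xi\in\mathcal C(G/\Gamma)$) and $g\in G$ put $$U(\xi)(l)(g)=\begin{cases}\displaystyle\int_{M/(M\cap\Gamma)}\xi(gm)\chi_l(m)\,d\dot m,& l\in\Sigma,\\[2mm] \displaystyle\int_{G/\Gamma}\xi(gm)\chi_l(m)\,d\dot m,& l\in\Lambda.\end{cases}$$ The integrands are well defined on $M/(M\cap\Gamma)$ and $G/\Gamma$ respectively. The operator $U$ is linear on $\mathcal C(G/\Gamma)$, takes its values in $\mathcal H_\rho$, and is isometric for the norm of $L^2(G/\Gamma)$. It extends to a linear isometry $V:L^2(G/\Gamma)\to\mathcal H_\rho$ with $V\tau(a)=\rho(a)V$ for all $a\in G$. -/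

import Mathlib

open MeasureTheory Filter Topology
open scoped Manifold ContDiff ENNReal

set_option linter.unusedSectionVars false

noncomputable section

namespace Nilmanifold

/-! ### Lie theory: exponential, adjoint action, bases, rationality -/

section Lie

variable {n : ℕ} {G : Type*} [TopologicalSpace G] [ChartedSpace (EuclideanSpace ℝ (Fin n)) G]
  [Group G]

/-- A smooth real Lie group is in particular of the class used by `GroupLieAlgebra`. -/
instance instLieGroupMinSmoothness [LieGroup (𝓡 n) ∞ G] :
    LieGroup (𝓡 n) (minSmoothness ℝ 3) G :=
  LieGroup.of_le (n := ∞) (by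
    rw [minSmoothness_of_isRCLikeNormedField]
    exact ENat.LEInfty.out)

/-- The exponential map of a Lie group: `exp X = γ 1`, where `γ` is the integral curve, defined on
the whole line and with `γ 0 = 1`, of the left invariant vector field given by `X`. -/
def lieExp (X : GroupLieAlgebra (𝓡 n) G) : G :=
  (Classical.epsilon fun γ : ℝ → G =>
    γ 0 = 1 ∧ IsMIntegralCurve (I := 𝓡 n) γ (mulInvariantVectorField X)) 1

/-- The logarithm, the inverse of `lieExp` (which is bijective for connected, simply connected
nilpotent groups). -/
def lieLog (g : G) : GroupLieAlgebra (𝓡 n) G :=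
  Function.invFun (lieExp : GroupLieAlgebra (𝓡 n) G → G) g

/-- The adjoint action: `Ad g` is the derivative at `1` of the conjugation `x ↦ g x g⁻¹`. -/
def lieAd (g : G) (Y : GroupLieAlgebra (𝓡 n) G) : GroupLieAlgebra (𝓡 n) G :=
  (mfderiv (𝓡 n) (𝓡 n) (fun x : G => g * x * g⁻¹) (1 : G) Y : EuclideanSpace ℝ (Fin n))

/-- The function `χ_l (exp X) = exp (2 π i ⟨l, X⟩)`. It is a character on each subgroup `exp 𝔟`
with `𝔟` a subalgebra such that `l` vanishes on `[𝔟, 𝔟]`. -/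
def chi (l : Module.Dual ℝ (GroupLieAlgebra (𝓡 n) G)) (g : G) : Circle :=
  Circle.exp (2 * Real.pi * l (lieLog g))

/-- The rational structure `ℚ-span (log Γ)` given by a discrete uniform subgroup `Γ`. -/
def rationalPart (Γ : Subgroup G) : Set (GroupLieAlgebra (𝓡 n) G) :=
  letI : Module ℚ (GroupLieAlgebra (𝓡 n) G) := Module.compHom _ (algebraMap ℚ ℝ)
  {Y | Y ∈ Submodule.span ℚ (lieLog '' (Γ : Set G) : Set (GroupLieAlgebra (𝓡 n) G))}

/-- A real subspace is rational with respect to `Γ` if it is spanned by its rational vectors. -/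
def IsRationalSubspace (Γ : Subgroup G) (W : Submodule ℝ (GroupLieAlgebra (𝓡 n) G)) : Prop :=
  W = Submodule.span ℝ ((W : Set (GroupLieAlgebra (𝓡 n) G)) ∩ rationalPart Γ)

/-- The basis `X` of `𝔤` is strongly based on `Γ`:
`Γ = exp (ℤ X₁) ⋯ exp (ℤ Xₙ)`. -/
def IsStronglyBasedOn (X : Module.Basis (Fin n) ℝ (GroupLieAlgebra (𝓡 n) G))
    (Γ : Subgroup G) : Prop :=
  (Γ : Set G) = Set.range fun k : Fin n → ℤ =>
    (List.ofFn fun i => lieExp ((k i : ℝ) • X i)).prod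

end Lie

section LieAlg

variable {L : Type*} [LieRing L] [LieAlgebra ℝ L]

variable (L) in
/-- A one-parameter metabelian nilpotent Lie algebra: nonabelian, nilpotent, with an abelian ideal
of codimension one. -/
def IsOneParameterMetabelian : Prop :=
  LieRing.IsNilpotent L ∧ ¬ IsLieAbelian L ∧
    ∃ I : LieIdeal ℝ L, IsLieAbelian I ∧ Module.finrank ℝ (L ⧸ I.toSubmodule) = 1

/-- The span of the first `k` vectors of a basis. -/
def flag {n : ℕ} (X : Module.Basis (Fin n) ℝ L) (k : ℕ) : Submodule ℝ L :=
  Submodule.span ℝ (X '' {i | (i : ℕ) < k})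

/-- Strong Malcev basis: each `span {X₁, …, X_k}` is an ideal. -/
def IsStrongMalcev {n : ℕ} (X : Module.Basis (Fin n) ℝ L) : Prop :=
  ∀ k ≤ n, ∃ I : LieIdeal ℝ L, I.toSubmodule = flag X k

/-- `ℤ X*_{p+1} + ⋯ + ℤ X*_n`, where `X₁, …, X_p` span `[𝔤, 𝔤]`. -/
def nonGenericSet {n : ℕ} (X : Module.Basis (Fin n) ℝ L) (p : ℕ) : Set (Module.Dual ℝ L) :=
  {l | ∃ k : Fin n → ℤ, (∀ i : Fin n, (i : ℕ) < p → k i = 0) ∧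
    l = ∑ i, (k i : ℝ) • X.coord i}

/-- The `l ∈ ℤ X*_1 + ⋯ + ℤ X*_{n-1}` with `l ≠ 0` on `[𝔤, 𝔤]` (here `n = d + 1`). -/
def genericSet {d : ℕ} (X : Module.Basis (Fin (d + 1)) ℝ L) : Set (Module.Dual ℝ L) :=
  {l | (∃ k : Fin (d + 1) → ℤ, k (Fin.last d) = 0 ∧ l = ∑ i, (k i : ℝ) • X.coord i) ∧
    ∃ Y ∈ ⁅(⊤ : LieIdeal ℝ L), (⊤ : LieIdeal ℝ L)⁆, l Y ≠ 0}

end LieAlg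

/-- `S` is a cross-section for the orbits of `Γ` in `genericSet X`, where `γ ∈ Γ` acts by
`Ad₀* γ l = (Ad* γ l)|_𝔪`, i.e. `⟨Ad₀* γ l, Y⟩ = ⟨l, Ad (γ⁻¹) Y⟩` for `Y ∈ 𝔪`. -/
def IsCrossSection {d : ℕ} {G : Type*} [TopologicalSpace G]
    [ChartedSpace (EuclideanSpace ℝ (Fin (d + 1))) G] [Group G] [LieGroup (𝓡 (d + 1)) ∞ G]
    (X : Module.Basis (Fin (d + 1)) ℝ (GroupLieAlgebra (𝓡 (d + 1)) G))
    (𝔪 : LieIdeal ℝ (GroupLieAlgebra (𝓡 (d + 1)) G)) (Γ : Subgroup G)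
    (S : Set (Module.Dual ℝ (GroupLieAlgebra (𝓡 (d + 1)) G))) : Prop :=
  S ⊆ genericSet X ∧
    ∀ l ∈ genericSet X, ∃! s, s ∈ S ∧ ∃ γ ∈ Γ, ∀ Y ∈ 𝔪, l Y = s (lieAd γ⁻¹ Y)

/-! ### Functions on coset spaces -/

section Coset

variable {G : Type*} [Group G] (H : Subgroup G)

/-- `f` is invariant under right translations by `H`, i.e. defines a function on `G ⧸ H`. -/
def RightInvariant {β : Type*} (f : G → β) : Prop := ∀ g, ∀ h ∈ H, f (g * h) = f g

/-- The function on `G ⧸ H` defined by a right `H`-invariant function `f` on `G`. -/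
def descend {β : Type*} (f : G → β) : G ⧸ H → β := fun x => f x.out

variable {H}

theorem descend_mk {β : Type*} {f : G → β} (hf : RightInvariant H f) (g : G) :
    descend H f (g : G ⧸ H) = f g := by
  obtain ⟨h, hh⟩ := QuotientGroup.mk_out_eq_mul H g
  simp only [descend]
  rw [hh]
  exact hf g h h.2

theorem continuous_descend [TopologicalSpace G] {β : Type*} [TopologicalSpace β] {f : G → β}
    (hf : RightInvariant H f) (hc : Continuous f) : Continuous (descend H f) := by
  refine (QuotientGroup.isQuotientMap_mk (N := H)).continuous_iff.2 ?_
  have : descend H f ∘ (QuotientGroup.mk : G → G ⧸ H) = f := funext fun g => descend_mk hf g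
  rwa [this]

instance instOpensMeasurableSpaceQuotient [TopologicalSpace G] [MeasurableSpace G]
    [OpensMeasurableSpace G] : OpensMeasurableSpace (G ⧸ H) where
  borel_le := by
    refine MeasurableSpace.generateFrom_le fun s hs => ?_
    have : IsOpen ((QuotientGroup.mk : G → G ⧸ H) ⁻¹' s) :=
      IsOpen.preimage QuotientGroup.continuous_mk hs
    exact this.measurableSet

instance instMeasurableConstSMulQuotient [TopologicalSpace G] [IsTopologicalGroup G]
    [MeasurableSpace G] [BorelSpace G] : MeasurableConstSMul G (G ⧸ H) where
  measurable_const_smul g := by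
    refine measurable_from_quotient.2 ?_
    have h1 : Measurable (QuotientGroup.mk : G → G ⧸ H) := measurable_from_quotient.1 measurable_id
    have h2 : Measurable fun x : G => g * x := (continuous_const.mul continuous_id).measurable
    exact h1.comp h2

end Coset

/-! ### The induced representation -/

section Induced

variable {G : Type*} [Group G] [TopologicalSpace G] [IsTopologicalGroup G]
  (H : Subgroup G) (χ : H → Circle)

/-- The covariance relation `F (g h) = χ (h⁻¹) F (g)`. -/
def Covariant (F : G → ℂ) : Prop := ∀ (g : G) (h : H), F (g * h) = (χ h⁻¹ : ℂ) * F g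

/-- `C_c(G/H, χ)`: continuous covariant functions on `G` with compact support modulo `H`. -/
def ccSections : Submodule ℂ (G → ℂ) where
  carrier := {F | Continuous F ∧ Covariant H χ F ∧
    IsCompact (closure ((QuotientGroup.mk : G → G ⧸ H) '' Function.support F))}
  zero_mem' := by
    refine ⟨continuous_const, fun g h => by simp, ?_⟩
    simp [Function.support_zero]
  add_mem' := by
    rintro F F' ⟨h1, h2, h3⟩ ⟨h1', h2', h3'⟩
    refine ⟨h1.add h1', fun g h => by simp [h2 g h, h2' g h, mul_add], ?_⟩
    refine (h3.union h3').of_isClosed_subset isClosed_closure ?_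
    rw [← closure_union, ← Set.image_union]
    exact closure_mono (Set.image_mono (Function.support_add F F'))
  smul_mem' := by
    rintro c F ⟨h1, h2, h3⟩
    refine ⟨h1.const_smul c, fun g h => by simp [h2 g h, mul_left_comm], ?_⟩
    refine h3.of_isClosed_subset isClosed_closure ?_
    exact closure_mono (Set.image_mono (Function.support_const_smul_subset c F))

variable {H χ}

theorem Covariant.rightInvariant_inner {F F' : G → ℂ} (hF : Covariant H χ F)
    (hF' : Covariant H χ F') : RightInvariant H fun g => starRingEnd ℂ (F g) * F' g := by
  intro g h hh
  have h1 := hF g ⟨h, hh⟩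
  have h2 := hF' g ⟨h, hh⟩
  simp only at h1 h2
  simp only [h1, h2, map_mul]
  have : starRingEnd ℂ ((χ (⟨h, hh⟩ : H)⁻¹ : Circle) : ℂ) * (χ (⟨h, hh⟩ : H)⁻¹ : ℂ) = 1 := by
    rw [← Complex.normSq_eq_conj_mul_self, Circle.normSq_coe]
    simp
  linear_combination (starRingEnd ℂ (F g) * F' g) * this

theorem translate_mem (a : G) {F : G → ℂ} (hF : F ∈ ccSections H χ) :
    (fun x => F (a⁻¹ * x)) ∈ ccSections H χ := by
  refine ⟨hF.1.comp (continuous_const.mul continuous_id), fun g h => ?_, ?_⟩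
  · have := hF.2.1 (a⁻¹ * g) h
    rwa [mul_assoc] at this
  · refine (hF.2.2.smul a).of_isClosed_subset isClosed_closure ?_
    rw [← closure_smul]
    refine closure_mono ?_
    rintro _ ⟨g, hg, rfl⟩
    exact ⟨((a⁻¹ * g : G) : G ⧸ H), ⟨a⁻¹ * g, hg, rfl⟩, by
      simp⟩

variable [MeasurableSpace G] [BorelSpace G] (H χ)
  (μ : Measure (G ⧸ H)) [IsFiniteMeasureOnCompacts μ] [SMulInvariantMeasure G (G ⧸ H) μ]

/-- `C_c(G/H, χ)`, to be normed by `‖F‖² = ∫_{G/H} |F|² dμ`. -/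
@[nolint unusedArguments]
def IndPre (_μ : Measure (G ⧸ H)) : Type _ := ccSections H χ

instance : AddCommGroup (IndPre H χ μ) := inferInstanceAs (AddCommGroup (ccSections H χ))
instance : Module ℂ (IndPre H χ μ) := inferInstanceAs (Module ℂ (ccSections H χ))

variable {H χ μ}

/-- The underlying function on `G`. -/
def IndPre.fn (F : IndPre H χ μ) : G → ℂ := F.1

theorem IndPre.fn_add (F F' : IndPre H χ μ) : (F + F').fn = F.fn + F'.fn := rfl
theorem IndPre.fn_smul (c : ℂ) (F : IndPre H χ μ) : (c • F).fn = c • F.fn := rfl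
theorem IndPre.covariant (F : IndPre H χ μ) : Covariant H χ F.fn := F.2.2.1

theorem IndPre.integrable_inner (F F' : IndPre H χ μ) :
    Integrable (descend H fun g => starRingEnd ℂ (F.fn g) * F'.fn g) μ := by
  have hinv := F.covariant.rightInvariant_inner F'.covariant
  refine Continuous.integrable_of_hasCompactSupport
    (continuous_descend hinv ((Complex.continuous_conj.comp F.2.1).mul F'.2.1)) ?_
  refine F.2.2.2.of_isClosed_subset isClosed_closure (closure_mono ?_)
  intro x hx
  induction x using QuotientGroup.induction_on with
  | H g =>
    rw [Function.mem_support, descend_mk hinv] at hx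
    refine ⟨g, fun h0 => hx ?_, rfl⟩
    have h0' : F.fn g = 0 := h0
    simp [h0']

/-- The inner product `∫_{G/H} conj(F) F' dμ`, conjugate linear in the first variable. -/
@[reducible] def indCore : PreInnerProductSpace.Core ℂ (IndPre H χ μ) where
  inner F F' := ∫ x, descend H (fun g => starRingEnd ℂ (F.fn g) * F'.fn g) x ∂μ
  conj_inner_symm F F' := by
    rw [← integral_conj]
    congr 1
    funext x
    simp [descend, mul_comm]
  re_inner_nonneg F := by
    have : ∀ x, descend H (fun g => starRingEnd ℂ (F.fn g) * F.fn g) x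
        = ((descend H (fun g => Complex.normSq (F.fn g)) x : ℝ) : ℂ) := fun x => by
      simp [descend, Complex.normSq_eq_conj_mul_self]
    simp_rw [this]
    rw [integral_complex_ofReal]
    simp only [RCLike.re_to_complex, Complex.ofReal_re]
    exact integral_nonneg fun x => Complex.normSq_nonneg _
  add_left F₁ F₂ F := by
    rw [← integral_add (F₁.integrable_inner F) (F₂.integrable_inner F)]
    congr 1
    funext x
    simp [descend, IndPre.fn_add, add_mul]
  smul_left F F' c := by
    rw [← integral_const_mul]
    congr 1
    funext x
    simp [descend, IndPre.fn_smul, mul_assoc]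

instance : SeminormedAddCommGroup (IndPre H χ μ) :=
  @InnerProductSpace.Core.toSeminormedAddCommGroup ℂ (IndPre H χ μ) _ _ _ indCore
instance : InnerProductSpace ℂ (IndPre H χ μ) := InnerProductSpace.ofCore indCore

theorem IndPre.norm_def (F : IndPre H χ μ) : ‖F‖ =
    √(RCLike.re (∫ x, descend H (fun g => starRingEnd ℂ (F.fn g) * F.fn g) x ∂μ)) := rfl

variable (H χ μ) in
/-- The Hilbert space of `Ind_H^G χ`: the completion of `C_c(G/H, χ)`. -/
abbrev IndSpace : Type _ := UniformSpace.Completion (IndPre H χ μ)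

/-- Left translation by `a` on `C_c(G/H, χ)`: `(a F)(x) = F (a⁻¹ x)`. -/
def indTranslate (a : G) : IndPre H χ μ →ₗᵢ[ℂ] IndPre H χ μ where
  toFun F := ⟨fun x => F.fn (a⁻¹ * x), translate_mem a F.2⟩
  map_add' _ _ := rfl
  map_smul' _ _ := rfl
  norm_map' F := by
    have hinv := F.covariant.rightInvariant_inner F.covariant
    let F' : IndPre H χ μ := ⟨fun x => F.fn (a⁻¹ * x), translate_mem a F.2⟩
    have hinv' := F'.covariant.rightInvariant_inner F'.covariant
    change ‖F'‖ = ‖F‖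
    rw [IndPre.norm_def, IndPre.norm_def,
      ← integral_smul_eq_self (descend H fun g => starRingEnd ℂ (F.fn g) * F.fn g) (g := a⁻¹)]
    congr 3
    funext x
    induction x using QuotientGroup.induction_on with
    | H g =>
      rw [descend_mk hinv']
      exact (descend_mk hinv (a⁻¹ * g)).symm

variable (H χ μ) in
/-- The operator `(Ind_H^G χ)(a)`: the continuous extension of left translation by `a` to the
completion. -/
def indRep (a : G) : IndSpace H χ μ →L[ℂ] IndSpace H χ μ :=
  ((UniformSpace.Completion.toComplₗᵢ (𝕜 := ℂ) (E := IndPre H χ μ)).toContinuousLinearMap.comp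
    (indTranslate a).toContinuousLinearMap).extend
      (UniformSpace.Completion.toComplL (𝕜 := ℂ) (E := IndPre H χ μ))

theorem indRep_coe (a : G) (F : IndPre H χ μ) :
    indRep H χ μ a (F : IndSpace H χ μ) = ((indTranslate a F : IndPre H χ μ) : IndSpace H χ μ) :=
  ContinuousLinearMap.extend_eq _ UniformSpace.Completion.denseRange_coe
    (UniformSpace.Completion.isUniformInducing_coe _) F

theorem norm_indRep_apply (a : G) (v : IndSpace H χ μ) : ‖indRep H χ μ a v‖ = ‖v‖ := by
  induction v using UniformSpace.Completion.induction_on with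
  | hp => exact isClosed_eq (by fun_prop) (by fun_prop)
  | ih F => rw [indRep_coe, UniformSpace.Completion.norm_coe, UniformSpace.Completion.norm_coe,
      LinearIsometry.norm_map]

theorem norm_indRep_le (a : G) : ‖indRep H χ μ a‖ ≤ 1 :=
  ContinuousLinearMap.opNorm_le_bound _ zero_le_one fun v => by
    rw [norm_indRep_apply, one_mul]

/-- The element `v` of the completion is the class of the function `F` on `G`: `F` is measurable
and covariant, and `v` is the limit of some `φ k ∈ C_c(G/H, χ)` with
`∫_{G/H} |F - φ k|² dμ → 0`. -/
def Represents (v : IndSpace H χ μ) (F : G → ℂ) : Prop :=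
  Measurable F ∧ Covariant H χ F ∧ ∃ φ : ℕ → IndPre H χ μ,
    Tendsto (fun k => ∫⁻ x, descend H (fun g => ‖F g - (φ k).fn g‖ₑ ^ 2) x ∂μ) atTop (𝓝 0) ∧
    Tendsto (fun k => (φ k : IndSpace H χ μ)) atTop (𝓝 v)

end Induced

/-! ### The quasi-regular representation -/

section QuasiRegular

variable {G : Type*} [Group G] [TopologicalSpace G] [IsTopologicalGroup G]
  [MeasurableSpace G] [BorelSpace G] {Γ : Subgroup G} (ν : Measure (G ⧸ Γ))

/-- `τ = Ind_Γ^G 1` on `L²(G/Γ)`: `(τ(a) f)(g) = f(a⁻¹ g)`. -/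
def quasiRegular [SMulInvariantMeasure G (G ⧸ Γ) ν] (a : G) : Lp ℂ 2 ν →ₗᵢ[ℂ] Lp ℂ 2 ν :=
  Lp.compMeasurePreservingₗᵢ ℂ (fun x : G ⧸ Γ => a⁻¹ • x) (measurePreserving_smul a⁻¹ ν)

/-- The class in `L²(G/Γ)` of a continuous function on the compact space `G/Γ`. -/
def toL2 [CompactSpace (G ⧸ Γ)] [IsFiniteMeasure ν] (ξ : C(G ⧸ Γ, ℂ)) : Lp ℂ 2 ν :=
  MemLp.toLp ξ (MemLp.of_bound ξ.continuous.aestronglyMeasurable ‖ξ‖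
    (Eventually.of_forall ξ.norm_coe_le_norm))

end QuasiRegular

/-! ### The representation `ρ` and the operator `U` -/

section Rho

variable {n : ℕ} {G : Type*} [TopologicalSpace G] [ChartedSpace (EuclideanSpace ℝ (Fin n)) G]
  [Group G] [IsTopologicalGroup G] [MeasurableSpace G] [BorelSpace G]

/-- The restriction of `χ_l` to a subgroup. -/
def chiOn (M : Subgroup G) (l : Module.Dual ℝ (GroupLieAlgebra (𝓡 n) G)) : M → Circle :=
  fun m => chi l (m : G)

variable (M : Subgroup G) (μ : Measure (G ⧸ M)) [IsFiniteMeasureOnCompacts μ]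
  [SMulInvariantMeasure G (G ⧸ M) μ] (S L : Set (Module.Dual ℝ (GroupLieAlgebra (𝓡 n) G)))

/-- The Hilbert space `⨁_{l ∈ S} Ind_M^G χ_l ⊕ ⨁_{l ∈ L} ℂ` (Hilbert direct sums). -/
abbrev RhoSpace : Type _ :=
  WithLp 2 (lp (fun l : S => IndSpace M (chiOn M l.1) μ) 2 × lp (fun _ : L => ℂ) 2)

/-- `ρ(a) = ⨁_{l ∈ S} (Ind_M^G χ_l)(a) ⊕ ⨁_{l ∈ L} χ_l(a)`, acting componentwise. -/
def rho (a : G) : RhoSpace M μ S L →L[ℂ] RhoSpace M μ S L :=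
  (WithLp.prodContinuousLinearEquiv 2 ℂ _ _).symm.toContinuousLinearMap ∘L
    ((lp.mapCLM 2 (fun l : S => indRep M (chiOn M l.1) μ a) zero_le_one
        fun _ => norm_indRep_le a).prodMap
      (lp.mapCLM 2 (fun l : L => (chi l.1 a : ℂ) • ContinuousLinearMap.id ℂ ℂ) zero_le_one
        fun l => by
          refine (norm_smul_le _ _).trans ?_
          rw [Circle.norm_coe, one_mul]
          exact ContinuousLinearMap.norm_id_le)) ∘L
    (WithLp.prodContinuousLinearEquiv 2 ℂ _ _).toContinuousLinearMap

theorem rho_fst (a : G) (v : RhoSpace M μ S L) (l : S) :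
    (rho M μ S L a v).fst l = indRep M (chiOn M l.1) μ a (v.fst l) := rfl

theorem rho_snd (a : G) (v : RhoSpace M μ S L) (l : L) :
    (rho M μ S L a v).snd l = (chi l.1 a : ℂ) * v.snd l := rfl

variable {Γ : Subgroup G}

/-- The integrand `m ↦ ξ(g m) χ_l(m)`. -/
def integrand (ξ : C(G ⧸ Γ, ℂ)) (l : Module.Dual ℝ (GroupLieAlgebra (𝓡 n) G)) (g : G) : G → ℂ :=
  fun m => ξ ((g * m : G) : G ⧸ Γ) * (chi l m : ℂ)

/-- `∫_{M / M ∩ Γ} ξ(g m) χ_l(m) dκ`. -/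
def uGeneric (κ : Measure (M ⧸ Γ.subgroupOf M)) (ξ : C(G ⧸ Γ, ℂ))
    (l : Module.Dual ℝ (GroupLieAlgebra (𝓡 n) G)) (g : G) : ℂ :=
  ∫ x, descend (Γ.subgroupOf M) (fun m : M => integrand ξ l g m) x ∂κ

/-- `∫_{G / Γ} ξ(g m) χ_l(m) dν`. -/
def uNonGeneric (ν : Measure (G ⧸ Γ)) (ξ : C(G ⧸ Γ, ℂ))
    (l : Module.Dual ℝ (GroupLieAlgebra (𝓡 n) G)) (g : G) : ℂ :=
  ∫ x, descend Γ (integrand ξ l g) x ∂ν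

end Rho

end Nilmanifold

end

open Nilmanifold

/-! Put `T = X_n`, let `v ∈ ℝᵈ` be the coordinates on `𝔪`, and write `e t = exp (tT)` and `m v` for
the exponential of the vector of `𝔪` with coordinates `v`. The map `(t, v) ↦ e t * m v` identifies
`G` with a semidirect product `ℝ ⋉ ℝᵈ`, where `ℝ` acts by the unipotent maps `A_t = exp (tD)` and
`D` is the matrix of `ad T` on `𝔪`. Under this identification `Γ` is the set of integral points, `M`
is the fiber `ℝᵈ`, and all invariant measures become Lebesgue measure, restricted to a unit cube for
the compact quotients.

For continuous `ξ` on `G/Γ` the function `v ↦ ξ(g m(v))` is `ℤᵈ`-periodic. Its Fourier coefficients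
`c_z(g)` are the values `U(ξ)(l)(g)` when `l` has integral coordinates `z` on `𝔪`. Parseval on the
torus gives `‖ξ‖² = Σ_z ∫₀¹ |c_z(e t)|² dt`. Conjugating by `e k ∈ Γ` gives the key relation `c_z(g
e(k)) = c_{z ∘ A₋ₖ}(g)`, so integers permute the coefficients.

If `z ∘ D ≠ 0`, unipotence makes the `ℤ`-orbit of `z` free, and the unit intervals belonging to its
points glue to `∫_ℝ |c_z(e t)|² dt`. This is the squared norm of `c_z` in the induced
representation, because `G/M` is the line. As `𝔪` is abelian, `M` acts trivially on functionals on
`𝔪`; hence `Γ`-orbits are `ℤ`-orbits and `Σ` contributes one `z` for each of them. If `z ∘ D = 0`,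
then `t ↦ c_z(e t)` is 1-periodic, and Parseval on the circle splits it into the characters in `Λ`
that restrict to `z`. Adding both contributions gives `‖U ξ‖ = ‖ξ‖`. Left translation visibly
commutes with the integrals defining `U`, and density of `C(G/Γ)` in `L²` yields `V`.

The Lie-theoretic input is `LieSplitting.lieAd_e` (`Ad` integrates `ad`),
`LieSplitting.isHomeomorph` (a covering argument from simple connectedness) and
`LieSplitting.lieExp_add_b` (a closed formula for `exp`, needed to evaluate `chi`). The analysis
rests on `SemidirectCoords.IsIntegral.measure_eq`, `SemidirectCoords.lintegral_eq_tsum_coeff`,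
`SemidirectCoords.coeff_mul_e` and `indEquiv`; the orbit count is `exists_crossSection_equiv`, and
everything meets in `LieSplitting.tsum_components`. -/

noncomputable section

namespace Nilmanifold

/-! ### The group law in a chart at the identity, and velocities of curves. -/

section Chart

variable {n : ℕ} {G : Type*} [TopologicalSpace G] [ChartedSpace (EuclideanSpace ℝ (Fin n)) G]
  [Group G] [LieGroup (𝓡 n) ∞ G]

variable (n G) in
/-- The chart at the identity. -/
def oneChart : G → EuclideanSpace ℝ (Fin n) := extChartAt (𝓡 n) (1 : G)

variable (n G) in
/-- The inverse of the chart at the identity. -/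
def oneChartSymm : EuclideanSpace ℝ (Fin n) → G := (extChartAt (𝓡 n) (1 : G)).symm

variable (n G) in
/-- The multiplication of `G`, read in the chart at the identity. -/
def chartMul (p : EuclideanSpace ℝ (Fin n) × EuclideanSpace ℝ (Fin n)) :
    EuclideanSpace ℝ (Fin n) :=
  oneChart n G (oneChartSymm n G p.1 * oneChartSymm n G p.2)

variable (n G) in
/-- The conjugation `(g, h) ↦ g h g⁻¹`, read in the chart at the identity. -/
def chartConj (p : EuclideanSpace ℝ (Fin n) × EuclideanSpace ℝ (Fin n)) :
    EuclideanSpace ℝ (Fin n) :=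
  oneChart n G (oneChartSymm n G p.1 * oneChartSymm n G p.2 * (oneChartSymm n G p.1)⁻¹)

@[simp] theorem oneChartSymm_oneChart_one : oneChartSymm n G (oneChart n G 1) = 1 :=
  (extChartAt (𝓡 n) (1 : G)).left_inv (mem_extChartAt_source _)

theorem eventually_oneChartSymm_oneChart :
    ∀ᶠ g in 𝓝 (1 : G), oneChartSymm n G (oneChart n G g) = g := by
  filter_upwards [extChartAt_source_mem_nhds (I := 𝓡 n) (1 : G)] with g hg
  exact (extChartAt (𝓡 n) (1 : G)).left_inv hg

theorem contMDiffAt_oneChart : ContMDiffAt (𝓡 n) 𝓘(ℝ, EuclideanSpace ℝ (Fin n)) ∞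
    (oneChart n G) (1 : G) :=
  have : IsManifold (𝓡 n) ∞ G := ContMDiffMul.toIsManifold
  contMDiffAt_extChartAt

theorem contMDiffAt_oneChartSymm : ContMDiffAt 𝓘(ℝ, EuclideanSpace ℝ (Fin n)) (𝓡 n) ∞
    (oneChartSymm n G) (oneChart n G (1 : G)) := by
  have : IsManifold (𝓡 n) ∞ G := ContMDiffMul.toIsManifold
  exact (contMDiffOn_extChartAt_symm (1 : G)).contMDiffAt (extChartAt_target_mem_nhds (1 : G))

theorem continuousAt_oneChart : ContinuousAt (oneChart n G) (1 : G) :=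
  contMDiffAt_oneChart.continuousAt

theorem continuousAt_oneChartSymm :
    ContinuousAt (oneChartSymm n G) (oneChart n G (1 : G)) :=
  contMDiffAt_oneChartSymm.continuousAt

theorem contMDiffAt_oneChartSymm_fst :
    ContMDiffAt (𝓘(ℝ, EuclideanSpace ℝ (Fin n)).prod 𝓘(ℝ, EuclideanSpace ℝ (Fin n))) (𝓡 n) ∞
      (fun p : EuclideanSpace ℝ (Fin n) × EuclideanSpace ℝ (Fin n) => oneChartSymm n G p.1)
      (oneChart n G (1 : G), oneChart n G (1 : G)) :=
  ContMDiffAt.comp (g := oneChartSymm n G) (I' := 𝓘(ℝ, EuclideanSpace ℝ (Fin n)))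
    (oneChart n G (1 : G), oneChart n G (1 : G)) contMDiffAt_oneChartSymm contMDiffAt_fst

theorem contMDiffAt_oneChartSymm_snd :
    ContMDiffAt (𝓘(ℝ, EuclideanSpace ℝ (Fin n)).prod 𝓘(ℝ, EuclideanSpace ℝ (Fin n))) (𝓡 n) ∞
      (fun p : EuclideanSpace ℝ (Fin n) × EuclideanSpace ℝ (Fin n) => oneChartSymm n G p.2)
      (oneChart n G (1 : G), oneChart n G (1 : G)) :=
  ContMDiffAt.comp (g := oneChartSymm n G) (I' := 𝓘(ℝ, EuclideanSpace ℝ (Fin n)))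
    (oneChart n G (1 : G), oneChart n G (1 : G)) contMDiffAt_oneChartSymm contMDiffAt_snd

theorem contDiffAt_chartMul :
    ContDiffAt ℝ ∞ (chartMul n G) (oneChart n G (1 : G), oneChart n G (1 : G)) := by
  have h := ContMDiffAt.comp (I' := 𝓡 n) (g := oneChart n G) (oneChart n G (1 : G), oneChart n G (1 : G))
    (by simpa using contMDiffAt_oneChart)
    (contMDiffAt_oneChartSymm_fst.mul contMDiffAt_oneChartSymm_snd)
  rw [← modelWithCornersSelf_prod, chartedSpaceSelf_prod] at h
  exact h.contDiffAt

theorem contDiffAt_chartConj :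
    ContDiffAt ℝ ∞ (chartConj n G) (oneChart n G (1 : G), oneChart n G (1 : G)) := by
  have h := ContMDiffAt.comp (I' := 𝓡 n) (g := oneChart n G) (oneChart n G (1 : G), oneChart n G (1 : G))
    (by simpa using contMDiffAt_oneChart)
    ((contMDiffAt_oneChartSymm_fst.mul contMDiffAt_oneChartSymm_snd).mul
      contMDiffAt_oneChartSymm_fst.inv)
  rw [← modelWithCornersSelf_prod, chartedSpaceSelf_prod] at h
  exact h.contDiffAt

/-- `γ` is a curve through `1` with velocity `X` there. -/
def HasVelocity (γ : ℝ → G) (X : EuclideanSpace ℝ (Fin n)) : Prop :=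
  γ 0 = 1 ∧ ContinuousAt γ 0 ∧ HasDerivAt (fun t => oneChart n G (γ t)) X 0

theorem HasVelocity.hasMFDerivAt {γ : ℝ → G} {X : EuclideanSpace ℝ (Fin n)}
    (h : HasVelocity γ X) :
    HasMFDerivAt 𝓘(ℝ, ℝ) (𝓡 n) γ 0 ((1 : ℝ →L[ℝ] ℝ).smulRight X) := by
  obtain ⟨h0, h1, h2⟩ := h
  refine ⟨h1, ?_⟩
  have : writtenInExtChartAt 𝓘(ℝ, ℝ) (𝓡 n) 0 γ = fun t => oneChart n G (γ t) := by
    funext t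
    simp only [writtenInExtChartAt, h0, oneChart]
    rfl
  rw [this]
  have h3 := h2.hasFDerivAt
  exact h3.hasFDerivWithinAt

theorem hasVelocity_of_hasMFDerivAt {γ : ℝ → G} {X : EuclideanSpace ℝ (Fin n)} (h0 : γ 0 = 1)
    (h : HasMFDerivAt 𝓘(ℝ, ℝ) (𝓡 n) γ 0 ((1 : ℝ →L[ℝ] ℝ).smulRight X)) :
    HasVelocity γ X := by
  obtain ⟨h1, h2⟩ := h
  refine ⟨h0, h1, ?_⟩
  have : writtenInExtChartAt 𝓘(ℝ, ℝ) (𝓡 n) 0 γ = fun t => oneChart n G (γ t) := by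
    funext t
    simp only [writtenInExtChartAt, h0, oneChart]
    rfl
  rw [this] at h2
  have h3 : HasFDerivAt (fun t => oneChart n G (γ t)) ((1 : ℝ →L[ℝ] ℝ).smulRight X) 0 := by
    have := h2.hasFDerivAt (by simp)
    exact this
  simpa using h3.hasDerivAt

end Chart
end Nilmanifold
end

/-! ### The derivative of the adjoint action is the Lie bracket. -/

noncomputable section

namespace Nilmanifold

section Chart

variable {n : ℕ} {G : Type*} [TopologicalSpace G] [ChartedSpace (EuclideanSpace ℝ (Fin n)) G]
  [Group G] [LieGroup (𝓡 n) ∞ G]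

theorem comp_smulRight_one {E F : Type*} [NormedAddCommGroup E] [NormedSpace ℝ E]
    [NormedAddCommGroup F] [NormedSpace ℝ F] (L : E →L[ℝ] F) (X : E) :
    L.comp ((1 : ℝ →L[ℝ] ℝ).smulRight X) = (1 : ℝ →L[ℝ] ℝ).smulRight (L X) := by
  ext
  simp

theorem mdifferentiable_mul_left (g : G) :
    MDifferentiable (𝓡 n) (𝓡 n) (fun x : G => g * x) :=
  (contMDiff_mul_left (I := 𝓡 n) (n := ∞) (a := g)).mdifferentiable (by simp)

theorem mdifferentiable_conj (g : G) :
    MDifferentiable (𝓡 n) (𝓡 n) (fun x : G => g * x * g⁻¹) :=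
  ((contMDiff_mul_right (I := 𝓡 n) (n := ∞)).comp
    (contMDiff_mul_left (I := 𝓡 n) (n := ∞) (a := g))).mdifferentiable (by simp)

theorem HasVelocity.mul_left {γ : ℝ → G} {X : EuclideanSpace ℝ (Fin n)}
    (h : HasVelocity γ X) (g : G) :
    HasMFDerivAt 𝓘(ℝ, ℝ) (𝓡 n) (fun t => g * γ t) 0
      ((1 : ℝ →L[ℝ] ℝ).smulRight
        (mulInvariantVectorField (I := 𝓡 n) (X : GroupLieAlgebra (𝓡 n) G) g)) := by
  have h1 := h.hasMFDerivAt
  have h2 := (mdifferentiable_mul_left (n := n) g (1 : G)).hasMFDerivAt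
  rw [← h.1] at h2
  have h3 := h2.comp 0 h1
  rw [h.1] at h3
  exact h3.congr_mfderiv (comp_smulRight_one (E := EuclideanSpace ℝ (Fin n))
    (F := EuclideanSpace ℝ (Fin n)) (mfderiv (𝓡 n) (𝓡 n) (fun x : G => g * x) (1 : G)) X)

theorem HasVelocity.conj {γ : ℝ → G} {X : EuclideanSpace ℝ (Fin n)}
    (h : HasVelocity γ X) (g : G) :
    HasVelocity (fun t => g * γ t * g⁻¹) (lieAd g (X : GroupLieAlgebra (𝓡 n) G)) := by
  refine hasVelocity_of_hasMFDerivAt (by simp [h.1]) ?_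
  have h1 := h.hasMFDerivAt
  have h2 := (mdifferentiable_conj (n := n) g (1 : G)).hasMFDerivAt
  rw [← h.1] at h2
  have h3 := h2.comp 0 h1
  rw [h.1] at h3
  exact h3.congr_mfderiv (comp_smulRight_one (E := EuclideanSpace ℝ (Fin n))
    (F := EuclideanSpace ℝ (Fin n)) (mfderiv (𝓡 n) (𝓡 n) (fun x : G => g * x * g⁻¹) (1 : G)) X)

theorem HasVelocity.unique {γ : ℝ → G} {X Y : EuclideanSpace ℝ (Fin n)}
    (h : HasVelocity γ X) (h' : HasVelocity γ Y) : X = Y :=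
  h.2.2.unique h'.2.2

-- Straight lines in the chart realize every vector as a velocity, so the bracket can be computed
-- before integral curves are available.
variable (G) in
theorem hasVelocity_oneChartSymm (X : EuclideanSpace ℝ (Fin n)) :
    HasVelocity (fun t : ℝ => oneChartSymm n G (oneChart n G (1 : G) + t • X)) X := by
  have hc : ContinuousAt (fun t : ℝ => oneChart n G (1 : G) + t • X) 0 := by fun_prop
  refine ⟨by simp, ?_, ?_⟩
  · refine ContinuousAt.comp (g := oneChartSymm n G) ?_ hc
    simpa using continuousAt_oneChartSymm
  · have h1 : HasDerivAt (fun t : ℝ => oneChart n G (1 : G) + t • X) X 0 := by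
      simpa using ((hasDerivAt_id (0 : ℝ)).smul_const X).const_add (oneChart n G (1 : G))
    refine h1.congr_of_eventuallyEq ?_
    have h2 : ∀ᶠ t : ℝ in 𝓝 0, oneChart n G (1 : G) + t • X ∈ (extChartAt (𝓡 n) (1 : G)).target :=
      hc (by
        simp only [zero_smul, add_zero]
        exact extChartAt_target_mem_nhds (I := 𝓡 n) (1 : G))
    filter_upwards [h2] with t ht
    exact (extChartAt (𝓡 n) (1 : G)).right_inv ht

theorem hasDerivAt_snd_of_contDiffAt {E F : Type*} [NormedAddCommGroup E] [NormedSpace ℝ E]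
    [NormedAddCommGroup F] [NormedSpace ℝ F] {f : E × E → F} {x y : E}
    (hf : DifferentiableAt ℝ f (x, y)) (Y : E) :
    HasDerivAt (fun t : ℝ => f (x, y + t • Y)) (fderiv ℝ f (x, y) (0, Y)) 0 := by
  have h1 : HasDerivAt (fun t : ℝ => (x, y + t • Y)) ((0 : E), Y) 0 := by
    refine (hasDerivAt_const _ _).prodMk ?_
    simpa using ((hasDerivAt_id (0 : ℝ)).smul_const Y).const_add y
  have h2 : HasFDerivAt f (fderiv ℝ f (x, y)) (x, y + (0 : ℝ) • Y) := by
    simpa using hf.hasFDerivAt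
  exact h2.comp_hasDerivAt 0 h1

/-- Exhibits `Ad` near the identity as a partial derivative of a smooth map, which makes it
differentiable in the group element. -/
theorem lieAd_oneChartSymm : ∀ᶠ x in 𝓝 (oneChart n G (1 : G)), ∀ Y : EuclideanSpace ℝ (Fin n),
    lieAd (oneChartSymm n G x) (Y : GroupLieAlgebra (𝓡 n) G) =
      fderiv ℝ (chartConj n G) (x, oneChart n G (1 : G)) (0, Y) := by
  have h1 : ∀ᶠ p in 𝓝 (oneChart n G (1 : G), oneChart n G (1 : G)),
      DifferentiableAt ℝ (chartConj n G) p :=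
    (((contDiffAt_chartConj (n := n) (G := G)).of_le (m := 1) (by simp)).eventually (by simp)).mono
      fun p hp => hp.differentiableAt (by simp)
  have h2 : Tendsto (fun x => (x, oneChart n G (1 : G))) (𝓝 (oneChart n G (1 : G)))
      (𝓝 (oneChart n G (1 : G), oneChart n G (1 : G))) :=
    (continuous_id.prodMk continuous_const).tendsto _
  filter_upwards [h2.eventually h1] with x hx Y
  exact ((hasVelocity_oneChartSymm G Y).conj (oneChartSymm n G x)).2.2.unique
    (hasDerivAt_snd_of_contDiffAt hx Y)

/-- The curve `t ↦ g * σ t`, with `σ` a chart line through `1`, has the left invariant field as its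
velocity at `g`, and in the chart it is a slice of `chartMul`. Pulling back along the inverse chart
amounts to applying the derivative of the chart. -/
theorem mpullback_oneChartSymm : ∀ᶠ x in 𝓝 (oneChart n G (1 : G)),
    ∀ Y : EuclideanSpace ℝ (Fin n),
    VectorField.mpullbackWithin 𝓘(ℝ, EuclideanSpace ℝ (Fin n)) (𝓡 n)
      (extChartAt (𝓡 n) (1 : G)).symm
      (mulInvariantVectorField (Y : GroupLieAlgebra (𝓡 n) G)) (Set.range (𝓡 n)) x =
      fderiv ℝ (chartMul n G) (x, oneChart n G (1 : G)) (0, Y) := by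
  have : IsManifold (𝓡 n) ∞ G := ContMDiffMul.toIsManifold
  have : IsManifold (𝓡 n) 1 G := IsManifold.of_le (n := ∞) (by simp)
  have h1 : ∀ᶠ p in 𝓝 (oneChart n G (1 : G), oneChart n G (1 : G)),
      DifferentiableAt ℝ (chartMul n G) p :=
    (((contDiffAt_chartMul (n := n) (G := G)).of_le (m := 1) (by simp)).eventually (by simp)).mono
      fun p hp => hp.differentiableAt (by simp)
  have h2 : Tendsto (fun x => (x, oneChart n G (1 : G))) (𝓝 (oneChart n G (1 : G)))
      (𝓝 (oneChart n G (1 : G), oneChart n G (1 : G))) :=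
    (continuous_id.prodMk continuous_const).tendsto _
  filter_upwards [h2.eventually h1, extChartAt_target_mem_nhds (I := 𝓡 n) (1 : G)] with x hx hxt Y
  rw [VectorField.mpullbackWithin_apply]
  have hsrc : (extChartAt (𝓡 n) (1 : G)).symm x ∈ (extChartAt (𝓡 n) (1 : G)).source :=
    (extChartAt (𝓡 n) (1 : G)).map_target hxt
  have hinv : (mfderivWithin 𝓘(ℝ, EuclideanSpace ℝ (Fin n)) (𝓡 n)
      (extChartAt (𝓡 n) (1 : G)).symm (Set.range (𝓡 n)) x).inverse =
      mfderiv (𝓡 n) 𝓘(ℝ, EuclideanSpace ℝ (Fin n)) (extChartAt (𝓡 n) (1 : G))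
        ((extChartAt (𝓡 n) (1 : G)).symm x) := by
    apply ContinuousLinearMap.inverse_eq
    · exact mfderivWithin_extChartAt_symm_comp_mfderiv_extChartAt hxt
    · exact mfderiv_extChartAt_comp_mfderivWithin_extChartAt_symm hxt
  rw [hinv]
  have h3 := (hasVelocity_oneChartSymm G Y).mul_left (oneChartSymm n G x)
  have h4 := (mdifferentiableAt_extChartAt (I := 𝓡 n)
    (by rwa [extChartAt_source] at hsrc)).hasMFDerivAt
  have h5 : oneChartSymm n G x * oneChartSymm n G (oneChart n G (1 : G) + (0 : ℝ) • Y) =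
    (extChartAt (𝓡 n) (1 : G)).symm x := by
    rw [show oneChart n G (1 : G) + (0 : ℝ) • Y = oneChart n G 1 by simp,
      oneChartSymm_oneChart_one, mul_one]
    rfl
  let L : EuclideanSpace ℝ (Fin n) →L[ℝ] EuclideanSpace ℝ (Fin n) :=
    mfderiv (𝓡 n) 𝓘(ℝ, EuclideanSpace ℝ (Fin n)) (extChartAt (𝓡 n) (1 : G))
      ((extChartAt (𝓡 n) (1 : G)).symm x)
  let V : EuclideanSpace ℝ (Fin n) :=
    mulInvariantVectorField (I := 𝓡 n) (Y : GroupLieAlgebra (𝓡 n) G) (oneChartSymm n G x)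
  have h4' : HasMFDerivAt (𝓡 n) 𝓘(ℝ, EuclideanSpace ℝ (Fin n)) (extChartAt (𝓡 n) (1 : G))
      (oneChartSymm n G x * oneChartSymm n G (oneChart n G (1 : G) + (0 : ℝ) • Y)) L := by
    rw [h5]
    exact h4
  have h6 : HasFDerivAt (fun t : ℝ => chartMul n G (x, oneChart n G (1 : G) + t • Y))
      ((1 : ℝ →L[ℝ] ℝ).smulRight (L V)) 0 :=
    ((h4'.comp (0 : ℝ) h3).congr_mfderiv (comp_smulRight_one L V)).hasFDerivAt
  have h7 := h6.hasDerivAt.unique (hasDerivAt_snd_of_contDiffAt hx Y)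
  rw [← h7]
  exact (one_smul ℝ (L V)).symm

theorem chartMul_oneChart_right : ∀ᶠ x in 𝓝 (oneChart n G (1 : G)),
    chartMul n G (x, oneChart n G (1 : G)) = x := by
  filter_upwards [extChartAt_target_mem_nhds (I := 𝓡 n) (1 : G)] with x hx
  simp only [chartMul, oneChartSymm_oneChart_one, mul_one]
  exact (extChartAt (𝓡 n) (1 : G)).right_inv hx

theorem chartMul_oneChart_left : ∀ᶠ x in 𝓝 (oneChart n G (1 : G)),
    chartMul n G (oneChart n G (1 : G), x) = x := by
  filter_upwards [extChartAt_target_mem_nhds (I := 𝓡 n) (1 : G)] with x hx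
  simp only [chartMul, oneChartSymm_oneChart_one, one_mul]
  exact (extChartAt (𝓡 n) (1 : G)).right_inv hx

theorem differentiableAt_chartMul :
    DifferentiableAt ℝ (chartMul n G) (oneChart n G (1 : G), oneChart n G (1 : G)) :=
  contDiffAt_chartMul.differentiableAt (by simp)

/-- As `1` is a two-sided unit, both slices of `chartMul` through it are the identity map. -/
theorem fderiv_chartMul_apply (V W : EuclideanSpace ℝ (Fin n)) :
    fderiv ℝ (chartMul n G) (oneChart n G (1 : G), oneChart n G (1 : G)) (V, W) = V + W := by
  set x₀ := oneChart n G (1 : G)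
  have h := (differentiableAt_chartMul (n := n) (G := G)).hasFDerivAt
  have h1 : fderiv ℝ (chartMul n G) (x₀, x₀) (0, W) = W := by
    have h2 : HasFDerivAt (fun y => chartMul n G (x₀, y)) _ x₀ :=
      h.comp x₀ (hasFDerivAt_prodMk_right x₀ x₀)
    have h3 := (h2.congr_of_eventuallyEq
      (chartMul_oneChart_left.mono fun x hx => hx.symm)).unique (hasFDerivAt_id x₀)
    simpa using congrArg (fun L => L W) h3
  have h1' : fderiv ℝ (chartMul n G) (x₀, x₀) (V, 0) = V := by
    have h2 : HasFDerivAt (fun y => chartMul n G (y, x₀)) _ x₀ :=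
      HasFDerivAt.comp (g := chartMul n G) x₀ h (hasFDerivAt_prodMk_left x₀ x₀)
    have h3 := (h2.congr_of_eventuallyEq
      (chartMul_oneChart_right.mono fun x hx => hx.symm)).unique (hasFDerivAt_id x₀)
    simpa using congrArg (fun L => L V) h3
  have : ((V, W) : EuclideanSpace ℝ (Fin n) × EuclideanSpace ℝ (Fin n)) = (V, 0) + (0, W) := by
    simp
  rw [this, map_add, h1, h1']

variable (n G) in
/-- The second derivative of the multiplication at the identity. -/
def chartMulSnd : EuclideanSpace ℝ (Fin n) × EuclideanSpace ℝ (Fin n) →L[ℝ]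
    EuclideanSpace ℝ (Fin n) × EuclideanSpace ℝ (Fin n) →L[ℝ] EuclideanSpace ℝ (Fin n) :=
  fderiv ℝ (fderiv ℝ (chartMul n G)) (oneChart n G (1 : G), oneChart n G (1 : G))

theorem hasFDerivAt_fderiv_chartMul : HasFDerivAt (fderiv ℝ (chartMul n G)) (chartMulSnd n G)
    (oneChart n G (1 : G), oneChart n G (1 : G)) := by
  have h : ContDiffAt ℝ 1 (fderiv ℝ (chartMul n G)) (oneChart n G (1 : G), oneChart n G (1 : G)) :=
    contDiffAt_chartMul.fderiv_right (m := 1) (by norm_num; exact ENat.LEInfty.out)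
  exact (h.differentiableAt (by simp)).hasFDerivAt

theorem chartMulSnd_symm (V W : EuclideanSpace ℝ (Fin n) × EuclideanSpace ℝ (Fin n)) :
    chartMulSnd n G V W = chartMulSnd n G W V :=
  (contDiffAt_chartMul (n := n) (G := G)).isSymmSndFDerivAt (by
    rw [minSmoothness_of_isRCLikeNormedField]
    exact ENat.LEInfty.out) V W

/-- In the chart the left invariant field of `Y` is `x ↦ ∂₂μ(x, 1) Y`, with `μ` the multiplication.
Its derivative along `X` is the mixed second derivative of `μ`, and the bracket of fields
antisymmetrizes it. -/
theorem bracket_eq_chartMulSnd (X Y : GroupLieAlgebra (𝓡 n) G) :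
    (⁅X, Y⁆ : GroupLieAlgebra (𝓡 n) G) =
      chartMulSnd n G ((X : EuclideanSpace ℝ (Fin n)), 0) (0, (Y : EuclideanSpace ℝ (Fin n))) -
      chartMulSnd n G ((Y : EuclideanSpace ℝ (Fin n)), 0) (0, (X : EuclideanSpace ℝ (Fin n))) := by
  have hd (Z : EuclideanSpace ℝ (Fin n)) : HasFDerivAt
      (VectorField.mpullbackWithin 𝓘(ℝ, EuclideanSpace ℝ (Fin n)) (𝓡 n)
      (extChartAt (𝓡 n) (1 : G)).symm
      (mulInvariantVectorField (Z : GroupLieAlgebra (𝓡 n) G)) (Set.range (𝓡 n)) :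
        EuclideanSpace ℝ (Fin n) → EuclideanSpace ℝ (Fin n))
      (((ContinuousLinearMap.apply ℝ (EuclideanSpace ℝ (Fin n))
        ((0, Z) : EuclideanSpace ℝ (Fin n) × EuclideanSpace ℝ (Fin n))).comp
        (chartMulSnd n G)).comp (ContinuousLinearMap.inl ℝ _ _)) (oneChart n G (1 : G)) := by
    have h1 : HasFDerivAt (fun x => fderiv ℝ (chartMul n G) (x, oneChart n G (1 : G)) (0, Z))
      (((ContinuousLinearMap.apply ℝ (EuclideanSpace ℝ (Fin n))
        ((0, Z) : EuclideanSpace ℝ (Fin n) × EuclideanSpace ℝ (Fin n))).comp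
        (chartMulSnd n G)).comp (ContinuousLinearMap.inl ℝ _ _)) (oneChart n G (1 : G)) :=
      HasFDerivAt.comp (g := fun p => fderiv ℝ (chartMul n G) p (0, Z)) _
        (((ContinuousLinearMap.apply ℝ (EuclideanSpace ℝ (Fin n))
          ((0, Z) : EuclideanSpace ℝ (Fin n) × EuclideanSpace ℝ (Fin n))).hasFDerivAt).comp _
          hasFDerivAt_fderiv_chartMul) (hasFDerivAt_prodMk_left _ _)
    exact h1.congr_of_eventuallyEq (mpullback_oneChartSymm.mono fun x hx => hx Z)
  rw [GroupLieAlgebra.bracket_def, VectorField.mlieBracket, VectorField.mlieBracketWithin_apply,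
    mfderiv_extChartAt_self]
  rw [Set.preimage_univ, Set.univ_inter, ModelWithCorners.Boundaryless.range_eq_univ] at *
  refine (congrFun (congrArg DFunLike.coe (ContinuousLinearMap.inverse_id (R := ℝ)
    (M := EuclideanSpace ℝ (Fin n)))) _).trans ?_
  have hv (Z : EuclideanSpace ℝ (Fin n)) : VectorField.mpullbackWithin (𝓡 n) (𝓡 n)
      (extChartAt (𝓡 n) (1 : G)).symm (mulInvariantVectorField (Z : GroupLieAlgebra (𝓡 n) G))
      Set.univ (oneChart n G (1 : G)) = Z := by
    have h := (mpullback_oneChartSymm (n := n) (G := G)).self_of_nhds Z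
    rw [ModelWithCorners.Boundaryless.range_eq_univ] at h
    exact h.trans ((fderiv_chartMul_apply 0 Z).trans (zero_add Z))
  refine (congrFun (VectorField.lieBracketWithin_univ (𝕜 := ℝ)
    (E := EuclideanSpace ℝ (Fin n))) _).trans ?_
  refine (congrArg₂ (· - ·) (congrArg₂ DFunLike.coe (hd Y).fderiv (hv X))
    (congrArg₂ DFunLike.coe (hd X).fderiv (hv Y))).trans ?_
  rfl

/-- Two differentiations of the identity `(x y x⁻¹) x = x y`, in `y` and then in `x`, both at `1`.
This avoids differentiating the inverse. -/
theorem HasVelocity.hasDerivAt_lieAd_chartMulSnd {γ : ℝ → G} {X : EuclideanSpace ℝ (Fin n)}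
    (h : HasVelocity γ X) (Y : EuclideanSpace ℝ (Fin n)) :
    HasDerivAt (F := EuclideanSpace ℝ (Fin n))
      (fun t => lieAd (γ t) (Y : GroupLieAlgebra (𝓡 n) G))
      (chartMulSnd n G (X, 0) (0, Y) - chartMulSnd n G (Y, 0) (0, X)) 0 := by
  set x₀ := oneChart n G (1 : G) with hx₀
  set Z : EuclideanSpace ℝ (Fin n) → EuclideanSpace ℝ (Fin n) :=
    fun x => fderiv ℝ (chartConj n G) (x, x₀) (0, Y) with hZ
  have hZd : DifferentiableAt ℝ Z x₀ := by
    have h1 : ContDiffAt ℝ 1 (fderiv ℝ (chartConj n G)) (x₀, x₀) :=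
      contDiffAt_chartConj.fderiv_right (m := 1) (by norm_num; exact ENat.LEInfty.out)
    have h2 : DifferentiableAt ℝ (fun x => fderiv ℝ (chartConj n G) (x, x₀)) x₀ :=
      DifferentiableAt.comp (g := fderiv ℝ (chartConj n G)) x₀ (h1.differentiableAt (by simp))
        (hasFDerivAt_prodMk_left x₀ x₀).differentiableAt
    exact h2.clm_apply (differentiableAt_const _)
  -- The derivative in `y` at `y = 1` of `(x y x⁻¹) x = x y`; here `Z x` is `Ad x` applied to `Y`.
  have hrel : ∀ᶠ x in 𝓝 x₀, fderiv ℝ (chartMul n G) (x₀, x) (Z x, 0) =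
      fderiv ℝ (chartMul n G) (x, x₀) (0, Y) := by
    have hcc : ContinuousAt (fun p : EuclideanSpace ℝ (Fin n) × EuclideanSpace ℝ (Fin n) =>
        oneChartSymm n G p.1 * oneChartSymm n G p.2 * (oneChartSymm n G p.1)⁻¹) (x₀, x₀) :=
      ((contMDiffAt_oneChartSymm_fst.mul contMDiffAt_oneChartSymm_snd).mul
        contMDiffAt_oneChartSymm_fst.inv).continuousAt
    have h1 : ∀ᶠ p in 𝓝 (x₀, x₀),
        chartMul n G (chartConj n G p, p.1) = chartMul n G p := by
      have h2 := hcc.eventually (p := fun g => oneChartSymm n G (oneChart n G g) = g)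
        (by simpa [hx₀] using eventually_oneChartSymm_oneChart)
      filter_upwards [h2] with p hp
      simp only [chartMul, chartConj, hp]
      simp
    have h2 := h1.curry_nhds
    have h3 : ∀ᶠ p in 𝓝 (x₀, x₀), DifferentiableAt ℝ (chartMul n G) p :=
      (((contDiffAt_chartMul (n := n) (G := G)).of_le (m := 1) (by simp)).eventually
        (by simp)).mono fun p hp => hp.differentiableAt (by simp)
    have h4 : ∀ᶠ p in 𝓝 (x₀, x₀), DifferentiableAt ℝ (chartConj n G) p :=
      (((contDiffAt_chartConj (n := n) (G := G)).of_le (m := 1) (by simp)).eventually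
        (by simp)).mono fun p hp => hp.differentiableAt (by simp)
    have hl : Tendsto (fun x => (x, x₀)) (𝓝 x₀) (𝓝 (x₀, x₀)) :=
      (continuous_id.prodMk continuous_const).tendsto _
    have hr : Tendsto (fun x => (x₀, x)) (𝓝 x₀) (𝓝 (x₀, x₀)) :=
      (continuous_const.prodMk continuous_id).tendsto _
    filter_upwards [h2, hl.eventually h3, hr.eventually h3, hl.eventually h4] with x a1 a2 a3 a4
    have d1 := hasDerivAt_snd_of_contDiffAt a2 Y
    have d2 := hasDerivAt_snd_of_contDiffAt a4 Y
    have e1 : chartConj n G (x, x₀ + (0 : ℝ) • Y) = x₀ := by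
      simp [chartConj, hx₀]
    have d3 : HasDerivAt (fun t : ℝ => chartMul n G (chartConj n G (x, x₀ + t • Y), x))
        (fderiv ℝ (chartMul n G) (x₀, x) (Z x, 0)) 0 := by
      have a3' : HasFDerivAt (chartMul n G) (fderiv ℝ (chartMul n G) (x₀, x))
          (chartConj n G (x, x₀ + (0 : ℝ) • Y), x) := by
        rw [e1]
        exact a3.hasFDerivAt
      exact a3'.comp_hasDerivAt (0 : ℝ) (d2.prodMk (hasDerivAt_const (0 : ℝ) x))
    refine d3.unique (d1.congr_of_eventuallyEq ?_)
    have hc : Tendsto (fun t : ℝ => x₀ + t • Y) (𝓝 0) (𝓝 x₀) := by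
      have : Continuous fun t : ℝ => x₀ + t • Y := by fun_prop
      simpa using this.tendsto 0
    exact hc.eventually a1
  set c : ℝ → EuclideanSpace ℝ (Fin n) := fun t => oneChart n G (γ t) with hc
  have hcd : HasDerivAt c X 0 := h.2.2
  have hc0 : c 0 = x₀ := by simp [hc, h.1, hx₀]
  have hct : Tendsto c (𝓝 0) (𝓝 x₀) := hc0 ▸ hcd.continuousAt
  have hft : HasDerivAt (fun t => Z (c t)) (fderiv ℝ Z x₀ X) 0 := by
    refine HasFDerivAt.comp_hasDerivAt (l := Z) 0 ?_ hcd
    rw [hc0]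
    exact hZd.hasFDerivAt
  have heq : (fun t => lieAd (γ t) (Y : GroupLieAlgebra (𝓡 n) G)) =ᶠ[𝓝 0] fun t => Z (c t) := by
    have h1 : Tendsto γ (𝓝 0) (𝓝 1) := h.1 ▸ h.2.1
    filter_upwards [hct.eventually lieAd_oneChartSymm,
      h1.eventually (eventually_oneChartSymm_oneChart (n := n))] with t a1 a2
    exact (congrArg (fun g => lieAd g (Y : GroupLieAlgebra (𝓡 n) G)) a2).symm.trans (a1 Y)
  have hZ0 : Z x₀ = Y := by
    have h1 := hrel.self_of_nhds
    rw [fderiv_chartMul_apply, fderiv_chartMul_apply] at h1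
    simpa using h1
  have hL : HasDerivAt (fun t => fderiv ℝ (chartMul n G) (x₀, c t)) (chartMulSnd n G (0, X)) 0 := by
    refine HasFDerivAt.comp_hasDerivAt (l := fderiv ℝ (chartMul n G)) 0 ?_
      ((hasDerivAt_const _ _).prodMk hcd)
    rw [hc0]
    exact hasFDerivAt_fderiv_chartMul
  have hR : HasDerivAt (fun t => fderiv ℝ (chartMul n G) (c t, x₀)) (chartMulSnd n G (X, 0)) 0 := by
    refine HasFDerivAt.comp_hasDerivAt (l := fderiv ℝ (chartMul n G)) 0 ?_
      (hcd.prodMk (hasDerivAt_const _ _))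
    rw [hc0]
    exact hasFDerivAt_fderiv_chartMul
  have hL' := hL.clm_apply (hft.prodMk (hasDerivAt_const (0 : ℝ) (0 : EuclideanSpace ℝ (Fin n))))
  have hR' := hR.clm_apply
    (hasDerivAt_const (0 : ℝ) ((0, Y) : EuclideanSpace ℝ (Fin n) × EuclideanSpace ℝ (Fin n)))
  -- Both sides of `hrel` are differentiated along the curve. Since the derivative of the product at
  -- `(1, 1)` is addition, the derivative of `Z` appears undisturbed and can be isolated.
  have key := hL'.unique (hR'.congr_of_eventuallyEq (hct.eventually hrel))
  rw [hc0, hZ0, fderiv_chartMul_apply] at key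
  simp only [add_zero, map_zero] at key
  have hfin : fderiv ℝ Z x₀ X =
      chartMulSnd n G (X, 0) (0, Y) - chartMulSnd n G (Y, 0) (0, X) := by
    rw [← key, chartMulSnd_symm (0, X) (Y, 0)]
    abel
  have hft' := hft.congr_of_eventuallyEq heq
  rw [hfin] at hft'
  exact hft'

/-- The derivative of the adjoint action at the identity is the Lie bracket. -/
theorem HasVelocity.hasDerivAt_lieAd {γ : ℝ → G} {X : GroupLieAlgebra (𝓡 n) G}
    (h : HasVelocity γ X) (Y : GroupLieAlgebra (𝓡 n) G) :
    HasDerivAt (F := EuclideanSpace ℝ (Fin n)) (fun t => lieAd (γ t) Y)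
      (⁅X, Y⁆ : GroupLieAlgebra (𝓡 n) G) 0 :=
  (bracket_eq_chartMulSnd X Y) ▸ h.hasDerivAt_lieAd_chartMulSnd Y

end Chart
end Nilmanifold
end

/-! ### One-parameter subgroups and the exponential map. -/

noncomputable section

namespace Nilmanifold

section Exp

variable {n : ℕ} {G : Type*} [TopologicalSpace G] [ChartedSpace (EuclideanSpace ℝ (Fin n)) G]
  [Group G] [LieGroup (𝓡 n) ∞ G]

theorem HasVelocity.congr {γ δ : ℝ → G} {X : EuclideanSpace ℝ (Fin n)} (h : HasVelocity γ X)
    (hδ : ∀ t, δ t = γ t) : HasVelocity δ X := by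
  rwa [show δ = γ from funext hδ]

theorem HasVelocity.mul {γ δ : ℝ → G} {X Y : EuclideanSpace ℝ (Fin n)} (h : HasVelocity γ X)
    (h' : HasVelocity δ Y) : HasVelocity (fun t => γ t * δ t) (X + Y) := by
  have := topologicalGroup_of_lieGroup (𝓡 n) ∞ (G := G)
  refine ⟨by simp [h.1, h'.1], h.2.1.mul h'.2.1, ?_⟩
  have h1 := differentiableAt_chartMul (n := n) (G := G) |>.hasFDerivAt
  have e1 : (oneChart n G (1 : G), oneChart n G (1 : G)) =
    (oneChart n G (γ 0), oneChart n G (δ 0)) := by rw [h.1, h'.1]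
  have h2 := HasFDerivAt.comp_hasDerivAt (l := chartMul n G) (0 : ℝ) (e1 ▸ h1)
    (h.2.2.prodMk h'.2.2)
  rw [← e1, fderiv_chartMul_apply] at h2
  refine h2.congr_of_eventuallyEq ?_
  have t1 : Tendsto γ (𝓝 0) (𝓝 1) := h.1 ▸ h.2.1
  have t2 : Tendsto δ (𝓝 0) (𝓝 1) := h'.1 ▸ h'.2.1
  filter_upwards [t1.eventually (eventually_oneChartSymm_oneChart (n := n)),
    t2.eventually (eventually_oneChartSymm_oneChart (n := n))] with t a1 a2
  simp [chartMul, a1, a2]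

@[simp] theorem mulInvariantVectorField_one (X : GroupLieAlgebra (𝓡 n) G) :
    mulInvariantVectorField X (1 : G) = X := by
  have h : (fun x : G => 1 * x) = id := by
    ext
    simp
  rw [mulInvariantVectorField, h, mfderiv_id]
  rfl

theorem mfderiv_mul_left_mulInvariantVectorField (X : GroupLieAlgebra (𝓡 n) G) (g h : G) :
    mfderiv (𝓡 n) (𝓡 n) (fun x : G => g * x) h (mulInvariantVectorField X h) =
      mulInvariantVectorField X (g * h) := by
  have h1 : (fun x : G => g * h * x) = (fun x => g * x) ∘ fun x => h * x := by
    ext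
    simp [mul_assoc]
  have h2 := mfderiv_comp (I := 𝓡 n) (I' := 𝓡 n) (I'' := 𝓡 n) (1 : G)
    (mdifferentiable_mul_left g (h * 1)) (mdifferentiable_mul_left h (1 : G))
  simp only [mulInvariantVectorField]
  rw [h1, h2, mul_one]
  rfl

theorem isMIntegralCurveOn_mul_left {X : GroupLieAlgebra (𝓡 n) G} {γ : ℝ → G} {s : Set ℝ}
    (h : IsMIntegralCurveOn (I := 𝓡 n) γ (mulInvariantVectorField X) s) (g : G) :
    IsMIntegralCurveOn (I := 𝓡 n) (fun t => g * γ t) (mulInvariantVectorField X) s := by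
  intro t ht
  have h1 := (mdifferentiable_mul_left (n := n) g (γ t)).hasMFDerivAt
  have h2 := h1.comp_hasMFDerivWithinAt t (h t ht)
  rw [← mfderiv_mul_left_mulInvariantVectorField]
  have h3 := comp_smulRight_one (E := EuclideanSpace ℝ (Fin n)) (F := EuclideanSpace ℝ (Fin n))
    (mfderiv (𝓡 n) (𝓡 n) (fun x : G => g * x) (γ t)) (mulInvariantVectorField X (γ t))
  exact Eq.mp (congrArg (HasMFDerivWithinAt 𝓘(ℝ, ℝ) (𝓡 n) (fun t => g * γ t) s t) h3) h2

variable [T2Space G]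

theorem contMDiff_one_mulInvariantVectorField (X : GroupLieAlgebra (𝓡 n) G) :
    ContMDiff (𝓡 n) (𝓡 n).tangent 1
      (fun g : G => (⟨g, mulInvariantVectorField X g⟩ : TangentBundle (𝓡 n) G)) :=
  (contMDiff_mulInvariantVectorField X).of_le (by
    rw [minSmoothness_of_isRCLikeNormedField]
    norm_num)

/-- Left translates of a local integral curve through `1` are integral curves through every other
point with the same existence time `ε`. A uniform existence time gives global curves. -/
theorem exists_isMIntegralCurve_mulInvariantVectorField (X : GroupLieAlgebra (𝓡 n) G) :
    ∃ γ : ℝ → G, γ 0 = 1 ∧ IsMIntegralCurve (I := 𝓡 n) γ (mulInvariantVectorField X) := by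
  have : IsManifold (𝓡 n) ∞ G := ContMDiffMul.toIsManifold
  have : IsManifold (𝓡 n) 1 G := IsManifold.of_le (n := ∞) (by simp)
  obtain ⟨γ, h0, h1⟩ := exists_isMIntegralCurveAt_of_contMDiffAt_boundaryless (I := 𝓡 n) 0
    (contMDiff_one_mulInvariantVectorField X).contMDiffAt (x₀ := (1 : G))
  obtain ⟨ε, hε, h2⟩ := isMIntegralCurveAt_iff'.1 h1
  rw [Real.ball_eq_Ioo, zero_sub, zero_add] at h2
  exact exists_isMIntegralCurve_of_isMIntegralCurveOn (contMDiff_one_mulInvariantVectorField X) hε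
    (fun g => ⟨fun t => g * γ t, by simp [h0], isMIntegralCurveOn_mul_left h2 g⟩) 1

variable (G) in
/-- The integral curve through `1` of the left invariant vector field given by `X`. -/
def expCurve (X : GroupLieAlgebra (𝓡 n) G) : ℝ → G :=
  Classical.epsilon fun γ : ℝ → G =>
    γ 0 = 1 ∧ IsMIntegralCurve (I := 𝓡 n) γ (mulInvariantVectorField X)

theorem expCurve_spec (X : GroupLieAlgebra (𝓡 n) G) : expCurve G X 0 = 1 ∧
    IsMIntegralCurve (I := 𝓡 n) (expCurve G X) (mulInvariantVectorField X) :=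
  Classical.epsilon_spec (exists_isMIntegralCurve_mulInvariantVectorField X)

theorem eq_expCurve {X : GroupLieAlgebra (𝓡 n) G} {γ : ℝ → G} (h0 : γ 0 = 1)
    (h : IsMIntegralCurve (I := 𝓡 n) γ (mulInvariantVectorField X)) : γ = expCurve G X := by
  have : IsManifold (𝓡 n) ∞ G := ContMDiffMul.toIsManifold
  have : IsManifold (𝓡 n) 1 G := IsManifold.of_le (n := ∞) (by simp)
  exact isMIntegralCurve_Ioo_eq_of_contMDiff_boundaryless (t₀ := 0)
    (contMDiff_one_mulInvariantVectorField X) h (expCurve_spec X).2 (h0.trans (expCurve_spec X).1.symm)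

theorem lieExp_eq_expCurve (X : GroupLieAlgebra (𝓡 n) G) : lieExp X = expCurve G X 1 := rfl

theorem expCurve_add (X : GroupLieAlgebra (𝓡 n) G) (s t : ℝ) :
    expCurve G X (s + t) = expCurve G X s * expCurve G X t := by
  have h1 := (expCurve_spec X).2.comp_add s
  have h2 := isMIntegralCurveOn_mul_left (h1.isMIntegralCurveOn Set.univ) (expCurve G X s)⁻¹
  have h3 := eq_expCurve (by simp) (isMIntegralCurve_iff_isMIntegralCurveOn.2 h2)
  have h4 := congrFun h3 t
  simp only [Function.comp] at h4
  rw [← h4, add_comm t s]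
  group

theorem lieExp_smul (X : GroupLieAlgebra (𝓡 n) G) (t : ℝ) : lieExp (t • X) = expCurve G X t := by
  have h1 := (expCurve_spec X).2.comp_mul t
  have h2 : IsMIntegralCurve (I := 𝓡 n) (expCurve G X ∘ (· * t))
      (mulInvariantVectorField (t • X)) := by
    rw [mulInvariantVectorField_smul]
    exact h1
  have h3 := eq_expCurve (by simp [(expCurve_spec X).1]) h2
  rw [lieExp_eq_expCurve, ← h3]
  simp

theorem hasVelocity_expCurve (X : GroupLieAlgebra (𝓡 n) G) : HasVelocity (expCurve G X) X := by
  refine hasVelocity_of_hasMFDerivAt (expCurve_spec X).1 ?_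
  have h := (expCurve_spec X).2 0
  have h1 : mulInvariantVectorField X (expCurve G X 0) = X := by
    rw [(expCurve_spec X).1]
    exact mulInvariantVectorField_one X
  exact h.congr_mfderiv (congrArg
    (fun V : EuclideanSpace ℝ (Fin n) => (1 : ℝ →L[ℝ] ℝ).smulRight V) h1)

theorem continuous_expCurve (X : GroupLieAlgebra (𝓡 n) G) : Continuous (expCurve G X) :=
  (expCurve_spec X).2.continuous

/-- A curve whose logarithmic derivative is constantly `X` is the one-parameter subgroup of `X`. -/
theorem eq_expCurve_of_hasVelocity {X : GroupLieAlgebra (𝓡 n) G} {γ : ℝ → G} (h0 : γ 0 = 1)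
    (h : ∀ s, HasVelocity (fun t => (γ s)⁻¹ * γ (s + t)) X) : γ = expCurve G X := by
  refine eq_expCurve h0 fun s => ?_
  have h1 := (h s).mul_left (γ s)
  have h2 : HasFDerivAt (fun t : ℝ => t - s) (ContinuousLinearMap.id ℝ ℝ) s :=
    (hasFDerivAt_id s).sub_const s
  have h3 := h2.hasMFDerivAt
  rw [show (0 : ℝ) = s - s by simp] at h1
  have h4 := HasMFDerivAt.comp (g := fun t => γ s * ((γ s)⁻¹ * γ (s + t)))
    (f := fun t : ℝ => t - s) s h1 h3
  exact h4.congr_of_eventuallyEq (.of_forall fun t => by simp)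

theorem conj_expCurve (X : GroupLieAlgebra (𝓡 n) G) (g : G) (t : ℝ) :
    g * expCurve G X t * g⁻¹ = expCurve G (lieAd g X) t := by
  have h := eq_expCurve_of_hasVelocity (X := lieAd g X) (γ := fun t => g * expCurve G X t * g⁻¹)
    (by simp [(expCurve_spec X).1]) fun s =>
      ((hasVelocity_expCurve X).conj g).congr fun t => by
        rw [expCurve_add]
        group
  exact congrFun h t

theorem conj_lieExp (X : GroupLieAlgebra (𝓡 n) G) (g : G) :
    g * lieExp X * g⁻¹ = lieExp (lieAd g X) := conj_expCurve X g 1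

section FVelocity

variable {V : Type*} [NormedAddCommGroup V] [NormedSpace ℝ V]

/-- `f` is a map with `f 0 = 1` and strict derivative `L` at `0`. -/
def HasFVelocity (f : V → G) (L : V →L[ℝ] EuclideanSpace ℝ (Fin n)) : Prop :=
  f 0 = 1 ∧ ContinuousAt f 0 ∧ HasStrictFDerivAt (fun v => oneChart n G (f v)) L 0

theorem hasFVelocity_one : HasFVelocity (fun _ : V => (1 : G))
    (0 : V →L[ℝ] EuclideanSpace ℝ (Fin n)) :=
  ⟨rfl, continuousAt_const, hasStrictFDerivAt_const _ _⟩

theorem HasFVelocity.mul {f g : V → G} {L L' : V →L[ℝ] EuclideanSpace ℝ (Fin n)}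
    (h : HasFVelocity f L) (h' : HasFVelocity g L') :
    HasFVelocity (fun v => f v * g v) (L + L') := by
  have := topologicalGroup_of_lieGroup (𝓡 n) ∞ (G := G)
  refine ⟨by simp [h.1, h'.1], h.2.1.mul h'.2.1, ?_⟩
  have h1 : HasStrictFDerivAt (chartMul n G) _ (oneChart n G (1 : G), oneChart n G (1 : G)) :=
    contDiffAt_chartMul.hasStrictFDerivAt (by simp)
  have e1 : (oneChart n G (1 : G), oneChart n G (1 : G)) =
    (oneChart n G (f 0), oneChart n G (g 0)) := by rw [h.1, h'.1]
  have h2 := HasStrictFDerivAt.comp (g := chartMul n G) (0 : V) (e1 ▸ h1) (h.2.2.prodMk h'.2.2)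
  have e2 : (fderiv ℝ (chartMul n G) (oneChart n G (1 : G), oneChart n G (1 : G))).comp
      (L.prod L') = L + L' := by
    ext1 v
    simp [fderiv_chartMul_apply]
  rw [← e1, e2] at h2
  refine h2.congr_of_eventuallyEq ?_
  have t1 : Tendsto f (𝓝 0) (𝓝 1) := h.1 ▸ h.2.1
  have t2 : Tendsto g (𝓝 0) (𝓝 1) := h'.1 ▸ h'.2.1
  filter_upwards [t1.eventually (eventually_oneChartSymm_oneChart (n := n)),
    t2.eventually (eventually_oneChartSymm_oneChart (n := n))] with t a1 a2
  simp [chartMul, a1, a2]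

theorem HasFVelocity.hasVelocity {f : V → G} {L : V →L[ℝ] EuclideanSpace ℝ (Fin n)}
    (h : HasFVelocity f L) {c : ℝ → V} {v : V} (h0 : c 0 = 0) (hc : HasDerivAt c v 0) :
    HasVelocity (fun t => f (c t)) (L v) := by
  refine ⟨by simp [h0, h.1], ?_, ?_⟩
  · exact ContinuousAt.comp (g := f) (by simpa [h0] using h.2.1) hc.continuousAt
  · exact HasFDerivAt.comp_hasDerivAt (l := fun v => oneChart n G (f v)) (0 : ℝ)
      (by simpa [h0] using h.2.2.hasFDerivAt) hc

theorem HasFVelocity.comp {W : Type*} [NormedAddCommGroup W] [NormedSpace ℝ W]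
    {f : V → G} {L : V →L[ℝ] EuclideanSpace ℝ (Fin n)}
    (h : HasFVelocity f L) (A : W →L[ℝ] V) : HasFVelocity (fun w => f (A w)) (L.comp A) := by
  refine ⟨by simp [h.1], ?_, ?_⟩
  · exact ContinuousAt.comp (g := f) (by simpa using h.2.1) A.continuous.continuousAt
  · exact HasStrictFDerivAt.comp (g := fun v => oneChart n G (f v)) (0 : W)
      (by simpa using h.2.2) A.hasStrictFDerivAt

/-- In the chart the curve solves `c' t = ∂₂μ(c t, 1) X` near `0`. The right-hand side is continuous
at `0`, which upgrades the derivative to a strict one, as the inverse function theorem requires. -/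
theorem hasFVelocity_expCurve (X : GroupLieAlgebra (𝓡 n) G) :
    HasFVelocity (expCurve G X)
      ((1 : ℝ →L[ℝ] ℝ).smulRight (X : EuclideanSpace ℝ (Fin n))) := by
  refine ⟨(expCurve_spec X).1, (continuous_expCurve X).continuousAt, ?_⟩
  set c : ℝ → EuclideanSpace ℝ (Fin n) := fun t => oneChart n G (expCurve G X t) with hc
  set x₀ := oneChart n G (1 : G) with hx₀
  have hX := hasVelocity_expCurve X
  have t1 : Tendsto (expCurve G X) (𝓝 0) (𝓝 1) := (expCurve_spec X).1 ▸ hX.2.1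
  have hc0 : c 0 = x₀ := by rw [hc, hx₀, ← (expCurve_spec X).1]
  have hct : Tendsto c (𝓝 0) (𝓝 x₀) := hc0 ▸ hX.2.2.continuousAt
  have hl : Tendsto (fun t => (c t, x₀)) (𝓝 0) (𝓝 (x₀, x₀)) :=
    hct.prodMk_nhds tendsto_const_nhds
  have h3 : ∀ᶠ p in 𝓝 (x₀, x₀), DifferentiableAt ℝ (chartMul n G) p :=
    (((contDiffAt_chartMul (n := n) (G := G)).of_le (m := 1) (by simp)).eventually
      (by simp)).mono fun p hp => hp.differentiableAt (by simp)
  set c' : ℝ → EuclideanSpace ℝ (Fin n) := fun t => fderiv ℝ (chartMul n G) (c t, x₀) (0, X)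
    with hc'
  have hder : ∀ᶠ t in 𝓝 0, HasDerivAt c (c' t) t := by
    filter_upwards [hl.eventually h3, t1.eventually (eventually_oneChartSymm_oneChart (n := n))]
      with t a1 a2
    have b1 : HasDerivAt (fun s => chartMul n G (c t, c s)) (c' t) 0 := by
      refine HasFDerivAt.comp_hasDerivAt (l := chartMul n G) (0 : ℝ) ?_
        ((hasDerivAt_const _ _).prodMk hX.2.2)
      change HasFDerivAt _ _ (c t, c 0)
      rw [hc0]
      exact a1.hasFDerivAt
    have b2 : HasDerivAt (fun s => c (t + s)) (c' t) 0 := by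
      refine b1.congr_of_eventuallyEq ?_
      filter_upwards [t1.eventually (eventually_oneChartSymm_oneChart (n := n))] with s a3
      simp [chartMul, hc, a2, a3, expCurve_add]
    have b3 := HasDerivAt.comp_const_add (f := fun s => c (t + s)) (-t) t (by simpa using b2)
    simpa using b3
  have hc'0 : c' 0 = X := by
    change fderiv ℝ (chartMul n G) (c 0, x₀)
      ((0 : EuclideanSpace ℝ (Fin n)), (X : EuclideanSpace ℝ (Fin n))) = X
    rw [hc0]
    exact (fderiv_chartMul_apply (0 : EuclideanSpace ℝ (Fin n)) X).trans
      (zero_add (X : EuclideanSpace ℝ (Fin n)))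
  have hcont : ContinuousAt c' 0 := by
    have h1 : ContinuousAt (fderiv ℝ (chartMul n G)) (c 0, x₀) := by
      rw [hc0]
      exact hasFDerivAt_fderiv_chartMul.continuousAt
    have h2 : ContinuousAt (fun t => fderiv ℝ (chartMul n G) (c t, x₀)) 0 :=
      ContinuousAt.comp (g := fderiv ℝ (chartMul n G)) (f := fun t => (c t, x₀)) h1
        (hX.2.2.continuousAt.prodMk continuousAt_const)
    exact h2.clm_apply continuousAt_const
  have := hasStrictDerivAt_of_hasDerivAt_of_continuousAt hder hcont
  rw [hc'0] at this
  have h4 := this.hasStrictFDerivAt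
  exact h4

end FVelocity

end Exp
end Nilmanifold
end

/-! ### Semidirect products and a covering criterion for global coordinates. -/

noncomputable section

namespace Nilmanifold

section Flow

/-- A continuous one-parameter group of linear automorphisms of `V`. -/
structure LinearFlow (V : Type*) [AddCommGroup V] [Module ℝ V] [TopologicalSpace V] where
  /-- The automorphism at time `t`. -/
  map : ℝ → V →ₗ[ℝ] V
  map_zero : ∀ v, map 0 v = v
  map_add : ∀ s t v, map (s + t) v = map s (map t v)
  continuous_map : Continuous fun p : ℝ × V => map p.1 p.2

variable {V : Type*} [AddCommGroup V] [Module ℝ V] [TopologicalSpace V]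

theorem LinearFlow.map_neg_map (A : LinearFlow V) (t : ℝ) (v : V) :
    A.map (-t) (A.map t v) = v := by
  rw [← A.map_add, neg_add_cancel, A.map_zero]

theorem LinearFlow.map_map_neg (A : LinearFlow V) (t : ℝ) (v : V) :
    A.map t (A.map (-t) v) = v := by
  rw [← A.map_add, add_neg_cancel, A.map_zero]

/-- The semidirect product `ℝ ⋉ V` defined by a flow, with multiplication
`(s, v) (t, w) = (s + t, A₋ₜ v + w)`. -/
@[nolint unusedArguments]
def LinearFlow.Model (_ : LinearFlow V) : Type _ := ℝ × V

namespace LinearFlow.Model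

variable (A : LinearFlow V)

instance : TopologicalSpace A.Model := inferInstanceAs (TopologicalSpace (ℝ × V))

instance : Mul A.Model := ⟨fun a b => (a.1 + b.1, A.map (-b.1) a.2 + b.2)⟩
instance : One A.Model := ⟨((0 : ℝ), (0 : V))⟩
instance : Inv A.Model := ⟨fun a => (-a.1, -A.map a.1 a.2)⟩

instance : Group A.Model :=
  Group.ofLeftAxioms
    (fun a b c => Prod.ext (add_assoc _ _ _) (by
      change A.map (-c.1) (A.map (-b.1) a.2 + b.2) + c.2 =
        A.map (-(b.1 + c.1)) a.2 + (A.map (-c.1) b.2 + c.2)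
      rw [_root_.map_add, ← A.map_add, neg_add_rev, add_assoc]))
    (fun a => Prod.ext (zero_add _) (by
      change A.map (-a.1) 0 + a.2 = a.2
      simp))
    (fun a => Prod.ext (neg_add_cancel _) (by
      change A.map (-a.1) (-A.map a.1 a.2) + a.2 = 0
      rw [map_neg, A.map_neg_map, neg_add_cancel]))

instance [IsTopologicalAddGroup V] : IsTopologicalGroup A.Model where
  continuous_mul := by
    have h1 : Continuous fun p : (ℝ × V) × (ℝ × V) =>
        (p.1.1 + p.2.1, A.map (-p.2.1) p.1.2 + p.2.2) :=
      (by fun_prop : Continuous fun p : (ℝ × V) × (ℝ × V) => p.1.1 + p.2.1).prodMk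
        ((A.continuous_map.comp (by fun_prop :
          Continuous fun p : (ℝ × V) × (ℝ × V) => (-p.2.1, p.1.2))).add (by fun_prop))
    exact h1
  continuous_inv := by
    have h1 : Continuous fun p : ℝ × V => (-p.1, -A.map p.1 p.2) :=
      (by fun_prop : Continuous fun p : ℝ × V => -p.1).prodMk A.continuous_map.neg
    exact h1

end LinearFlow.Model

variable {G : Type*} [Group G] [TopologicalSpace G]

/-- A homomorphism from `ℝ ⋉ V` which is a local homeomorphism at the identity onto a simply
connected group is a homeomorphism. -/
theorem LinearFlow.isHomeomorph_of_nhds [IsTopologicalAddGroup V] [ContinuousSMul ℝ V] [T2Space V]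
    [IsTopologicalGroup G] [SimplyConnectedSpace G] [LocallyPathConnectedSpace G]
    (A : LinearFlow V) {e : ℝ → G} {m : V → G} (he : Continuous e) (hm : Continuous m)
    (e_add : ∀ s t, e (s + t) = e s * e t) (m_add : ∀ v w, m (v + w) = m v * m w)
    (conj : ∀ t v, e t * m v = m (A.map t v) * e t)
    (hopen : 𝓝 (1 : G) ≤ Filter.map (fun p : ℝ × V => e p.1 * m p.2) (𝓝 (0, 0)))
    (hinj : ∀ᶠ p in 𝓝 ((0 : ℝ), (0 : V)), e p.1 * m p.2 = 1 → p = (0, 0)) :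
    IsHomeomorph (fun p : ℝ × V => e p.1 * m p.2) := by
  have e0 : e 0 = 1 := by simpa using e_add 0 0
  have m0 : m 0 = 1 := by simpa using m_add 0 0
  let f : A.Model →* G :=
    { toFun := fun p => e p.1 * m p.2
      map_one' := by
        change e 0 * m 0 = 1
        simp [e0, m0]
      map_mul' := fun p q => by
        change e (p.1 + q.1) * m (A.map (-q.1) p.2 + q.2) = e p.1 * m p.2 * (e q.1 * m q.2)
        have := conj q.1 (A.map (-q.1) p.2)
        rw [A.map_map_neg] at this
        rw [e_add, m_add, mul_assoc (e p.1), ← mul_assoc (e q.1), this]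
        simp only [mul_assoc] }
  have hfc : Continuous f := by
    have : Continuous fun p : ℝ × V => e p.1 * m p.2 := by fun_prop
    exact this
  have hfo : IsOpenMap f := IsTopologicalGroup.isOpenMap_iff_nhds_one.2 hopen
  -- The image is an open subgroup, hence also closed, and `G` is connected.
  have hfs : Function.Surjective f := by
    have h1 : IsOpen (f.range : Set G) := by
      rw [MonoidHom.coe_range]
      exact hfo.isOpen_range
    have h2 : (f.range : Set G) = Set.univ :=
      IsClopen.eq_univ ⟨f.range.isClosed_of_isOpen h1, h1⟩ ⟨1, f.range.one_mem⟩
    exact Set.range_eq_univ.1 (by rw [← MonoidHom.coe_range, h2])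
  have hq : Topology.IsQuotientMap f := hfo.isQuotientMap hfc hfs
  -- Injectivity near the identity isolates `1` in the kernel; translation isolates every other
  -- point.
  have hd : IsDiscrete (f.ker : Set A.Model) := by
    rw [isDiscrete_iff_nhdsWithin]
    intro x hx
    have hx' : f x = 1 := hx
    have h1 : ∀ᶠ p : A.Model in 𝓝 1, f p = 1 → p = 1 := hinj
    have h2 : Tendsto (fun y => x⁻¹ * y) (𝓝 x) (𝓝 (1 : A.Model)) := by
      have : Continuous fun y => x⁻¹ * y := by fun_prop
      simpa using this.tendsto x
    refine le_antisymm ?_ (pure_le_nhdsWithin hx)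
    rw [le_pure_iff, mem_nhdsWithin_iff_eventually]
    filter_upwards [h2.eventually h1] with y hy hyk
    have hy' : f y = 1 := hyk
    have := hy (by simp [hx', hy'])
    exact (inv_mul_eq_one.1 this).symm
  have hcov : IsCoveringMap f := (hq.isQuotientCoveringMap_of_isDiscrete_ker_monoidHom hd).isCoveringMap
  have : PreconnectedSpace A.Model := inferInstanceAs (PreconnectedSpace (ℝ × V))
  -- Simple connectedness lifts the identity of `G` to a section `s`. Both `s ∘ f` and the identity
  -- lift `f` and agree at `1`, so connectedness of `ℝ × V` makes them equal, which gives
  -- injectivity.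
  obtain ⟨s, ⟨hs1, hs2⟩, -⟩ := hcov.existsUnique_continuousMap_lifts (ContinuousMap.id G) 1 1
    (by simp)
  have hsf : s ∘ f = id := by
    refine hcov.eq_of_comp_eq (s.continuous.comp hfc) continuous_id ?_ 1 (by simp [hs1])
    rw [← Function.comp_assoc, hs2]
    rfl
  have hfi : Function.Injective f := Function.LeftInverse.injective (congrFun hsf)
  exact ⟨hfc, hfo, ⟨hfi, hfs⟩⟩

end Flow
end Nilmanifold
end

/-! ### The adjoint action along one-parameter subgroups, and exponentials of nilpotent maps. -/

noncomputable section

namespace Nilmanifold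

section Ad

variable {n : ℕ} {G : Type*} [TopologicalSpace G] [ChartedSpace (EuclideanSpace ℝ (Fin n)) G]
  [Group G] [LieGroup (𝓡 n) ∞ G] [T2Space G]

variable (n) in
/-- The adjoint action as a continuous linear map on the model space. -/
def lieAdL (g : G) : EuclideanSpace ℝ (Fin n) →L[ℝ] EuclideanSpace ℝ (Fin n) :=
  (mfderiv (𝓡 n) (𝓡 n) (fun x : G => g * x * g⁻¹) (1 : G))

theorem lieAd_mul (g h : G) (Y : GroupLieAlgebra (𝓡 n) G) :
    lieAd (g * h) Y = lieAd g (lieAd h Y) := by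
  have h1 := (hasVelocity_expCurve Y).conj (g * h)
  have h2 := ((hasVelocity_expCurve Y).conj h).conj g
  exact h1.unique (h2.congr fun t => by group)

theorem lieAd_one (Y : GroupLieAlgebra (𝓡 n) G) : lieAd (1 : G) Y = Y :=
  ((hasVelocity_expCurve Y).conj 1).unique ((hasVelocity_expCurve Y).congr fun t => by group)

theorem hasDerivAt_lieAdL_expCurve (X Y : GroupLieAlgebra (𝓡 n) G) (t : ℝ) :
    HasDerivAt (fun t => lieAdL n (expCurve G X t) Y)
      (lieAdL n (expCurve G X t) (⁅X, Y⁆ : GroupLieAlgebra (𝓡 n) G)) t := by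
  have h1 := (hasVelocity_expCurve X).hasDerivAt_lieAd Y
  have h2 : HasDerivAt (fun s => lieAdL n (expCurve G X t) (lieAdL n (expCurve G X s) Y))
    (lieAdL n (expCurve G X t) (⁅X, Y⁆ : GroupLieAlgebra (𝓡 n) G)) 0 :=
    (lieAdL n (expCurve G X t)).hasFDerivAt.comp_hasDerivAt (0 : ℝ) h1
  have h3 : HasDerivAt (fun s => lieAdL n (expCurve G X (t + s)) Y)
      (lieAdL n (expCurve G X t) (⁅X, Y⁆ : GroupLieAlgebra (𝓡 n) G)) 0 := by
    refine h2.congr_of_eventuallyEq (.of_forall fun s => ?_)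
    exact (congrArg (fun g => lieAd g Y) (expCurve_add X t s)).trans
      (lieAd_mul (expCurve G X t) (expCurve G X s) Y)
  rw [show (0 : ℝ) = -t + t by simp] at h3
  have h4 := HasDerivAt.comp_const_add (f := fun s : ℝ =>
    lieAdL n (expCurve G X (t + s)) Y) (-t) t h3
  simpa using h4

theorem lieAd_expCurve_of_bracket_eq_zero {X Y : GroupLieAlgebra (𝓡 n) G} (h : ⁅X, Y⁆ = 0)
    (t : ℝ) : lieAd (expCurve G X t) Y = Y := by
  have h1 : ∀ t, HasDerivAt (fun t => lieAdL n (expCurve G X t) Y) 0 t := fun t =>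
    (hasDerivAt_lieAdL_expCurve X Y t).congr_deriv (by
      rw [h]
      exact map_zero (lieAdL n (expCurve G X t)))
  have h2 := is_const_of_deriv_eq_zero (f := fun t => lieAdL n (expCurve G X t) Y)
    (fun t => (h1 t).differentiableAt) (fun t => (h1 t).deriv) t 0
  refine h2.trans ?_
  change lieAd (expCurve G X 0) Y = Y
  rw [(expCurve_spec X).1, lieAd_one]

theorem expCurve_commute {X Y : GroupLieAlgebra (𝓡 n) G} (h : ⁅X, Y⁆ = 0) (s t : ℝ) :
    expCurve G X s * expCurve G Y t = expCurve G Y t * expCurve G X s := by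
  have h1 := conj_expCurve Y (expCurve G X s) t
  rw [lieAd_expCurve_of_bracket_eq_zero h] at h1
  rw [mul_inv_eq_iff_eq_mul] at h1
  exact h1

/-- The two one-parameter subgroups commute, so the logarithmic derivative of their product is
constantly `X + Y`. -/
theorem expCurve_add_of_bracket_eq_zero {X Y : GroupLieAlgebra (𝓡 n) G} (h : ⁅X, Y⁆ = 0) (t : ℝ) :
    expCurve G (X + Y) t = expCurve G X t * expCurve G Y t := by
  refine (congrFun (eq_expCurve_of_hasVelocity (X := X + Y)
    (γ := fun t => expCurve G X t * expCurve G Y t)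
    (by simp [(expCurve_spec X).1, (expCurve_spec Y).1]) fun s => ?_) t).symm
  refine ((hasVelocity_expCurve X).mul (hasVelocity_expCurve Y)).congr fun t => ?_
  simp only [expCurve_add, mul_inv_rev]
  have h1 := expCurve_commute h t s
  calc (expCurve G Y s)⁻¹ * (expCurve G X s)⁻¹ *
        (expCurve G X s * expCurve G X t * (expCurve G Y s * expCurve G Y t))
      = (expCurve G Y s)⁻¹ * (expCurve G X t * expCurve G Y s) * expCurve G Y t := by group
    _ = expCurve G X t * expCurve G Y t := by
      rw [h1]
      group

theorem lieExp_add_of_bracket_eq_zero {X Y : GroupLieAlgebra (𝓡 n) G} (h : ⁅X, Y⁆ = 0) :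
    lieExp (X + Y) = lieExp X * lieExp Y := expCurve_add_of_bracket_eq_zero h 1

theorem lieExp_zero : lieExp (0 : GroupLieAlgebra (𝓡 n) G) = 1 := by
  have h := lieExp_smul (0 : GroupLieAlgebra (𝓡 n) G) 0
  rwa [smul_zero, (expCurve_spec _).1] at h

end Ad

section Unipotent

variable {V : Type*} [AddCommGroup V] [Module ℝ V]

/-- `∑ k < N, tᵏ Dᵏ / k!`, the exponential of `t D` if `D ^ N = 0`. -/
def nilExp (D : V →ₗ[ℝ] V) (N : ℕ) (t : ℝ) : V →ₗ[ℝ] V :=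
  ∑ k ∈ Finset.range N, (t ^ k / k.factorial) • D ^ k

/-- `∑ k < N, tᵏ Dᵏ / (k + 1)!`, the mean of the exponentials of `u t D`, `0 ≤ u ≤ 1`,
if `D ^ N = 0`. -/
def nilExpMean (D : V →ₗ[ℝ] V) (N : ℕ) (t : ℝ) : V →ₗ[ℝ] V :=
  ∑ k ∈ Finset.range N, (t ^ k / (k + 1).factorial) • D ^ k

theorem nilExp_apply (D : V →ₗ[ℝ] V) (N : ℕ) (t : ℝ) (v : V) :
    nilExp D N t v = ∑ k ∈ Finset.range N, (t ^ k / k.factorial) • (D ^ k) v := by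
  simp [nilExp, LinearMap.sum_apply]

theorem nilExpMean_apply (D : V →ₗ[ℝ] V) (N : ℕ) (t : ℝ) (v : V) :
    nilExpMean D N t v = ∑ k ∈ Finset.range N, (t ^ k / (k + 1).factorial) • (D ^ k) v := by
  simp [nilExpMean, LinearMap.sum_apply]

/-- The derivative telescopes: differentiating a power cancels the derivative of the preceding `g
k`, and only the last term survives. -/
theorem hasDerivAt_sum_neg_pow_smul {E : Type*} [NormedAddCommGroup E] [NormedSpace ℝ E]
    {g : ℕ → ℝ → E} (hg : ∀ k t, HasDerivAt (g k) (g (k + 1) t) t) (N : ℕ) (t : ℝ) :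
    HasDerivAt (fun t => ∑ k ∈ Finset.range (N + 1), ((-t) ^ k / k.factorial : ℝ) • g k t)
      (((-t) ^ N / N.factorial : ℝ) • g (N + 1) t) t := by
  induction N with
  | zero => simpa using hg 0 t
  | succ N ih =>
    simp_rw [Finset.sum_range_succ _ (N + 1)]
    have h1 : HasDerivAt (fun t : ℝ => ((-t) ^ (N + 1) / (N + 1).factorial : ℝ))
        (-((-t) ^ N / N.factorial)) t := by
      have h2 := (((hasDerivAt_id t).neg).pow (N + 1)).div_const ((N + 1).factorial : ℝ)
      refine h2.congr_deriv ?_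
      have : ((N + 1).factorial : ℝ) = (N + 1) * N.factorial := by
        rw [Nat.factorial_succ]
        push_cast
        ring
      rw [this]
      have h3 : (N.factorial : ℝ) ≠ 0 := by positivity
      have h4 : (N + 1 : ℝ) ≠ 0 := by positivity
      simp
      field_simp
    refine (ih.add (h1.smul (hg (N + 1) t))).congr_deriv ?_
    rw [neg_smul]
    abel

/-- This is the role of `nilExpMean`: it integrates the flow, and so supplies the fiber coordinate
of `exp (tT + b v)`. -/
theorem hasDerivAt_smul_nilExpMean {V : Type*} [NormedAddCommGroup V] [NormedSpace ℝ V]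
    (D : V →ₗ[ℝ] V) (N : ℕ) (t : ℝ) (v : V) (s : ℝ) :
    HasDerivAt (fun s : ℝ => s • nilExpMean D N (s * t) v) (nilExp D N (s * t) v) s := by
  have h1 : (fun s : ℝ => s • nilExpMean D N (s * t) v) = fun s : ℝ =>
      ∑ k ∈ Finset.range N, (s ^ (k + 1) * (t ^ k / (k + 1).factorial)) • (D ^ k) v := by
    funext s
    rw [nilExpMean_apply, Finset.smul_sum]
    refine Finset.sum_congr rfl fun k _ => ?_
    rw [smul_smul]
    congr 1
    ring
  rw [h1, nilExp_apply]
  refine HasDerivAt.fun_sum fun k _ => ?_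
  have h2 : HasDerivAt (fun s : ℝ => s ^ (k + 1) * (t ^ k / (k + 1).factorial))
      ((s * t) ^ k / k.factorial) s := by
    refine ((hasDerivAt_pow (k + 1) s).mul_const _).congr_deriv ?_
    have : ((k + 1).factorial : ℝ) = (k + 1) * k.factorial := by
      rw [Nat.factorial_succ]
      push_cast
      ring
    rw [this]
    have h3 : (k.factorial : ℝ) ≠ 0 := by positivity
    have h4 : (k + 1 : ℝ) ≠ 0 := by positivity
    push_cast
    field_simp
    try ring
  exact h2.smul_const _

/-- The operator is the identity plus a nilpotent map. If `i` is the last exponent with `Dⁱ v ≠ 0`,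
then applying `Dⁱ` to the sum leaves only the term `k = 0`. -/
theorem nilExpMean_injective {D : V →ₗ[ℝ] V} {N : ℕ} (hD : D ^ N = 0) (t : ℝ) :
    Function.Injective (nilExpMean D N t) := by
  refine (injective_iff_map_eq_zero _).2 fun v hv => ?_
  by_contra hne
  have hex : ∃ j, (D ^ j) v = 0 := ⟨N, by simp [hD]⟩
  classical
  have h0 := Nat.find_spec hex
  have hmin := fun {j} => Nat.find_min hex (m := j)
  set j := Nat.find hex
  have hj : j ≠ 0 := fun h => hne (by simpa [h] using h0)
  obtain ⟨i, hi⟩ := Nat.exists_eq_succ_of_ne_zero hj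
  have hz : ∀ k, i < k → (D ^ k) v = 0 := fun k hk => by
    obtain ⟨r, rfl⟩ := Nat.exists_eq_add_of_le (show j ≤ k by omega)
    rw [add_comm, pow_add, Module.End.mul_apply, h0, map_zero]
  have hN : 0 < N := by
    rcases Nat.eq_zero_or_pos N with h | h
    · exact absurd (by simpa [h] using LinearMap.congr_fun hD v) hne
    · exact h
  refine hmin (show i < j by omega) ?_
  have h1 := congrArg (D ^ i) hv
  rw [nilExpMean_apply, map_sum, map_zero, Finset.sum_eq_single_of_mem 0 (by simpa using hN)] at h1
  · simpa using h1
  · intro k _ hk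
    rw [map_smul, ← Module.End.mul_apply, ← pow_add, hz _ (by omega), smul_zero]

end Unipotent
end Nilmanifold
end

/-! ### Global coordinates of the group attached to a splitting of its Lie algebra. -/

noncomputable section

namespace Nilmanifold

section Splitting

variable {n d : ℕ} {G : Type*} [TopologicalSpace G] [ChartedSpace (EuclideanSpace ℝ (Fin n)) G]
  [Group G] [LieGroup (𝓡 n) ∞ G] [T2Space G]

variable (n d G) in
/-- A splitting of the Lie algebra of `G` as `ℝ T ⊕ b (ℝᵈ)`, with `b (ℝᵈ)` an abelian ideal on
which `T` acts by a nilpotent map `D`. -/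
structure LieSplitting where
  /-- The transversal vector. -/
  T : GroupLieAlgebra (𝓡 n) G
  /-- The coordinates on the abelian ideal. -/
  b : (Fin d → ℝ) →ₗ[ℝ] GroupLieAlgebra (𝓡 n) G
  /-- The action of `T` in coordinates. -/
  D : (Fin d → ℝ) →ₗ[ℝ] (Fin d → ℝ)
  /-- An exponent that annihilates `D`. -/
  N : ℕ
  pow_D : D ^ N = 0
  bracket_b : ∀ v w, ⁅b v, b w⁆ = 0
  bracket_T : ∀ v, ⁅T, b v⁆ = b (D v)
  bijective : Function.Bijective fun p : ℝ × (Fin d → ℝ) =>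
    p.1 • T + b p.2

namespace LieSplitting

variable (L : LieSplitting n d G)

/-- The one-parameter subgroup of the transversal vector. -/
def e (t : ℝ) : G := expCurve G L.T t

/-- The exponential map on the abelian ideal, in coordinates. -/
def m (v : Fin d → ℝ) : G := lieExp (L.b v)

theorem e_add (s t : ℝ) : L.e (s + t) = L.e s * L.e t := expCurve_add _ _ _

theorem e_zero : L.e 0 = 1 := (expCurve_spec _).1

theorem m_zero : L.m 0 = 1 := by
  rw [m, map_zero]
  exact lieExp_zero

theorem m_add (v w : Fin d → ℝ) : L.m (v + w) = L.m v * L.m w := by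
  rw [m, map_add]
  exact lieExp_add_of_bracket_eq_zero (L.bracket_b v w)

theorem m_neg (v : Fin d → ℝ) : L.m (-v) = (L.m v)⁻¹ :=
  eq_inv_of_mul_eq_one_left (by rw [← m_add, neg_add_cancel, m_zero])

theorem e_neg (t : ℝ) : L.e (-t) = (L.e t)⁻¹ :=
  eq_inv_of_mul_eq_one_left (by rw [← e_add, neg_add_cancel, e_zero])

theorem b_injective : Function.Injective L.b := fun v w h => by
  have := L.bijective.1 (a₁ := ((0 : ℝ), v)) (a₂ := ((0 : ℝ), w)) (by simp [h])
  exact congrArg Prod.snd this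

/-- `b` as a continuous linear map to the model space. -/
def bL : (Fin d → ℝ) →L[ℝ] EuclideanSpace ℝ (Fin n) :=
  LinearMap.toContinuousLinearMap (F' := EuclideanSpace ℝ (Fin n)) L.b

/-- The function `Ad(e t) (b (exp(-tD) v))` has derivative zero: differentiating `Ad` inserts `ad
T`, which is `D` in coordinates, and the exponential contributes the opposite term. -/
theorem lieAd_e (t : ℝ) (v : Fin d → ℝ) :
    lieAd (L.e t) (L.b v) = L.b (nilExp L.D L.N t v) := by
  have key : ∀ t : ℝ, ∀ v, lieAdL n (L.e t) (L.bL (nilExp L.D L.N (-t) v)) = L.bL v := by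
    intro t v
    set g : ℕ → ℝ → EuclideanSpace ℝ (Fin n) := fun k t => lieAdL n (L.e t) (L.bL ((L.D ^ k) v))
      with hg
    have hgd : ∀ k t, HasDerivAt (g k) (g (k + 1) t) t := fun k t => by
      refine (hasDerivAt_lieAdL_expCurve L.T (L.b ((L.D ^ k) v)) t).congr_deriv ?_
      rw [L.bracket_T, ← Module.End.mul_apply, ← pow_succ']
      rfl
    have hgN : ∀ t, g (L.N + 1) t = 0 := fun t => by
      simp [hg, pow_succ, L.pow_D]
    -- The range `N + 1` exceeds that of `nilExp` by one term, which vanishes because `D ^ N = 0`.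
    have hsum : ∀ t, ∑ k ∈ Finset.range (L.N + 1), ((-t) ^ k / k.factorial : ℝ) • g k t =
        lieAdL n (L.e t) (L.bL (nilExp L.D L.N (-t) v)) := fun t => by
      rw [Finset.sum_range_succ, nilExp_apply, map_sum, map_sum]
      simp [hg, L.pow_D]
    have hder := fun t => hasDerivAt_sum_neg_pow_smul hgd L.N t
    simp only [hgN, smul_zero, hsum] at hder
    rw [is_const_of_deriv_eq_zero (fun t => (hder t).differentiableAt) (fun t => (hder t).deriv) t 0,
      e_zero]
    have h1 : nilExp L.D L.N (-0) v = v := by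
      -- For `N = 0` the sum is empty, but then `1 = D ^ 0 = 0` forces `v = 0`.
      rcases Nat.eq_zero_or_pos L.N with h | h
      · have h2 : v = 0 := by
          have := LinearMap.congr_fun L.pow_D v
          simpa [h] using this
        simp [h2]
      · rw [nilExp_apply, Finset.sum_eq_single_of_mem 0 (by simpa using h)]
        · simp
        · intro k _ hk
          simp [hk]
    rw [h1]
    exact lieAd_one _
  have h1 := key (-t) v
  rw [neg_neg] at h1
  have h2 := lieAd_mul (L.e t) (L.e (-t)) (L.b (nilExp L.D L.N t v))
  rw [← e_add, add_neg_cancel, e_zero, lieAd_one] at h2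
  refine Eq.trans ?_ h2.symm
  exact congrArg (lieAdL n (L.e t)) h1.symm

theorem conj (t : ℝ) (v : Fin d → ℝ) :
    L.e t * L.m v = L.m (nilExp L.D L.N t v) * L.e t := by
  rw [← mul_inv_eq_iff_eq_mul, m, conj_lieExp, lieAd_e, m]

theorem nilExp_zero (v : Fin d → ℝ) : nilExp L.D L.N 0 v = v :=
  L.b_injective (by rw [← lieAd_e, e_zero, lieAd_one])

theorem nilExp_add (s t : ℝ) (v : Fin d → ℝ) :
    nilExp L.D L.N (s + t) v = nilExp L.D L.N s (nilExp L.D L.N t v) :=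
  L.b_injective (by rw [← lieAd_e, ← lieAd_e, e_add, lieAd_mul, lieAd_e])

/-- The action of the one-parameter subgroup of `T` on the abelian ideal. -/
def flow : LinearFlow (Fin d → ℝ) where
  map := nilExp L.D L.N
  map_zero := L.nilExp_zero
  map_add := L.nilExp_add
  continuous_map := by
    simp_rw [nilExp_apply]
    refine continuous_finsetSum _ fun k _ => ?_
    have : Continuous (L.D ^ k) := LinearMap.continuous_of_finiteDimensional _
    fun_prop

/-- On the abelian ideal the exponential is the product of the coordinate one-parameter subgroups,
whose strict derivatives are known and add up. No smoothness of `lieExp` on the whole algebra is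
needed. -/
theorem hasFVelocity_m : HasFVelocity L.m L.bL := by
  have key : ∀ s : Finset (Fin d), HasFVelocity
      (fun v : Fin d → ℝ => L.m (∑ i ∈ s, v i • Pi.single i (1 : ℝ)))
      (L.bL.comp (∑ i ∈ s, (ContinuousLinearMap.proj i : (Fin d → ℝ) →L[ℝ] ℝ).smulRight
        (Pi.single i (1 : ℝ)))) := by
    intro s
    classical
    induction s using Finset.induction_on with
    | empty => simpa [m_zero] using hasFVelocity_one (n := n) (G := G) (V := Fin d → ℝ)
    | insert i s hi ih =>
      have h1 := (hasFVelocity_expCurve (L.b (Pi.single i (1 : ℝ)))).comp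
        (ContinuousLinearMap.proj i : (Fin d → ℝ) →L[ℝ] ℝ)
      have h2 := h1.mul ih
      convert h2 using 1
      · funext v
        rw [Finset.sum_insert hi, m_add, m, map_smul]
        congr 1
        exact lieExp_smul _ _
      · ext1 v
        simp [Finset.sum_insert hi]
        rfl
  have h := key Finset.univ
  convert h using 1
  · funext v
    congr 1
    exact pi_eq_sum_univ' v
  · ext1 v
    simp only [ContinuousLinearMap.comp_apply, _root_.sum_apply]
    congr 1
    simpa using pi_eq_sum_univ' v

/-- The differential at the identity of `(t, v) ↦ e t * m v`. -/
def diff : (ℝ × (Fin d → ℝ)) →L[ℝ] EuclideanSpace ℝ (Fin n) :=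
  (ContinuousLinearMap.smulRight (M₂ := EuclideanSpace ℝ (Fin n)) (1 : ℝ →L[ℝ] ℝ) L.T).comp
    (ContinuousLinearMap.fst ℝ ℝ (Fin d → ℝ)) + L.bL.comp (ContinuousLinearMap.snd ℝ ℝ (Fin d → ℝ))

/-- The differential at the identity of `(t, v) ↦ e t * m v`, as an equivalence. -/
def diffEquiv : (ℝ × (Fin d → ℝ)) ≃L[ℝ] EuclideanSpace ℝ (Fin n) :=
  ContinuousLinearEquiv.ofBijective L.diff (LinearMap.ker_eq_bot.2 L.bijective.1)
    (LinearMap.range_eq_top.2 L.bijective.2)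

theorem hasFVelocity_e_m :
    HasFVelocity (fun p : ℝ × (Fin d → ℝ) => L.e p.1 * L.m p.2) L.diff :=
  ((hasFVelocity_expCurve L.T).comp (ContinuousLinearMap.fst ℝ ℝ (Fin d → ℝ))).mul
    (L.hasFVelocity_m.comp (ContinuousLinearMap.snd ℝ ℝ (Fin d → ℝ)))

/-- The order of the factors is invisible to first order; this order is the one that occurs in
`lieExp_add_b`. -/
theorem hasFVelocity_m_e :
    HasFVelocity (fun p : ℝ × (Fin d → ℝ) => L.m p.2 * L.e p.1) L.diff := by
  have h := (L.hasFVelocity_m.comp (ContinuousLinearMap.snd ℝ ℝ (Fin d → ℝ))).mul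
    ((hasFVelocity_expCurve L.T).comp (ContinuousLinearMap.fst ℝ ℝ (Fin d → ℝ)))
  rwa [add_comm] at h

theorem continuous_e : Continuous L.e := continuous_expCurve L.T

theorem continuous_m : Continuous L.m := by
  have := topologicalGroup_of_lieGroup (𝓡 n) ∞ (G := G)
  let f : Multiplicative (Fin d → ℝ) →* G :=
    { toFun := fun v => L.m v.toAdd
      map_one' := L.m_zero
      map_mul' := fun v w => L.m_add v.toAdd w.toAdd }
  have h : Continuous f := by
    refine continuous_of_continuousAt_one f ?_
    exact L.hasFVelocity_m.2.1
  exact h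

/-- The strict differential at the origin is the linear isomorphism of the splitting, so the inverse
function theorem supplies both local hypotheses of `LinearFlow.isHomeomorph_of_nhds`. -/
theorem isHomeomorph [SimplyConnectedSpace G] :
    IsHomeomorph (fun p : ℝ × (Fin d → ℝ) => L.e p.1 * L.m p.2) := by
  have := topologicalGroup_of_lieGroup (𝓡 n) ∞ (G := G)
  have : LocallyPathConnectedSpace G :=
    ChartedSpace.locallyPathConnectedSpace (EuclideanSpace ℝ (Fin n)) G
  obtain ⟨h0, hc, hs⟩ := L.hasFVelocity_e_m
  have hs' : HasStrictFDerivAt (fun p : ℝ × (Fin d → ℝ) => oneChart n G (L.e p.1 * L.m p.2))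
    (L.diffEquiv : (ℝ × (Fin d → ℝ)) →L[ℝ] EuclideanSpace ℝ (Fin n)) 0 := hs
  set Φ := fun p : ℝ × (Fin d → ℝ) => L.e p.1 * L.m p.2 with hΦ
  have hΦt : Tendsto Φ (𝓝 0) (𝓝 1) := h0 ▸ hc
  refine L.flow.isHomeomorph_of_nhds L.continuous_e L.continuous_m L.e_add L.m_add L.conj ?_ ?_
  · have h1 := hs'.map_nhds_eq_of_equiv
    have h2 : Filter.map (oneChartSymm n G ∘ oneChart n G) (𝓝 (1 : G)) = 𝓝 1 :=
      (Filter.map_congr (eventually_oneChartSymm_oneChart (n := n))).trans Filter.map_id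
    have h3 : Filter.map (oneChartSymm n G ∘ fun p => oneChart n G (Φ p)) (𝓝 0) =
        Filter.map Φ (𝓝 0) :=
      Filter.map_congr (hΦt.eventually (eventually_oneChartSymm_oneChart (n := n)))
    change 𝓝 (1 : G) ≤ Filter.map Φ (𝓝 0)
    rw [← h3, ← h2, ← Filter.map_map, ← Filter.map_map]
    refine Filter.map_mono ?_
    rw [h1]
    change _ ≤ 𝓝 (oneChart n G (Φ 0))
    rw [h0]
    exact continuousAt_oneChart
  · have h1 := hs'.toOpenPartialHomeomorph.open_source.mem_nhds
      hs'.mem_toOpenPartialHomeomorph_source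
    filter_upwards [h1] with p hp hp1
    refine hs'.toOpenPartialHomeomorph.injOn hp hs'.mem_toOpenPartialHomeomorph_source ?_
    change oneChart n G (Φ p) = oneChart n G (Φ 0)
    rw [h0]
    exact congrArg _ hp1

/-- The curve `s ↦ m (s · nilExpMean (s t) v) * e (s t)` has constant logarithmic derivative `tT + b
v`, because `s · nilExpMean (s t) v` is a primitive of `exp (s t D) v`. Evaluation at `s = 1` gives
the formula. -/
theorem lieExp_add_b (t : ℝ) (v : Fin d → ℝ) :
    lieExp (t • L.T + L.b v) = L.m (nilExpMean L.D L.N t v) * L.e t := by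
  set X := t • L.T + L.b v with hX
  set a : ℝ → Fin d → ℝ := fun s => s • nilExpMean L.D L.N (s * t) v with ha
  set γ : ℝ → G := fun s => L.m (a s) * L.e (s * t) with hγ
  have h := eq_expCurve_of_hasVelocity (X := X) (γ := γ) (by simp [hγ, ha, m_zero, e_zero]) ?_
  · rw [lieExp_eq_expCurve, ← h]
    simp [hγ, ha]
  intro s
  -- The coordinates of `γ(s)⁻¹ γ(s + h)`, found by moving `e (s t)` past the fiber factor. The
  -- twist by `-(s t)` undoes the flow in the derivative of `a`, leaving the velocity `(t, v)`.
  set c : ℝ → ℝ × (Fin d → ℝ) :=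
    fun h => (h * t, nilExp L.D L.N (-(s * t)) (a (s + h) - a s)) with hc
  have hcd : HasDerivAt c (t, v) 0 := by
    refine HasDerivAt.prodMk (by simpa using (hasDerivAt_id (0 : ℝ)).mul_const t) ?_
    have h1 : HasDerivAt (fun h => a (s + h)) (nilExp L.D L.N (s * t) v) 0 :=
      HasDerivAt.comp_const_add (f := a) s 0
        (by simpa using hasDerivAt_smul_nilExpMean L.D L.N t v s)
    have h2 := (LinearMap.toContinuousLinearMap
      (nilExp L.D L.N (-(s * t)))).hasFDerivAt.comp_hasDerivAt (0 : ℝ) (h1.sub_const (a s))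
    refine h2.congr_deriv ?_
    rw [LinearMap.coe_toContinuousLinearMap', ← L.nilExp_add, neg_add_cancel, L.nilExp_zero]
  have hv := L.hasFVelocity_m_e.hasVelocity (c := c) (by simp [hc]) hcd
  refine hv.congr fun h => ?_
  have h1 := L.conj (-(s * t)) (a (s + h) - a s)
  simp only [hγ, hc]
  have h2 : L.m (a (s + h)) = L.m (a s) * L.m (a (s + h) - a s) := by
    rw [← m_add]
    congr 1
    abel
  rw [add_mul, e_add, h2, mul_inv_rev, ← L.e_neg]
  rw [eq_mul_inv_of_mul_eq h1.symm, L.e_neg, inv_inv]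
  simp only [mul_assoc, inv_mul_cancel_left]

end LieSplitting

end Splitting
end Nilmanifold
end

/-! ### Malcev bases in coordinates, and the generic and nongeneric functionals. -/

noncomputable section

namespace Nilmanifold

section Algebra

variable {𝔤 : Type*} [LieRing 𝔤] [LieAlgebra ℝ 𝔤]

theorem mem_flag_iff {n : ℕ} (X : Module.Basis (Fin n) ℝ 𝔤) (k : ℕ) (y : 𝔤) :
    y ∈ flag X k ↔ ∀ i : Fin n, k ≤ i → X.coord i y = 0 := by
  rw [flag, Module.Basis.mem_span_image]
  constructor
  · intro h i hi
    by_contra h0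
    have := h (Finsupp.mem_support_iff.2 h0)
    exact absurd this (not_lt.2 hi)
  · intro h i hi
    by_contra h0
    exact (Finsupp.mem_support_iff.1 hi) (h i (not_lt.1 h0))

variable {d : ℕ} (X : Module.Basis (Fin (d + 1)) ℝ 𝔤)

/-- The linear combinations of all basis vectors but the last. -/
def flagMap : (Fin d → ℝ) →ₗ[ℝ] 𝔤 := Fintype.linearCombination ℝ fun i => X (Fin.castSucc i)

theorem flagMap_apply (v : Fin d → ℝ) : flagMap X v = ∑ i, v i • X (Fin.castSucc i) :=
  Fintype.linearCombination_apply ..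

theorem coord_castSucc_flagMap (v : Fin d → ℝ) (i : Fin d) :
    X.coord (Fin.castSucc i) (flagMap X v) = v i := by
  simp [flagMap_apply, Finsupp.single_apply]

theorem coord_last_flagMap (v : Fin d → ℝ) : X.coord (Fin.last d) (flagMap X v) = 0 := by
  simp [flagMap_apply, Fin.castSucc_ne_last]

theorem eq_smul_add_flagMap (y : 𝔤) :
    y = X.coord (Fin.last d) y • X (Fin.last d) +
      flagMap X fun i => X.coord (Fin.castSucc i) y := by
  rw [flagMap_apply]
  conv_lhs => rw [← X.sum_repr y, Fin.sum_univ_castSucc]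
  rw [add_comm]
  rfl

theorem mem_flag_iff_exists (y : 𝔤) : y ∈ flag X d ↔ ∃ v, flagMap X v = y := by
  rw [mem_flag_iff]
  constructor
  · intro h
    refine ⟨fun i => X.coord (Fin.castSucc i) y, ?_⟩
    conv_rhs => rw [eq_smul_add_flagMap X y, h (Fin.last d) le_rfl, zero_smul, zero_add]
  · rintro ⟨v, rfl⟩ i hi
    have : i = Fin.last d := Fin.ext (le_antisymm (Nat.le_of_lt_succ i.2) hi)
    rw [this, coord_last_flagMap]

/-- The matrix of `ad X_n`, in the coordinates `flagMap X`. -/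
def flagAd : (Fin d → ℝ) →ₗ[ℝ] (Fin d → ℝ) :=
  LinearMap.pi fun i => X.coord (Fin.castSucc i) ∘ₗ
    (LieAlgebra.ad ℝ 𝔤 (X (Fin.last d)) : 𝔤 →ₗ[ℝ] 𝔤) ∘ₗ flagMap X

variable {X} {𝔪 : LieIdeal ℝ 𝔤} (hX𝔪 : flag X d = 𝔪.toSubmodule)

include hX𝔪 in
theorem flagMap_mem (v : Fin d → ℝ) : flagMap X v ∈ 𝔪 := by
  change flagMap X v ∈ 𝔪.toSubmodule
  rw [← hX𝔪, mem_flag_iff_exists]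
  exact ⟨v, rfl⟩

include hX𝔪 in
theorem exists_flagMap_eq {y : 𝔤} (hy : y ∈ 𝔪) : ∃ v, flagMap X v = y := by
  rw [← mem_flag_iff_exists, hX𝔪]
  exact hy

include hX𝔪 in
theorem bracket_last_flagMap (v : Fin d → ℝ) :
    ⁅X (Fin.last d), flagMap X v⁆ = flagMap X (flagAd X v) := by
  obtain ⟨w, hw⟩ := exists_flagMap_eq hX𝔪
    (lie_mem_right ℝ 𝔤 𝔪 (X (Fin.last d)) _ (flagMap_mem hX𝔪 v))
  rw [← hw]
  congr 1
  funext i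
  have := coord_castSucc_flagMap X w i
  rw [hw] at this
  exact this.symm

include hX𝔪 in
theorem bracket_flagMap (hab : IsLieAbelian 𝔪) (v w : Fin d → ℝ) :
    ⁅flagMap X v, flagMap X w⁆ = 0 := by
  have := hab.1 ⟨_, flagMap_mem hX𝔪 v⟩ ⟨_, flagMap_mem hX𝔪 w⟩
  exact congrArg Subtype.val this

include hX𝔪 in
theorem isNilpotent_flagAd (h : LieRing.IsNilpotent 𝔤) : IsNilpotent (flagAd X) := by
  obtain ⟨k, hk⟩ := LieModule.isNilpotent_toEnd_of_isNilpotent ℝ 𝔤 𝔤 (X (Fin.last d))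
  refine ⟨k, LinearMap.ext fun v => ?_⟩
  have key : ∀ j : ℕ, flagMap X ((flagAd X ^ j) v) =
      (LieModule.toEnd ℝ 𝔤 𝔤 (X (Fin.last d)) ^ j) (flagMap X v) := by
    intro j
    induction j with
    | zero => rfl
    | succ j ih =>
      rw [pow_succ', pow_succ', Module.End.mul_apply, Module.End.mul_apply, ← ih,
        ← bracket_last_flagMap hX𝔪]
      rfl
  have h1 := key k
  rw [hk, LinearMap.zero_apply] at h1
  funext i
  have h2 := coord_castSucc_flagMap X ((flagAd X ^ k) v) i
  rw [h1, map_zero] at h2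
  exact h2.symm

-- Since the algebra is `ℝ X_n ⊕ 𝔪` with `𝔪` abelian, every bracket is a combination of brackets
-- `[X_n, Y]` with `Y ∈ 𝔪`. The commutator is therefore the image of `D`.
include hX𝔪 in
theorem eq_zero_on_commutator_iff (hab : IsLieAbelian 𝔪) (l : Module.Dual ℝ 𝔤) :
    (∀ Y ∈ ⁅(⊤ : LieIdeal ℝ 𝔤), (⊤ : LieIdeal ℝ 𝔤)⁆, l Y = 0) ↔
      ∀ v, l (flagMap X (flagAd X v)) = 0 := by
  constructor
  · intro h v
    refine h _ ?_
    rw [← bracket_last_flagMap hX𝔪]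
    exact LieSubmodule.lie_mem_lie (LieSubmodule.mem_top _) (LieSubmodule.mem_top _)
  · intro h Y hY
    change Y ∈ (⁅(⊤ : LieIdeal ℝ 𝔤), (⊤ : LieIdeal ℝ 𝔤)⁆).toSubmodule at hY
    rw [LieSubmodule.lieIdeal_oper_eq_linear_span'] at hY
    refine Submodule.span_induction (p := fun y _ => l y = 0) ?_ (map_zero _) ?_ ?_ hY
    · rintro _ ⟨x, -, y, -, rfl⟩
      rw [eq_smul_add_flagMap X x, eq_smul_add_flagMap X y]
      simp only [lie_add, add_lie, smul_lie, lie_smul, lie_self, smul_zero, zero_add,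
        bracket_flagMap hX𝔪 hab, add_zero]
      rw [← lie_skew, bracket_last_flagMap hX𝔪, bracket_last_flagMap hX𝔪]
      simp [h]
    · intro x y _ _ hx hy
      rw [map_add, hx, hy, add_zero]
    · intro a x _ hx
      rw [map_smul, hx, smul_zero]

theorem mem_genericSet_iff (hX𝔪 : flag X d = 𝔪.toSubmodule) (hab : IsLieAbelian 𝔪)
    (l : Module.Dual ℝ 𝔤) :
    l ∈ genericSet X ↔ (∃ z : Fin d → ℤ, ∀ v, l (flagMap X v) = ∑ i, (z i : ℝ) * v i) ∧
      l (X (Fin.last d)) = 0 ∧ ∃ v, l (flagMap X (flagAd X v)) ≠ 0 := by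
  have h1 := not_congr (eq_zero_on_commutator_iff hX𝔪 hab l)
  push Not at h1
  rw [genericSet, Set.mem_ofPred_eq, h1, ← and_assoc]
  refine and_congr_left fun _ => ⟨?_, ?_⟩
  · rintro ⟨k, hk, rfl⟩
    refine ⟨⟨fun i => k (Fin.castSucc i), fun v => ?_⟩, ?_⟩
    · rw [LinearMap.sum_apply, Fin.sum_univ_castSucc]
      simp only [LinearMap.smul_apply, coord_castSucc_flagMap, coord_last_flagMap, smul_eq_mul, mul_zero, add_zero]
    · simp [LinearMap.sum_apply, Finsupp.single_apply, hk]
  · rintro ⟨⟨z, hz⟩, h0⟩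
    refine ⟨Fin.snoc z 0, by simp, ?_⟩
    refine LinearMap.ext fun y => ?_
    conv_lhs => rw [eq_smul_add_flagMap X y, map_add, map_smul, h0, hz]
    simp [LinearMap.sum_apply, Fin.sum_univ_castSucc]

theorem mem_nonGenericSet_iff (hX𝔪 : flag X d = 𝔪.toSubmodule) (hab : IsLieAbelian 𝔪) {p : ℕ}
    (hXp : flag X p = (⁅(⊤ : LieIdeal ℝ 𝔤), (⊤ : LieIdeal ℝ 𝔤)⁆).toSubmodule)
    (l : Module.Dual ℝ 𝔤) :
    l ∈ nonGenericSet X p ↔ (∃ z : Fin d → ℤ, ∀ v, l (flagMap X v) = ∑ i, (z i : ℝ) * v i) ∧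
      (∃ j : ℤ, l (X (Fin.last d)) = j) ∧ ∀ v, l (flagMap X (flagAd X v)) = 0 := by
  rw [← eq_zero_on_commutator_iff hX𝔪 hab l]
  have h2 : (∀ Y ∈ ⁅(⊤ : LieIdeal ℝ 𝔤), (⊤ : LieIdeal ℝ 𝔤)⁆, l Y = 0) ↔
      ∀ i : Fin (d + 1), (i : ℕ) < p → l (X i) = 0 := by
    change (∀ Y ∈ (⁅(⊤ : LieIdeal ℝ 𝔤), (⊤ : LieIdeal ℝ 𝔤)⁆).toSubmodule, l Y = 0) ↔ _
    rw [← hXp]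
    constructor
    · intro h i hi
      exact h _ (Submodule.subset_span ⟨i, hi, rfl⟩)
    · intro h Y hY
      refine Submodule.span_induction (p := fun y _ => l y = 0) ?_ (map_zero _) ?_ ?_ hY
      · rintro _ ⟨i, hi, rfl⟩
        exact h i hi
      · intro x y _ _ hx hy
        rw [map_add, hx, hy, add_zero]
      · intro a x _ hx
        rw [map_smul, hx, smul_zero]
  rw [h2]
  constructor
  · rintro ⟨k, hk, rfl⟩
    refine ⟨⟨fun i => k (Fin.castSucc i), fun v => ?_⟩, ⟨k (Fin.last d), ?_⟩, fun i hi => ?_⟩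
    · rw [LinearMap.sum_apply, Fin.sum_univ_castSucc]
      simp only [LinearMap.smul_apply, coord_castSucc_flagMap, coord_last_flagMap, smul_eq_mul, mul_zero, add_zero]
    · simp [LinearMap.sum_apply, Finsupp.single_apply]
    · simp [LinearMap.sum_apply, Finsupp.single_apply, hk i hi]
  · rintro ⟨⟨z, hz⟩, ⟨j, hj⟩, h⟩
    have hl : ∀ i, l (X i) = ((Fin.snoc z j : Fin (d + 1) → ℤ) i : ℝ) := by
      intro i
      refine Fin.lastCases ?_ (fun i => ?_) i
      · simpa using hj
      · have := hz (Pi.single i 1)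
        rw [flagMap_apply] at this
        simpa [Pi.single_apply] using this
    refine ⟨Fin.snoc z j, fun i hi => ?_, X.ext fun i => ?_⟩
    · have := hl i
      rw [h i hi] at this
      exact_mod_cast this.symm
    · rw [hl]
      simp [LinearMap.sum_apply, Finsupp.single_apply]

end Algebra

end Nilmanifold
end

/-! ### Semidirect coordinates: the lattice `Γ`, the fiber `M`, and the functions `chi`. -/

noncomputable section

namespace Nilmanifold

section Coords

/-- An identification of `G` with a semidirect product `ℝ ⋉ ℝᵈ`. -/
structure SemidirectCoords (d : ℕ) (G : Type*) [Group G] [TopologicalSpace G] where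
  /-- The action of `ℝ` on `ℝᵈ`. -/
  A : LinearFlow (Fin d → ℝ)
  /-- The embedding of `ℝ`. -/
  e : ℝ → G
  /-- The embedding of `ℝᵈ`. -/
  m : (Fin d → ℝ) → G
  e_add : ∀ s t, e (s + t) = e s * e t
  m_add : ∀ v w, m (v + w) = m v * m w
  conj : ∀ t v, e t * m v = m (A.map t v) * e t
  isHomeomorph : IsHomeomorph fun p : ℝ × (Fin d → ℝ) => e p.1 * m p.2

/-- The point of `ℝᵈ` with the given integral coordinates. -/
def intVec {d : ℕ} (z : Fin d → ℤ) : Fin d → ℝ := fun i => z i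

theorem intVec_neg {d : ℕ} (z : Fin d → ℤ) : intVec (-z) = -intVec z := by
  funext i
  simp [intVec]

namespace SemidirectCoords

variable {d : ℕ} {G : Type*} [Group G] [TopologicalSpace G] (P : SemidirectCoords d G)

theorem e_zero : P.e 0 = 1 := by simpa using P.e_add 0 0
theorem m_zero : P.m 0 = 1 := by simpa using P.m_add 0 0

theorem m_neg (v : Fin d → ℝ) : P.m (-v) = (P.m v)⁻¹ :=
  eq_inv_of_mul_eq_one_left (by rw [← m_add, neg_add_cancel, m_zero])

theorem m_mul_e (t : ℝ) (v : Fin d → ℝ) : P.m v * P.e t = P.e t * P.m (P.A.map (-t) v) := by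
  rw [P.conj, P.A.map_map_neg]

/-- The coordinates as a homeomorphism. -/
def homeo : ℝ × (Fin d → ℝ) ≃ₜ G := P.isHomeomorph.homeomorph

theorem homeo_apply (p : ℝ × (Fin d → ℝ)) : P.homeo p = P.e p.1 * P.m p.2 := rfl

theorem continuous_e : Continuous P.e := by
  have h : P.e = fun t => P.homeo (t, 0) := funext fun t => by simp [homeo_apply, P.m_zero]
  rw [h]
  fun_prop

theorem continuous_m : Continuous P.m := by
  have h : P.m = fun v => P.homeo (0, v) := funext fun t => by simp [homeo_apply, P.e_zero]
  rw [h]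
  fun_prop

theorem coords_unique {s t : ℝ} {v w : Fin d → ℝ} (h : P.e s * P.m v = P.e t * P.m w) :
    s = t ∧ v = w := by
  have := P.homeo.injective (a₁ := (s, v)) (a₂ := (t, w)) h
  simpa using this

theorem exists_coords (g : G) : ∃ t v, g = P.e t * P.m v := by
  obtain ⟨p, hp⟩ := P.homeo.surjective g
  exact ⟨p.1, p.2, hp.symm⟩

/-- `Γ` consists of the points with integral coordinates. -/
def IsIntegral (Γ : Subgroup G) : Prop :=
  ∀ g, g ∈ Γ ↔ ∃ (k : ℤ) (z : Fin d → ℤ), g = P.e k * P.m (intVec z)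

/-- `M` is the subgroup `ℝᵈ`. -/
def IsFiber (M : Subgroup G) : Prop := ∀ g, g ∈ M ↔ ∃ v, g = P.m v

variable {P} {Γ M : Subgroup G}

theorem IsIntegral.e_mem (h : P.IsIntegral Γ) (k : ℤ) : P.e k ∈ Γ :=
  (h _).2 ⟨k, 0, by rw [show intVec (0 : Fin d → ℤ) = 0 from funext fun i => by simp [intVec],
    P.m_zero, mul_one]⟩

theorem IsIntegral.m_mem (h : P.IsIntegral Γ) (z : Fin d → ℤ) : P.m (intVec z) ∈ Γ :=
  (h _).2 ⟨0, z, by simp [P.e_zero]⟩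

theorem IsIntegral.of_m_mem (h : P.IsIntegral Γ) {v : Fin d → ℝ} (hv : P.m v ∈ Γ) :
    ∃ z, v = intVec z := by
  obtain ⟨k, z, hz⟩ := (h _).1 hv
  have : P.e 0 * P.m v = P.e k * P.m (intVec z) := by rw [P.e_zero, one_mul, hz]
  exact ⟨z, (P.coords_unique this).2⟩

/-- Conjugation by `e k ∈ Γ` preserves both `Γ` and the fiber, hence the lattice `ℤᵈ`. -/
theorem IsIntegral.map_intVec (h : P.IsIntegral Γ) (k : ℤ) (z : Fin d → ℤ) :
    ∃ y, P.A.map k (intVec z) = intVec y := by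
  refine h.of_m_mem ?_
  rw [← mul_inv_eq_iff_eq_mul.2 (P.conj k (intVec z))]
  exact Γ.mul_mem (Γ.mul_mem (h.e_mem k) (h.m_mem z)) (Γ.inv_mem (h.e_mem k))

theorem IsFiber.m_mem (h : P.IsFiber M) (v : Fin d → ℝ) : P.m v ∈ M := (h _).2 ⟨v, rfl⟩

end SemidirectCoords

end Coords

section Lie

namespace LieSplitting

variable {n d : ℕ} {G : Type*} [TopologicalSpace G] [ChartedSpace (EuclideanSpace ℝ (Fin n)) G]
  [Group G] [LieGroup (𝓡 n) ∞ G] [T2Space G] [SimplyConnectedSpace G] (L : LieSplitting n d G)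

/-- The semidirect product structure of the group. -/
def coords : SemidirectCoords d G where
  A := L.flow
  e := L.e
  m := L.m
  e_add := L.e_add
  m_add := L.m_add
  conj := L.conj
  isHomeomorph := L.isHomeomorph

theorem surjective_nilExpMean (t : ℝ) : Function.Surjective (nilExpMean L.D L.N t) :=
  LinearMap.surjective_of_injective (nilExpMean_injective L.pow_D t)

-- By `lieExp_add_b` equal exponentials have equal `t`, and for fixed `t` the fiber coordinate is an
-- injective function of `v`. This is what makes `lieLog` an inverse of `lieExp`, so that `chi` can
-- be evaluated.
include L in
theorem lieExp_injective : Function.Injective (lieExp : GroupLieAlgebra (𝓡 n) G → G) := by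
  intro Y Z h
  obtain ⟨⟨s, v⟩, rfl⟩ := L.bijective.2 Y
  obtain ⟨⟨t, w⟩, rfl⟩ := L.bijective.2 Z
  simp only [lieExp_add_b] at h
  have h1 := L.coords.m_mul_e s (nilExpMean L.D L.N s v)
  have h2 := L.coords.m_mul_e t (nilExpMean L.D L.N t w)
  have h3 : L.coords.m (nilExpMean L.D L.N s v) * L.coords.e s =
    L.coords.m (nilExpMean L.D L.N t w) * L.coords.e t := h
  rw [h1, h2] at h3
  obtain ⟨rfl, h4⟩ := L.coords.coords_unique h3
  have h5 := congrArg (L.coords.A.map s) h4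
  rw [L.coords.A.map_map_neg, L.coords.A.map_map_neg] at h5
  rw [nilExpMean_injective L.pow_D s h5]

include L in
theorem lieLog_lieExp (Y : GroupLieAlgebra (𝓡 n) G) : lieLog (lieExp Y) = Y :=
  Function.leftInverse_invFun L.lieExp_injective Y

theorem chi_m (l : Module.Dual ℝ (GroupLieAlgebra (𝓡 n) G)) (v : Fin d → ℝ) :
    chi l (L.m v) = Circle.exp (2 * Real.pi * l (L.b v)) := by
  rw [chi, m, L.lieLog_lieExp]

/-- All terms with `k ≥ 1` lie in the image of `D`, where `f` vanishes. -/
theorem apply_sum_pow {f : (Fin d → ℝ) →ₗ[ℝ] ℝ} (hf : ∀ v, f (L.D v) = 0) {c : ℕ → ℝ}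
    (hc : c 0 = 1) (v : Fin d → ℝ) :
    f (∑ k ∈ Finset.range L.N, c k • (L.D ^ k) v) = f v := by
  rcases Nat.eq_zero_or_pos L.N with h | h
  · have h2 : v = 0 := by
      have := LinearMap.congr_fun L.pow_D v
      simpa [h] using this
    simp [h2]
  · rw [map_sum, Finset.sum_eq_single_of_mem 0 (by simpa using h)]
    · simp [hc]
    · intro k _ hk
      obtain ⟨j, rfl⟩ := Nat.exists_eq_succ_of_ne_zero hk
      rw [map_smul, pow_succ', Module.End.mul_apply, hf, smul_zero]

theorem apply_nilExp {f : (Fin d → ℝ) →ₗ[ℝ] ℝ} (hf : ∀ v, f (L.D v) = 0) (t : ℝ)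
    (v : Fin d → ℝ) : f (nilExp L.D L.N t v) = f v := by
  rw [nilExp_apply]
  exact L.apply_sum_pow hf (by simp) v

/-- The point `e t * m v` is `exp (tT + b u)` with `nilExpMean u = nilExp v`. A functional killing
the image of `D` sees neither series beyond its constant term, so `l (b u) = l (b v)`. -/
theorem chi_e_mul_m {l : Module.Dual ℝ (GroupLieAlgebra (𝓡 n) G)} (hl : ∀ v, l (L.b (L.D v)) = 0)
    (t : ℝ) (v : Fin d → ℝ) :
    chi l (L.e t * L.m v) = Circle.exp (2 * Real.pi * (t * l L.T + l (L.b v))) := by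
  obtain ⟨u, hu⟩ := L.surjective_nilExpMean t (nilExp L.D L.N t v)
  have h1 : l (L.b u) = l (L.b v) := by
    have h2 := L.apply_nilExp (f := l ∘ₗ L.b) hl t v
    rw [← hu, nilExpMean_apply, L.apply_sum_pow (f := l ∘ₗ L.b) hl (by simp)] at h2
    exact h2
  rw [L.conj, ← hu, ← lieExp_add_b, chi, L.lieLog_lieExp, map_add, map_smul, h1, smul_eq_mul]

theorem lieAd_m (w v : Fin d → ℝ) : lieAd (L.m w) (L.b v) = L.b v := by
  have h := lieAd_expCurve_of_bracket_eq_zero (L.bracket_b w v) 1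
  rwa [← lieExp_smul, one_smul] at h

/-- The abelian factor acts trivially, so only the time coordinate matters. This reduces `Γ`-orbits
of functionals on `𝔪` to `ℤ`-orbits. -/
theorem lieAd_inv (t : ℝ) (w v : Fin d → ℝ) :
    lieAd (L.e t * L.m w)⁻¹ (L.b v) = L.b (nilExp L.D L.N (-t) v) := by
  rw [mul_inv_rev, ← L.m_neg, ← L.e_neg, lieAd_mul, lieAd_e, lieAd_m]

theorem prod_ofFn (w : Fin d → ℝ) :
    (List.ofFn fun i => L.m (Pi.single i (w i))).prod = L.m w := by
  let f : Multiplicative (Fin d → ℝ) →* G :=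
    { toFun := fun v => L.m v.toAdd
      map_one' := L.m_zero
      map_mul' := fun v w => L.m_add v.toAdd w.toAdd }
  have h := map_list_prod f (List.ofFn fun i => Multiplicative.ofAdd (Pi.single i (w i)))
  rw [List.map_ofFn] at h
  refine Eq.trans (Eq.trans ?_ h.symm) ?_
  · rfl
  · rw [List.prod_ofFn]
    change L.m _ = L.m w
    congr 1
    rw [toAdd_prod]
    exact Finset.univ_sum_single w

end LieSplitting

variable {d : ℕ} {G : Type*} [TopologicalSpace G] [T2Space G]
    [ChartedSpace (EuclideanSpace ℝ (Fin (d + 1))) G] [Group G] [LieGroup (𝓡 (d + 1)) ∞ G]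

/-- The splitting of the Lie algebra defined by a Malcev basis through an abelian ideal. -/
def malcevSplitting {𝔪 : LieIdeal ℝ (GroupLieAlgebra (𝓡 (d + 1)) G)}
    {X : Module.Basis (Fin (d + 1)) ℝ (GroupLieAlgebra (𝓡 (d + 1)) G)}
    (hX𝔪 : flag X d = 𝔪.toSubmodule) (hab : IsLieAbelian 𝔪)
    (h : LieRing.IsNilpotent (GroupLieAlgebra (𝓡 (d + 1)) G)) :
    LieSplitting (d + 1) d G where
  T := X (Fin.last d)
  b := flagMap X
  D := flagAd X
  N := (isNilpotent_flagAd hX𝔪 h).choose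
  pow_D := (isNilpotent_flagAd hX𝔪 h).choose_spec
  bracket_b := bracket_flagMap hX𝔪 hab
  bracket_T := bracket_last_flagMap hX𝔪
  bijective := by
    constructor
    · rintro ⟨s, v⟩ ⟨t, w⟩ hst
      have h1 := congrArg (X.coord (Fin.last d)) hst
      have h2 := fun i : Fin d => congrArg (X.coord (Fin.castSucc i)) hst
      simp only [map_add, map_smul, coord_last_flagMap, coord_castSucc_flagMap] at h1 h2
      refine Prod.ext (by simpa using h1) (funext fun i => ?_)
      simpa [Finsupp.single_apply, (Fin.castSucc_ne_last i).symm] using h2 i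
    · intro y
      exact ⟨(_, _), (eq_smul_add_flagMap X y).symm⟩

variable [SimplyConnectedSpace G] {𝔪 : LieIdeal ℝ (GroupLieAlgebra (𝓡 (d + 1)) G)}
    {X : Module.Basis (Fin (d + 1)) ℝ (GroupLieAlgebra (𝓡 (d + 1)) G)}
    (hX𝔪 : flag X d = 𝔪.toSubmodule) (hab : IsLieAbelian 𝔪)
    (h : LieRing.IsNilpotent (GroupLieAlgebra (𝓡 (d + 1)) G))

/-- The ordered product of the basis exponentials has the form `m z * e k`, with the factors
opposite to the coordinates `e k * m z`. Passing to inverses, under which `Γ` is stable, exchanges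
them. -/
theorem isIntegral_malcevSplitting {Γ : Subgroup G} (hXΓ : IsStronglyBasedOn X Γ) :
    (malcevSplitting hX𝔪 hab h).coords.IsIntegral Γ := by
  set L := malcevSplitting hX𝔪 hab h with hL
  have h1 : ∀ k : Fin (d + 1) → ℤ, (List.ofFn fun i => lieExp ((k i : ℝ) • X i)).prod =
      L.m (intVec fun i => k (Fin.castSucc i)) * L.e (k (Fin.last d)) := by
    intro k
    rw [List.ofFn_succ', List.concat_eq_append, List.prod_append, List.prod_singleton,
      ← L.prod_ofFn]
    congr 1
    · congr 2
      funext i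
      rw [LieSplitting.m]
      congr 1
      change _ = flagMap X _
      rw [flagMap_apply, Finset.sum_eq_single i]
      · simp [intVec]
      · intro j _ hj
        simp [hj]
      · simp
    · exact lieExp_smul _ _
  intro g
  have h2 : g ∈ Γ ↔ g⁻¹ ∈ (Γ : Set G) := by
    rw [SetLike.mem_coe, inv_mem_iff]
  rw [h2, hXΓ]
  simp only [Set.mem_range, h1]
  constructor
  · rintro ⟨k, hk⟩
    refine ⟨-k (Fin.last d), -fun i => k (Fin.castSucc i), ?_⟩
    change g = L.e _ * L.m _
    rw [intVec_neg, L.m_neg, Int.cast_neg, L.e_neg, ← mul_inv_rev, hk, inv_inv]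
  · rintro ⟨k, z, hk⟩
    change g = L.e _ * L.m _ at hk
    refine ⟨Fin.snoc (-z) (-k), ?_⟩
    simp only [Fin.snoc_castSucc, Fin.snoc_last]
    change L.m (intVec (-z)) * _ = _
    rw [hk, mul_inv_rev, intVec_neg, L.m_neg, Int.cast_neg, L.e_neg]

theorem isFiber_malcevSplitting {M : Subgroup G}
    (hM : (M : Set G) = lieExp '' (𝔪 : Set (GroupLieAlgebra (𝓡 (d + 1)) G))) :
    (malcevSplitting hX𝔪 hab h).coords.IsFiber M := by
  intro g
  rw [← SetLike.mem_coe, hM]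
  constructor
  · rintro ⟨Y, hY, rfl⟩
    obtain ⟨v, rfl⟩ := exists_flagMap_eq hX𝔪 hY
    exact ⟨v, rfl⟩
  · rintro ⟨v, rfl⟩
    exact ⟨_, flagMap_mem hX𝔪 v, rfl⟩

end Lie

end Nilmanifold
end

/-! ### Invariant measures on the quotients, in coordinates. -/

noncomputable section

namespace Nilmanifold

section Unfold

open scoped Pointwise

variable {G : Type*} [Group G] [TopologicalSpace G] [IsTopologicalGroup G] [MeasurableSpace G]
  [BorelSpace G] (Γ : Subgroup G)

/-- The counting measure on a coset of `Γ`. -/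
def cosetCount (x : G ⧸ Γ) : Measure G := Measure.sum fun γ : Γ => Measure.dirac (x.out * γ)

variable {Γ}

theorem cosetCount_apply {E : Set G} (hE : MeasurableSet E) (g : G) :
    cosetCount Γ (g : G ⧸ Γ) E = ∑' γ : Γ, E.indicator (fun _ => (1 : ℝ≥0∞)) (g * γ) := by
  obtain ⟨h, hh⟩ := QuotientGroup.mk_out_eq_mul Γ g
  rw [cosetCount, Measure.sum_apply _ hE]
  simp_rw [Measure.dirac_apply' _ hE, hh]
  rw [← (Equiv.mulLeft h).tsum_eq fun γ : Γ => E.indicator (fun _ => (1 : ℝ≥0∞)) (g * γ)]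
  refine tsum_congr fun γ => ?_
  rw [mul_assoc]
  rfl

theorem measurable_cosetCount [Countable Γ] : Measurable (cosetCount Γ) := by
  refine Measure.measurable_of_measurable_coe _ fun E hE => measurable_from_quotient.2 ?_
  have : (fun x : G ⧸ Γ => cosetCount Γ x E) ∘ Quotient.mk'' =
      fun g : G => ∑' γ : Γ, E.indicator (fun _ => (1 : ℝ≥0∞)) (g * γ) :=
    funext fun g => cosetCount_apply hE g
  rw [this]
  refine Measurable.tsum fun γ => ?_
  exact (measurable_one.indicator hE).comp (measurable_mul_const (γ : G))

theorem cosetCount_smul (g : G) (x : G ⧸ Γ) {E : Set G} (hE : MeasurableSet E) :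
    cosetCount Γ (g • x) E = cosetCount Γ x ((g * ·) ⁻¹' E) := by
  induction x using QuotientGroup.induction_on with
  | H a =>
    rw [cosetCount_apply (hE.preimage (measurable_const_mul g))]
    change cosetCount Γ ((g * a : G) : G ⧸ Γ) E = _
    rw [cosetCount_apply hE]
    refine tsum_congr fun γ => ?_
    rw [mul_assoc]
    rfl

variable (ν : Measure (G ⧸ Γ))

/-- The measure on `G` obtained from a measure on `G ⧸ Γ` and the counting measure on `Γ`. -/
def unfoldMeasure : Measure G := ν.bind (cosetCount Γ)

variable {ν}

theorem unfoldMeasure_apply [Countable Γ] {E : Set G} (hE : MeasurableSet E) :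
    unfoldMeasure ν E = ∫⁻ x, cosetCount Γ x E ∂ν :=
  Measure.bind_apply hE measurable_cosetCount.aemeasurable

instance isMulLeftInvariant_unfoldMeasure [Countable Γ] [SMulInvariantMeasure G (G ⧸ Γ) ν] :
    (unfoldMeasure ν).IsMulLeftInvariant where
  map_mul_left_eq_self g := by
    ext E hE
    rw [Measure.map_apply (measurable_const_mul g) hE,
      unfoldMeasure_apply (hE.preimage (measurable_const_mul g)), unfoldMeasure_apply hE]
    simp_rw [← cosetCount_smul g _ hE]
    exact (measurePreserving_smul g ν).lintegral_comp
      ((Measure.measurable_coe hE).comp measurable_cosetCount)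

/-- If `g γ₀ ∈ K`, any other `g γ₀ γ ∈ K` has `γ ∈ K⁻¹ K`. So each coset meets `K` in at most `|Γ ∩
K⁻¹ K|` points, a finite number by discreteness. -/
theorem isFiniteMeasureOnCompacts_unfoldMeasure [T2Space G] [Countable Γ] [DiscreteTopology Γ]
    [IsFiniteMeasure ν] : IsFiniteMeasureOnCompacts (unfoldMeasure ν) where
  lt_top_of_isCompact K hK := by
    have hf : (Subtype.val ⁻¹' (K⁻¹ * K) : Set Γ).Finite := by
      have h1 := Subgroup.tendsto_coe_cofinite_of_discrete Γ ⟨‹_›⟩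
      have h2 := h1 ((hK.inv.mul hK).compl_mem_cocompact)
      simpa using h2
    rw [unfoldMeasure_apply hK.measurableSet]
    refine (lintegral_mono (g := fun _ => (hf.toFinset.card : ℝ≥0∞)) fun x => ?_).trans_lt ?_
    · induction x using QuotientGroup.induction_on with
      | H g =>
        change cosetCount Γ (g : G ⧸ Γ) K ≤ _
        rw [cosetCount_apply hK.measurableSet]
        by_cases h : ∃ γ₀ : Γ, g * γ₀ ∈ K
        · obtain ⟨γ₀, h0⟩ := h
          rw [← (Equiv.mulLeft γ₀).tsum_eq, tsum_eq_sum (s := hf.toFinset)]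
          · refine (Finset.sum_le_card_nsmul _ _ 1 fun γ _ => ?_).trans (by simp)
            exact Set.indicator_le_self' (fun _ _ => zero_le) _
          · intro γ hγ
            refine Set.indicator_of_notMem (fun hK' => hγ ?_) _
            rw [Set.Finite.mem_toFinset]
            refine ⟨(g * γ₀)⁻¹, Set.inv_mem_inv.2 h0, _, hK', ?_⟩
            simp [mul_assoc]
        · push Not at h
          simp [h]
    · rw [lintegral_const]
      exact ENNReal.mul_lt_top (by simp) (measure_lt_top _ _)

/-- An invariant probability measure on `G ⧸ Γ` comes from Haar measure on a fundamental domain. -/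
theorem eq_map_restrict_of_fundamentalDomain [T2Space G] [LocallyCompactSpace G]
    [SecondCountableTopology G] [Countable Γ] [DiscreteTopology Γ] [IsProbabilityMeasure ν]
    [SMulInvariantMeasure G (G ⧸ Γ) ν] (μ : Measure G) [μ.IsHaarMeasure] {F : Set G}
    (hF : MeasurableSet F) (hΓ : ∀ g : G, ∃! γ : Γ, g * γ ∈ F) (h1 : μ F = 1) :
    ν = (μ.restrict F).map (QuotientGroup.mk : G → G ⧸ Γ) := by
  have hmk : Measurable (QuotientGroup.mk : G → G ⧸ Γ) := measurable_from_quotient.1 measurable_id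
  have := isFiniteMeasureOnCompacts_unfoldMeasure (ν := ν)
  have h2 := Measure.isMulLeftInvariant_eq_smul (unfoldMeasure ν) μ
  set c := (unfoldMeasure ν).haarScalarFactor μ
  have key : ∀ B : Set (G ⧸ Γ), MeasurableSet B → ν B = c * μ (QuotientGroup.mk ⁻¹' B ∩ F) := by
    intro B hB
    have hE : MeasurableSet (QuotientGroup.mk ⁻¹' B ∩ F) := (hB.preimage hmk).inter hF
    -- Every coset meets `F` in exactly one point, so counting the points over `B` in `F` gives the
    -- indicator function of `B`.
    have h3 : unfoldMeasure ν (QuotientGroup.mk ⁻¹' B ∩ F) = ν B := by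
      rw [unfoldMeasure_apply hE, ← lintegral_indicator_one hB]
      refine lintegral_congr fun x => ?_
      induction x using QuotientGroup.induction_on with
      | H g =>
        rw [cosetCount_apply hE]
        obtain ⟨γ, h4, h5⟩ := hΓ g
        rw [tsum_eq_single γ]
        · have h6 : g * (γ : G) ∈ (QuotientGroup.mk ⁻¹' B ∩ F : Set G) ↔ (g : G ⧸ Γ) ∈ B := by
            rw [Set.mem_inter_iff, and_iff_left h4, Set.mem_preimage,
              QuotientGroup.mk_mul_of_mem g γ.2]
          by_cases h7 : (g : G ⧸ Γ) ∈ B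
          · rw [Set.indicator_of_mem (h6.2 h7), Set.indicator_of_mem h7]
            rfl
          · rw [Set.indicator_of_notMem (h6.not.2 h7), Set.indicator_of_notMem h7]
        · intro γ' hγ'
          exact Set.indicator_of_notMem (fun h6 => hγ' (h5 γ' h6.2)) _
    rw [← h3, h2]
    rfl
  -- The Haar scalar is fixed by `B = univ`, both total masses being `1`.
  have hc : (c : ℝ≥0∞) = 1 := by
    have := key Set.univ MeasurableSet.univ
    rwa [measure_univ, Set.preimage_univ, Set.univ_inter, h1, mul_one, eq_comm] at this
  ext B hB
  rw [key B hB, hc, one_mul, Measure.map_apply hmk hB, Measure.restrict_apply (hB.preimage hmk)]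

end Unfold

section UnitCube

/-- The half-open unit cube. -/
def unitCube (d : ℕ) : Set (Fin d → ℝ) := {v | ∀ i, v i ∈ Set.Ioc 0 1}

theorem unitCube_eq_pi (d : ℕ) : unitCube d = Set.univ.pi fun _ => Set.Ioc (0 : ℝ) 1 := by
  ext v
  simp [unitCube]

theorem measurableSet_unitCube (d : ℕ) : MeasurableSet (unitCube d) := by
  rw [unitCube_eq_pi]
  exact MeasurableSet.univ_pi fun _ => measurableSet_Ioc

theorem volume_unitCube (d : ℕ) : volume (unitCube d) = 1 := by
  rw [unitCube_eq_pi, volume_pi_pi]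
  simp

theorem existsUnique_add_int_mem_Ioc (t : ℝ) : ∃! k : ℤ, t + k ∈ Set.Ioc (0 : ℝ) 1 := by
  have := existsUnique_add_zsmul_mem_Ioc (zero_lt_one (α := ℝ)) t 0
  simpa using this

theorem existsUnique_add_intVec_mem_unitCube {d : ℕ} (v : Fin d → ℝ) :
    ∃! z : Fin d → ℤ, v + intVec z ∈ unitCube d := by
  choose z hz hu using fun i => existsUnique_add_int_mem_Ioc (v i)
  exact ⟨z, hz, fun y hy => funext fun i => hu i _ (hy i)⟩

end UnitCube

namespace SemidirectCoords

variable {d : ℕ} {G : Type*} [Group G] [TopologicalSpace G] (P : SemidirectCoords d G)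

include P in
theorem secondCountableTopology : SecondCountableTopology G :=
  P.homeo.symm.secondCountableTopology

include P in
theorem locallyCompactSpace : LocallyCompactSpace G :=
  P.homeo.symm.isClosedEmbedding.locallyCompactSpace

/-- The point of the fiber with the given coordinates. -/
def fiberMk {M : Subgroup G} (hM : P.IsFiber M) (v : Fin d → ℝ) : M := ⟨P.m v, hM.m_mem v⟩

theorem isEmbedding_m : Topology.IsEmbedding P.m := by
  have h : P.m = P.homeo ∘ fun v => (0, v) := funext fun v => by simp [homeo_apply, P.e_zero]
  rw [h]
  exact P.homeo.isEmbedding.comp (isEmbedding_prodMkRight 0)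

/-- The coordinates on the fiber. -/
def fiberHomeo {M : Subgroup G} (hM : P.IsFiber M) : (Fin d → ℝ) ≃ₜ M :=
  (P.isEmbedding_m.codRestrict (M : Set G) hM.m_mem).toHomeomorphOfSurjective fun g => by
    obtain ⟨v, hv⟩ := (hM _).1 g.2
    exact ⟨v, Subtype.ext hv.symm⟩

theorem fiberHomeo_apply {M : Subgroup G} (hM : P.IsFiber M) (v : Fin d → ℝ) :
    P.fiberHomeo hM v = P.fiberMk hM v := rfl

variable [IsTopologicalGroup G] [MeasurableSpace G] [BorelSpace G]

/-- Haar measure in coordinates. -/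
def haar : Measure G := (volume : Measure (ℝ × (Fin d → ℝ))).map P.homeo

theorem isHaarMeasure_map_homeomorph {H V : Type*} [Group H] [TopologicalSpace H]
    [T2Space H] [IsTopologicalGroup H] [MeasurableSpace H] [BorelSpace H] [TopologicalSpace V]
    [MeasurableSpace V] [BorelSpace V] (f : V ≃ₜ H) (μ : Measure V) [IsFiniteMeasureOnCompacts μ]
    [μ.IsOpenPosMeasure] (h : ∀ g, ∃ φ : V → V, MeasurePreserving φ μ μ ∧ ∀ v, f (φ v) = g * f v) :
    (μ.map f).IsHaarMeasure where
  lt_top_of_isCompact K hK := by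
    rw [Measure.map_apply f.measurable hK.isClosed.measurableSet]
    exact (f.isCompact_preimage.2 hK).measure_lt_top
  map_mul_left_eq_self g := by
    obtain ⟨φ, h1, h2⟩ := h g
    rw [Measure.map_map (measurable_const_mul g) f.measurable]
    have : (g * ·) ∘ f = f ∘ φ := funext fun v => (h2 v).symm
    rw [this, ← Measure.map_map f.measurable h1.measurable, h1.map_eq]
  open_pos := (f.continuous.isOpenPosMeasure_map f.surjective (μ := μ)).open_pos

variable [T2Space G]

/-- Left translation by `e s * m w` reads `(t, v) ↦ (s + t, A₋ₜ w + v)`: a translation of the base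
followed by a translation in each fiber, which preserves Lebesgue measure. -/
instance isHaarMeasure_haar : P.haar.IsHaarMeasure := by
  refine isHaarMeasure_map_homeomorph P.homeo volume fun g => ?_
  obtain ⟨s, w, rfl⟩ := P.exists_coords g
  refine ⟨fun p => (s + p.1, P.A.map (-p.1) w + p.2), ?_, fun p => ?_⟩
  · refine (measurePreserving_add_left volume s).skew_product (g := fun t v => P.A.map (-t) w + v)
      ?_ (Eventually.of_forall fun t => ?_)
    · have : Continuous fun p : ℝ × (Fin d → ℝ) => P.A.map (-p.1) w + p.2 :=
        (P.A.continuous_map.comp (by fun_prop :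
          Continuous fun p : ℝ × (Fin d → ℝ) => (-p.1, w))).add (by fun_prop)
      exact this.measurable
    · exact (measurePreserving_add_left volume (P.A.map (-t) w)).map_eq
  · simp only [homeo_apply, P.e_add, P.m_add]
    have := P.m_mul_e p.1 w
    simp only [mul_assoc]
    rw [← mul_assoc (P.m w), this, mul_assoc]

variable {P} {Γ M : Subgroup G}

/-- Right multiplication by `e k * m z` shifts `t` by `k` and sends `v` to `A₋ₖ v + z`. Hence `k` is
determined by `t`, and afterwards `z` by `A₋ₖ v`. -/
theorem IsIntegral.existsUnique_mul_mem (h : P.IsIntegral Γ) (g : G) :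
    ∃! γ : Γ, g * γ ∈ P.homeo '' (Set.Ioc 0 1 ×ˢ unitCube d) := by
  obtain ⟨t, v, rfl⟩ := P.exists_coords g
  have key : ∀ (k : ℤ) (z : Fin d → ℤ), P.e t * P.m v * (P.e k * P.m (intVec z)) ∈
      P.homeo '' (Set.Ioc 0 1 ×ˢ unitCube d) ↔
      t + k ∈ Set.Ioc (0 : ℝ) 1 ∧ P.A.map (-k) v + intVec z ∈ unitCube d := by
    intro k z
    have : P.e t * P.m v * (P.e k * P.m (intVec z)) =
        P.homeo (t + k, P.A.map (-k) v + intVec z) := by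
      simp only [homeo_apply, P.e_add, P.m_add]
      have := P.m_mul_e k v
      simp only [mul_assoc]
      rw [← mul_assoc (P.m v), this, mul_assoc]
    rw [this, P.homeo.injective.mem_set_image, Set.mem_prod]
  obtain ⟨k, hk, hku⟩ := existsUnique_add_int_mem_Ioc t
  obtain ⟨z, hz, hzu⟩ := existsUnique_add_intVec_mem_unitCube (P.A.map (-k) v)
  refine ⟨⟨P.e k * P.m (intVec z), (h _).2 ⟨k, z, rfl⟩⟩, (key k z).2 ⟨hk, hz⟩, ?_⟩
  rintro ⟨γ, hγ⟩ h1
  obtain ⟨k', z', rfl⟩ := (h _).1 hγ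
  obtain ⟨h2, h3⟩ := (key k' z').1 h1
  obtain rfl := hku k' h2
  obtain rfl := hzu z' h3
  rfl

/-- The invariant probability measure on `G ⧸ Γ` in coordinates. -/
theorem IsIntegral.measure_eq (h : P.IsIntegral Γ) [DiscreteTopology Γ] (ν : Measure (G ⧸ Γ))
    [IsProbabilityMeasure ν] [SMulInvariantMeasure G (G ⧸ Γ) ν] :
    ν = ((volume : Measure (ℝ × (Fin d → ℝ))).restrict (Set.Ioc 0 1 ×ˢ unitCube d)).map
      fun p => ((P.homeo p : G) : G ⧸ Γ) := by
  have := P.secondCountableTopology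
  have := P.locallyCompactSpace
  have : Countable Γ := countable_of_Lindelof_of_discrete
  have hmk : Measurable (QuotientGroup.mk : G → G ⧸ Γ) := measurable_from_quotient.1 measurable_id
  have hme := P.homeo.measurableEmbedding
  have hms : MeasurableSet (Set.Ioc (0 : ℝ) 1 ×ˢ unitCube d) :=
    measurableSet_Ioc.prod (measurableSet_unitCube d)
  have h1 := eq_map_restrict_of_fundamentalDomain (ν := ν) P.haar
    (hme.measurableSet_image.2 hms) h.existsUnique_mul_mem (by
      rw [haar, hme.map_apply, P.homeo.injective.preimage_image, Measure.volume_eq_prod,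
        Measure.prod_prod, volume_unitCube]
      simp)
  rw [haar, hme.restrict_map, P.homeo.injective.preimage_image,
    Measure.map_map hmk hme.measurable] at h1
  exact h1

/-- The invariant probability measure on `M ⧸ (M ∩ Γ)` in coordinates. -/
theorem IsFiber.measure_eq (hM : P.IsFiber M) (h : P.IsIntegral Γ) [DiscreteTopology Γ]
    (κ : Measure (M ⧸ Γ.subgroupOf M)) [IsProbabilityMeasure κ]
    [SMulInvariantMeasure M (M ⧸ Γ.subgroupOf M) κ] :
    κ = ((volume : Measure (Fin d → ℝ)).restrict (unitCube d)).map
      fun v => ((P.fiberMk hM v : M) : M ⧸ Γ.subgroupOf M) := by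
  have : SecondCountableTopology M := (P.fiberHomeo hM).symm.secondCountableTopology
  have : LocallyCompactSpace M := (P.fiberHomeo hM).symm.isClosedEmbedding.locallyCompactSpace
  have : DiscreteTopology (Γ.subgroupOf M) := by
    refine DiscreteTopology.of_continuous_injective
      (f := fun x : Γ.subgroupOf M => (⟨x.1.1, x.2⟩ : Γ)) (by fun_prop) fun x y hxy => ?_
    exact Subtype.ext (Subtype.ext (congrArg (fun z : Γ => (z : G)) hxy))
  have : Countable (Γ.subgroupOf M) := countable_of_Lindelof_of_discrete
  have hmk : Measurable (QuotientGroup.mk : M → M ⧸ Γ.subgroupOf M) :=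
    measurable_from_quotient.1 measurable_id
  have hme := (P.fiberHomeo hM).measurableEmbedding
  have hH : ((volume : Measure (Fin d → ℝ)).map (P.fiberHomeo hM)).IsHaarMeasure := by
    refine isHaarMeasure_map_homeomorph (P.fiberHomeo hM) volume fun g => ?_
    obtain ⟨w, hw⟩ := (hM _).1 g.2
    refine ⟨fun v => w + v, measurePreserving_add_left volume w, fun v => Subtype.ext ?_⟩
    change P.m (w + v) = g.1 * P.m v
    rw [P.m_add, hw]
  have h1 := eq_map_restrict_of_fundamentalDomain (ν := κ)
    ((volume : Measure (Fin d → ℝ)).map (P.fiberHomeo hM))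
    (hme.measurableSet_image.2 (measurableSet_unitCube d)) (fun g => ?_) (by
      rw [hme.map_apply, (P.fiberHomeo hM).injective.preimage_image, volume_unitCube])
  · rw [hme.restrict_map, (P.fiberHomeo hM).injective.preimage_image,
      Measure.map_map hmk hme.measurable] at h1
    exact h1
  · obtain ⟨v, rfl⟩ := (P.fiberHomeo hM).surjective g
    have key : ∀ z, P.fiberHomeo hM v * P.fiberMk hM (intVec z) ∈ P.fiberHomeo hM '' unitCube d ↔
        v + intVec z ∈ unitCube d := by
      intro z
      have : P.fiberHomeo hM v * P.fiberMk hM (intVec z) = P.fiberHomeo hM (v + intVec z) :=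
        Subtype.ext (P.m_add _ _).symm
      rw [this, (P.fiberHomeo hM).injective.mem_set_image]
    obtain ⟨z, hz, hzu⟩ := existsUnique_add_intVec_mem_unitCube v
    refine ⟨⟨P.fiberMk hM (intVec z), h.m_mem z⟩, (key z).2 hz, ?_⟩
    rintro ⟨⟨γ, hγM⟩, hγ⟩ h1
    obtain ⟨w, rfl⟩ := (hM _).1 hγM
    obtain ⟨z', rfl⟩ := h.of_m_mem hγ
    obtain rfl := hzu z' ((key z').1 h1)
    rfl

/-- The coset space of the fiber is the line. -/
def IsFiber.lineEquiv (hM : P.IsFiber M) : ℝ ≃ᵐ G ⧸ M where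
  toFun t := (P.e t : G ⧸ M)
  invFun := descend M fun g => (P.homeo.symm g).1
  left_inv t := by
    have hinv : RightInvariant M fun g => (P.homeo.symm g).1 := by
      intro g x hx
      obtain ⟨w, rfl⟩ := (hM _).1 hx
      obtain ⟨⟨t, v⟩, rfl⟩ := P.homeo.surjective g
      have : P.homeo (t, v) * P.m w = P.homeo (t, v + w) := by
        simp [homeo_apply, P.m_add, mul_assoc]
      simp [this]
    rw [descend_mk hinv]
    have : P.e t = P.homeo (t, 0) := by simp [homeo_apply, P.m_zero]
    simp [this]
  right_inv x := by
    obtain ⟨⟨t, v⟩, h⟩ := P.homeo.surjective x.out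
    have h1 : (P.homeo.symm x.out).1 = t := by simp [← h]
    simp only [descend, h1]
    conv_rhs => rw [← QuotientGroup.out_eq' x, ← h]
    exact (QuotientGroup.mk_mul_of_mem _ (hM.m_mem v)).symm
  measurable_toFun := by
    have hmk : Measurable (QuotientGroup.mk : G → G ⧸ M) := measurable_from_quotient.1 measurable_id
    exact hmk.comp P.continuous_e.measurable
  measurable_invFun := by
    have hinv : RightInvariant M fun g => (P.homeo.symm g).1 := by
      intro g x hx
      obtain ⟨w, rfl⟩ := (hM _).1 hx
      obtain ⟨⟨t, v⟩, rfl⟩ := P.homeo.surjective g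
      have : P.homeo (t, v) * P.m w = P.homeo (t, v + w) := by
        simp [homeo_apply, P.m_add, mul_assoc]
      simp [this]
    exact (continuous_descend hinv (by fun_prop)).measurable

theorem IsFiber.lineEquiv_apply (hM : P.IsFiber M) (t : ℝ) :
    hM.lineEquiv t = (P.e t : G ⧸ M) := rfl

/-- The normalized invariant measure on `G ⧸ M` is Lebesgue measure. -/
theorem IsFiber.measure_quotient_eq (hM : P.IsFiber M) (μ : Measure (G ⧸ M))
    [IsFiniteMeasureOnCompacts μ] [SMulInvariantMeasure G (G ⧸ M) μ]
    (hμ : μ ((fun t : ℝ => (P.e t : G ⧸ M)) '' Set.Ico 0 1) = 1) :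
    μ = (volume : Measure ℝ).map hM.lineEquiv := by
  set μ' := μ.map hM.lineEquiv.symm with hμ'
  have hq : Continuous hM.lineEquiv := by
    have h1 : Continuous fun t => (P.e t : G ⧸ M) :=
      QuotientGroup.continuous_mk.comp P.continuous_e
    exact h1
  have h0 : ∀ s : Set ℝ, μ' s = μ (hM.lineEquiv '' s) := fun s => by
    rw [hμ', MeasurableEquiv.map_apply, MeasurableEquiv.image_eq_preimage_symm]
  have h1 : IsFiniteMeasureOnCompacts μ' :=
    ⟨fun K hK => by
      rw [h0]
      exact (hK.image hq).measure_lt_top⟩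
  have h2 : μ'.IsAddLeftInvariant := by
    refine ⟨fun s => ?_⟩
    ext E hE
    rw [Measure.map_apply (measurable_const_add s) hE, h0, h0]
    have h3 : hM.lineEquiv '' ((s + ·) ⁻¹' E) =
        (fun x : G ⧸ M => P.e s • x) ⁻¹' (hM.lineEquiv '' E) := by
      ext x
      obtain ⟨t, rfl⟩ := hM.lineEquiv.surjective x
      have h4 : P.e s • hM.lineEquiv t = hM.lineEquiv (s + t) := by
        rw [lineEquiv_apply, lineEquiv_apply, P.e_add]
        rfl
      rw [hM.lineEquiv.injective.mem_set_image, Set.mem_preimage, Set.mem_preimage, h4,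
        hM.lineEquiv.injective.mem_set_image]
    rw [h3, (measurePreserving_smul (P.e s) μ).measure_preimage]
    exact ((hM.lineEquiv.measurableSet_image).2 hE).nullMeasurableSet
  have h3 := Measure.isAddLeftInvariant_eq_smul μ' volume
  have h4 : μ' (Set.Ico 0 1) = 1 := by
    rw [h0]
    exact hμ
  have h5 : μ' = volume := by
    rw [h3] at h4 ⊢
    simp only [Measure.smul_apply, Real.volume_Ico, sub_zero, ENNReal.ofReal_one] at h4
    have h6 : μ'.addHaarScalarFactor volume = 1 := by
      simpa [ENNReal.smul_def] using h4
    rw [h6, one_smul]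
  rw [← h5, hμ', Measure.map_map hM.lineEquiv.measurable hM.lineEquiv.symm.measurable]
  simp

theorem IsFiber.lintegral_eq (hM : P.IsFiber M) {f : G → ℝ≥0∞} (hf : RightInvariant M f) :
    ∫⁻ x, descend M f x ∂((volume : Measure ℝ).map hM.lineEquiv) = ∫⁻ t, f (P.e t) := by
  rw [lintegral_map_equiv]
  refine lintegral_congr fun t => ?_
  rw [lineEquiv_apply, descend_mk hf]

theorem IsFiber.integral_eq (hM : P.IsFiber M) {E : Type*} [NormedAddCommGroup E]
    [NormedSpace ℝ E] {f : G → E} (hf : RightInvariant M f) :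
    ∫ x, descend M f x ∂((volume : Measure ℝ).map hM.lineEquiv) = ∫ t, f (P.e t) := by
  rw [integral_map_equiv]
  refine integral_congr_ae (Eventually.of_forall fun t => ?_)
  simp only [lineEquiv_apply, descend_mk hf]

end SemidirectCoords

end Nilmanifold
end

/-! ### Fourier analysis of periodic functions on the unit cube. -/

noncomputable section

namespace Nilmanifold

section Fourier

local instance instMeasureSpaceUnitAddCircle : MeasureSpace UnitAddCircle :=
  ⟨AddCircle.haarAddCircle⟩

local instance instIsAddHaarMeasureUnitAddCircle :
    Measure.IsAddHaarMeasure (volume : Measure UnitAddCircle) :=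
  inferInstanceAs (Measure.IsAddHaarMeasure AddCircle.haarAddCircle)

local instance instIsProbabilityMeasureUnitAddCircle :
    IsProbabilityMeasure (volume : Measure UnitAddCircle) :=
  inferInstanceAs (IsProbabilityMeasure AddCircle.haarAddCircle)

variable {d : ℕ}

/-- The character `v ↦ exp (2 π i ⟨z, v⟩)`. -/
def intChar (z : Fin d → ℤ) (v : Fin d → ℝ) : Circle :=
  Circle.exp (2 * Real.pi * ∑ i, (z i : ℝ) * v i)

theorem continuous_intChar (z : Fin d → ℤ) : Continuous (intChar z) := by
  unfold intChar
  fun_prop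

theorem intChar_add (z : Fin d → ℤ) (v w : Fin d → ℝ) :
    intChar z (v + w) = intChar z v * intChar z w := by
  rw [intChar, intChar, intChar, ← Circle.exp_add, ← mul_add, ← Finset.sum_add_distrib]
  simp [mul_add]

theorem circleExp_two_pi_mul_int (k : ℤ) : Circle.exp (2 * Real.pi * k) = 1 := by
  rw [Circle.exp_eq_one]
  exact ⟨k, by ring⟩

theorem intChar_intVec (z y : Fin d → ℤ) : intChar z (intVec y) = 1 := by
  rw [intChar]
  have : ∑ i, (z i : ℝ) * intVec y i = ((∑ i, z i * y i : ℤ) : ℝ) := by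
    push_cast
    rfl
  rw [this, circleExp_two_pi_mul_int]

theorem intChar_add_intVec (z : Fin d → ℤ) (v : Fin d → ℝ) (y : Fin d → ℤ) :
    intChar z (v + intVec y) = intChar z v := by
  rw [intChar_add, intChar_intVec, mul_one]

theorem mFourier_coe (z : Fin d → ℤ) (v : Fin d → ℝ) :
    UnitAddTorus.mFourier z (fun i => (v i : UnitAddCircle)) = intChar z v := by
  simp only [UnitAddTorus.mFourier, ContinuousMap.coe_mk, fourier_coe_apply, intChar,
    Circle.coe_exp]
  rw [← Complex.exp_sum]
  congr 1
  push_cast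
  rw [Finset.mul_sum, Finset.sum_mul]
  refine Finset.sum_congr rfl fun i _ => ?_
  ring

theorem isOpenQuotientMap_torus :
    IsOpenQuotientMap fun (v : Fin d → ℝ) (i : Fin d) => (v i : UnitAddCircle) :=
  IsOpenQuotientMap.piMap fun _ => QuotientAddGroup.isOpenQuotientMap_mk

theorem torus_eq_iff (v w : Fin d → ℝ) :
    (fun i => (v i : UnitAddCircle)) = (fun i => (w i : UnitAddCircle)) ↔
      ∃ z : Fin d → ℤ, w = v + intVec z := by
  constructor
  · intro h
    have : ∀ i, ∃ k : ℤ, w i = v i + k := fun i => by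
      obtain ⟨k, hk⟩ := (QuotientAddGroup.eq (s := AddSubgroup.zmultiples (1 : ℝ))).1 (congrFun h i)
      refine ⟨k, ?_⟩
      simp only [zsmul_eq_mul, mul_one] at hk
      linarith
    choose z hz using this
    exact ⟨z, funext hz⟩
  · rintro ⟨z, rfl⟩
    funext i
    simp [intVec]

/-- A continuous periodic function comes from the torus. -/
theorem exists_torus_lift {h : (Fin d → ℝ) → ℂ} (hc : Continuous h)
    (hp : ∀ v z, h (v + intVec z) = h v) :
    ∃ H : C(UnitAddTorus (Fin d), ℂ), ∀ v : Fin d → ℝ, H (fun i => (v i : UnitAddCircle)) = h v := by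
  have hq := isOpenQuotientMap_torus (d := d)
  choose s hs using hq.surjective
  have h1 : ∀ v : Fin d → ℝ, h (s fun i => (v i : UnitAddCircle)) = h v := fun v => by
    obtain ⟨z, hz⟩ := (torus_eq_iff _ _).1 (hs fun i => (v i : UnitAddCircle))
    conv_rhs => rw [hz, hp]
  refine ⟨⟨fun x => h (s x), ?_⟩, h1⟩
  rw [hq.isQuotientMap.continuous_iff]
  convert hc using 1
  exact funext h1

theorem unitCube_eq : unitCube d = {x : Fin d → ℝ | ∀ i, x i ∈ Set.Ioc ((0 : Fin d → ℝ) i)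
    ((0 : Fin d → ℝ) i + 1)} := by
  ext v
  simp [unitCube]

/-- The Fourier coefficient `∫ h(v) exp (2 π i ⟨z, v⟩) dv` of a periodic function. -/
def cubeCoeff (h : (Fin d → ℝ) → ℂ) (z : Fin d → ℤ) : ℂ :=
  ∫ v in unitCube d, h v * (intChar z v : ℂ)

theorem tsum_enorm_sq_cubeCoeff {h : (Fin d → ℝ) → ℂ} (hc : Continuous h)
    (hp : ∀ v z, h (v + intVec z) = h v) :
    ∑' z, ‖cubeCoeff h z‖ₑ ^ 2 = ∫⁻ v in unitCube d, ‖h v‖ₑ ^ 2 := by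
  obtain ⟨H, hH⟩ := exists_torus_lift hc hp
  have h1 := UnitAddTorus.hasSum_sq_mFourierCoeff (H.toLp 2 volume ℂ)
  simp only [UnitAddTorus.mFourierCoeff_toLp] at h1
  have h2 : ∫ t, ‖(H.toLp 2 volume ℂ : UnitAddTorus (Fin d) → ℂ) t‖ ^ 2 = ∫ t, ‖H t‖ ^ 2 := by
    refine integral_congr_ae ?_
    filter_upwards [ContinuousMap.coeFn_toLp (p := 2) (𝕜 := ℂ) volume H] with t ht
    rw [ht]
  have h3 : ENNReal.ofReal (∫ t, ‖H t‖ ^ 2) = ∫⁻ t, ‖H t‖ₑ ^ 2 := by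
    rw [ofReal_integral_eq_lintegral_ofReal]
    · refine lintegral_congr fun t => ?_
      rw [ENNReal.ofReal_pow (norm_nonneg _), ofReal_norm]
    · exact (by fun_prop : Continuous fun t => ‖H t‖ ^ 2).integrable_of_hasCompactSupport
        (HasCompactSupport.of_compactSpace _)
    · exact Eventually.of_forall fun t => by positivity
  -- `cubeCoeff` integrates against the character itself and the torus coefficient against its
  -- conjugate, whence the sign of `z`.
  have h4 : ∀ z, ‖cubeCoeff h z‖ₑ ^ 2 =
      ENNReal.ofReal (‖UnitAddTorus.mFourierCoeff H (-z)‖ ^ 2) := by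
    intro z
    rw [ENNReal.ofReal_pow (norm_nonneg _), ofReal_norm,
      UnitAddTorus.mFourierCoeff_eq_integral _ _ 0, ← unitCube_eq, cubeCoeff]
    congr 2
    refine integral_congr_ae (Eventually.of_forall fun v => ?_)
    simp only [neg_neg, mFourier_coe, hH, smul_eq_mul, mul_comm]
  have h5 := (Equiv.neg (Fin d → ℤ)).tsum_eq fun z => ‖UnitAddTorus.mFourierCoeff H z‖ ^ 2
  simp only [Equiv.neg_apply] at h5
  rw [tsum_congr h4, ← ENNReal.ofReal_tsum_of_nonneg (fun _ => by positivity), h5, h1.tsum_eq, h2, h3,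
    UnitAddTorus.lintegral_preimage _ 0, ← unitCube_eq]
  · simp only [hH]
  · exact ((Equiv.neg _).summable_iff (f := fun z => ‖UnitAddTorus.mFourierCoeff H z‖ ^ 2)).2
      h1.summable

/-- Integrals of periodic functions over the unit cube are invariant under automorphisms of the
lattice. -/
theorem integral_unitCube_comp {h : (Fin d → ℝ) → ℂ} (hc : Continuous h)
    (hp : ∀ v z, h (v + intVec z) = h v) {B : (Fin d → ℝ) →ₗ[ℝ] (Fin d → ℝ)}
    (hB : Function.Surjective B) (hBz : ∀ z, ∃ y, B (intVec z) = intVec y) :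
    ∫ v in unitCube d, h (B v) = ∫ v in unitCube d, h v := by
  obtain ⟨H, hH⟩ := exists_torus_lift hc hp
  choose c hc' using fun j : Fin d => hBz (Pi.single j 1)
  have hBv : ∀ v i, B v i = ∑ j, (c j i : ℝ) * v j := by
    intro v i
    conv_lhs => rw [pi_eq_sum_univ' v, map_sum]
    rw [Finset.sum_apply]
    refine Finset.sum_congr rfl fun j _ => ?_
    have h1 : Pi.single j (1 : ℝ) = intVec (Pi.single j 1) := by
      funext k
      by_cases hk : k = j <;> simp [intVec, hk]
    rw [map_smul, h1, hc']
    simp [intVec, mul_comm]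
  let φ : UnitAddTorus (Fin d) →+ UnitAddTorus (Fin d) :=
    { toFun := fun x i => ∑ j, c j i • x j
      map_zero' := by
        funext i
        simp
      map_add' := fun x y => by
        funext i
        simp [Finset.sum_add_distrib] }
  have hφ : ∀ v : Fin d → ℝ, φ (fun i => (v i : UnitAddCircle)) =
      fun i => (B v i : UnitAddCircle) := by
    intro v
    funext i
    change ∑ j, c j i • (v j : UnitAddCircle) = _
    rw [hBv]
    change _ = QuotientAddGroup.mk' (AddSubgroup.zmultiples (1 : ℝ)) _
    rw [map_sum]
    refine Finset.sum_congr rfl fun j _ => ?_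
    rw [← zsmul_eq_mul]
    rfl
  have hφc : Continuous φ := by
    change Continuous fun (x : UnitAddTorus (Fin d)) i => ∑ j, c j i • x j
    fun_prop
  have hφs : Function.Surjective φ := by
    intro x
    obtain ⟨v, rfl⟩ := isOpenQuotientMap_torus.surjective x
    obtain ⟨w, rfl⟩ := hB v
    exact ⟨_, hφ w⟩
  -- A surjective continuous endomorphism of a compact group preserves its Haar probability measure.
  -- Only surjectivity of `φ` is needed, not invertibility over the integers.
  have hm : MeasurePreserving φ volume volume := AddMonoidHom.measurePreserving hφc hφs rfl
  have h2 : ∫ x, H (φ x) = ∫ x, H x := by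
    conv_rhs => rw [← hm.map_eq]
    rw [integral_map hm.measurable.aemeasurable H.continuous.aestronglyMeasurable]
  rw [UnitAddTorus.integral_preimage _ 0, UnitAddTorus.integral_preimage _ 0, ← unitCube_eq] at h2
  simpa only [hφ, hH] using h2

theorem integral_unitCube_add {h : (Fin d → ℝ) → ℂ} (hc : Continuous h)
    (hp : ∀ v z, h (v + intVec z) = h v) (w : Fin d → ℝ) :
    ∫ v in unitCube d, h (w + v) = ∫ v in unitCube d, h v := by
  obtain ⟨H, hH⟩ := exists_torus_lift hc hp
  have h2 := integral_add_left_eq_self (μ := volume) (fun x => H x)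
    (fun i => (w i : UnitAddCircle) : UnitAddTorus (Fin d))
  rw [UnitAddTorus.integral_preimage _ 0, UnitAddTorus.integral_preimage _ 0, ← unitCube_eq] at h2
  simp only [hH] at h2
  rw [← h2]
  refine integral_congr_ae (Eventually.of_forall fun v => ?_)
  simp only [← hH]
  rfl

/-- Parseval's identity on the circle. -/
theorem tsum_enorm_sq_circleCoeff {h : ℝ → ℂ} (hc : Continuous h) (hp : ∀ t (k : ℤ), h (t + k) = h t) :
    ∑' j : ℤ, ‖∫ t in Set.Ioc (0 : ℝ) 1, h t * (Circle.exp (2 * Real.pi * (j * t)) : ℂ)‖ₑ ^ 2 =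
      ∫⁻ t in Set.Ioc (0 : ℝ) 1, ‖h t‖ₑ ^ 2 := by
  have h1 := tsum_enorm_sq_cubeCoeff (d := 1) (h := fun v => h (v 0)) (by fun_prop)
    fun v z => hp _ _
  have hm : MeasurePreserving (fun v : Fin 1 → ℝ => v 0) := volume_preserving_funUnique (Fin 1) ℝ
  have he : MeasurableEmbedding (fun v : Fin 1 → ℝ => v 0) :=
    (MeasurableEquiv.funUnique (Fin 1) ℝ).measurableEmbedding
  have hs : unitCube 1 = (fun v : Fin 1 → ℝ => v 0) ⁻¹' Set.Ioc 0 1 := by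
    ext v
    simp [unitCube]
  rw [hs, hm.setLIntegral_comp_preimage_emb he (fun t => ‖h t‖ₑ ^ 2),
    ← (Equiv.funUnique (Fin 1) ℤ).symm.tsum_eq] at h1
  rw [← h1]
  refine tsum_congr fun j => ?_
  rw [cubeCoeff, hs, ← hm.setIntegral_preimage_emb he]
  simp [intChar]

end Fourier

end Nilmanifold
end

/-! ### Fourier coefficients along the fibers, and their behavior under integer translations. -/

noncomputable section

namespace Nilmanifold

section Coeff

variable {d : ℕ} {G : Type*} [Group G] [TopologicalSpace G]

/-- The linear functional with the given integral coordinates. -/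
def intDual (z : Fin d → ℤ) : (Fin d → ℝ) →ₗ[ℝ] ℝ := Fintype.linearCombination ℝ fun i => (z i : ℝ)

theorem intDual_apply (z : Fin d → ℤ) (v : Fin d → ℝ) : intDual z v = ∑ i, (z i : ℝ) * v i := by
  simp [intDual, Fintype.linearCombination_apply, mul_comm]

theorem intChar_eq (z : Fin d → ℤ) (v : Fin d → ℝ) :
    intChar z v = Circle.exp (2 * Real.pi * intDual z v) := by
  rw [intDual_apply, intChar]

theorem intDual_injective : Function.Injective (intDual : (Fin d → ℤ) → _) := by
  intro y z h
  funext i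
  have := LinearMap.congr_fun h (Pi.single i 1)
  simpa [intDual_apply, Pi.single_apply] using this

namespace SemidirectCoords

variable (P : SemidirectCoords d G)

/-- The partial Fourier coefficients of a function on the group along the fiber. -/
def coeff (f : G → ℂ) (z : Fin d → ℤ) (g : G) : ℂ := cubeCoeff (fun v => f (g * P.m v)) z

variable {P} {Γ : Subgroup G} {f : G → ℂ}

theorem periodic_of_rightInvariant (h : P.IsIntegral Γ) (hf : RightInvariant Γ f) (g : G)
    (v : Fin d → ℝ) (z : Fin d → ℤ) : f (g * P.m (v + intVec z)) = f (g * P.m v) := by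
  rw [P.m_add, ← mul_assoc]
  exact hf _ _ (h.m_mem z)

variable [IsTopologicalGroup G]

theorem continuous_comp_mul_m (hc : Continuous f) (g : G) : Continuous fun v => f (g * P.m v) :=
  hc.comp (continuous_const.mul P.continuous_m)

theorem continuous_mul_intChar {h : (Fin d → ℝ) → ℂ} (hc : Continuous h) (z : Fin d → ℤ) :
    Continuous fun v => h v * (intChar z v : ℂ) :=
  hc.mul (continuous_subtype_val.comp (continuous_intChar z))

/-- Translation of the integration variable by `w` costs the factor `χ_z(-w)`. This is the
covariance relation of the induced representation. -/
theorem coeff_mul_m (h : P.IsIntegral Γ) (hf : RightInvariant Γ f) (hc : Continuous f)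
    (z : Fin d → ℤ) (g : G) (w : Fin d → ℝ) :
    P.coeff f z (g * P.m w) = (intChar z (-w) : ℂ) * P.coeff f z g := by
  have h1 := integral_unitCube_add
    (continuous_mul_intChar (continuous_comp_mul_m (P := P) hc g) z)
    (fun v y => by rw [periodic_of_rightInvariant h hf, intChar_add_intVec]) w
  rw [coeff, coeff, cubeCoeff, cubeCoeff, ← h1, ← integral_const_mul]
  refine integral_congr_ae (Eventually.of_forall fun v => ?_)
  have h2 : intChar z v = intChar z (-w) * intChar z (w + v) := by
    rw [← intChar_add, neg_add_cancel_left]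
  simp only [P.m_add, mul_assoc]
  rw [h2, Circle.coe_mul]
  ring

/-- Write `e k * m v = m (A_k v) * e k` and absorb `e k` into `Γ`. The automorphism `A_k` of the
lattice is then a measure-preserving change of variable, and it carries `χ_y` to `χ_z`. -/
theorem coeff_mul_e (h : P.IsIntegral Γ) (hf : RightInvariant Γ f) (hc : Continuous f)
    {z y : Fin d → ℤ} {k : ℤ} (hzy : ∀ v, intDual y (P.A.map k v) = intDual z v) (g : G) :
    P.coeff f z (g * P.e k) = P.coeff f y g := by
  have h1 := integral_unitCube_comp
    (continuous_mul_intChar (continuous_comp_mul_m (P := P) hc g) y)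
    (fun v y => by rw [periodic_of_rightInvariant h hf, intChar_add_intVec])
    (B := P.A.map k) (fun v => ⟨_, P.A.map_map_neg k v⟩) (h.map_intVec k)
  rw [coeff, coeff, cubeCoeff, cubeCoeff, ← h1]
  refine integral_congr_ae (Eventually.of_forall fun v => ?_)
  simp only
  rw [intChar_eq y, hzy, ← intChar_eq, mul_assoc, P.conj, ← mul_assoc, hf _ _ (h.e_mem k)]

/-- Replacing the half-open cube by the closed one changes only a null set and gives a compact
domain for the parametric integral. -/
theorem continuous_coeff (P : SemidirectCoords d G) (hc : Continuous f) (z : Fin d → ℤ) :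
    Continuous (P.coeff f z) := by
  have := P.secondCountableTopology
  have := P.locallyCompactSpace
  have h1 : ∀ g, P.coeff f z g =
      ∫ v in Set.Icc (0 : Fin d → ℝ) 1, f (g * P.m v) * (intChar z v : ℂ) := by
    intro g
    rw [coeff, cubeCoeff, unitCube_eq_pi]
    exact setIntegral_congr_set Measure.univ_pi_Ioc_ae_eq_Icc
  rw [funext h1]
  refine continuous_parametric_integral_of_continuous ?_ isCompact_Icc
  have h2 : Continuous fun p : G × (Fin d → ℝ) => f (p.1 * P.m p.2) :=
    hc.comp (continuous_fst.mul (P.continuous_m.comp continuous_snd))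
  exact h2.mul (continuous_subtype_val.comp ((continuous_intChar z).comp continuous_snd))

theorem measurable_enorm_coeff_e (P : SemidirectCoords d G) (hc : Continuous f) (z : Fin d → ℤ) :
    Measurable fun t => ‖P.coeff f z (P.e t)‖ₑ ^ 2 := by
  have := (P.continuous_coeff hc z).comp P.continuous_e
  exact this.enorm.measurable.pow_const 2

/-- Parseval's identity along the fibers. -/
theorem lintegral_eq_tsum_coeff [MeasurableSpace G] [BorelSpace G] [T2Space G]
    (h : P.IsIntegral Γ) [DiscreteTopology Γ] (ν : Measure (G ⧸ Γ)) [IsProbabilityMeasure ν]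
    [SMulInvariantMeasure G (G ⧸ Γ) ν] (hf : RightInvariant Γ f) (hc : Continuous f) :
    ∫⁻ x, ‖descend Γ f x‖ₑ ^ 2 ∂ν =
      ∑' z, ∫⁻ t in Set.Ioc (0 : ℝ) 1, ‖P.coeff f z (P.e t)‖ₑ ^ 2 := by
  have hmk : Measurable (QuotientGroup.mk : G → G ⧸ Γ) := measurable_from_quotient.1 measurable_id
  have hm : Measurable fun p => ((P.homeo p : G) : G ⧸ Γ) := hmk.comp P.homeo.measurable
  rw [h.measure_eq ν, lintegral_map ((continuous_descend hf hc).enorm.measurable.pow_const 2) hm, ← lintegral_tsum fun z =>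
      (P.measurable_enorm_coeff_e hc z).aemeasurable, Measure.volume_eq_prod,
    ← Measure.prod_restrict, lintegral_prod]
  · refine lintegral_congr fun t => ?_
    rw [show (∑' z, ‖P.coeff f z (P.e t)‖ₑ ^ 2) = _ from
      tsum_enorm_sq_cubeCoeff (continuous_comp_mul_m hc (P.e t))
        (periodic_of_rightInvariant h hf (P.e t))]
    refine lintegral_congr fun v => ?_
    rw [descend_mk hf]
    rfl
  · refine Measurable.aemeasurable ?_
    exact ((continuous_descend hf hc).enorm.measurable.pow_const 2).comp
      hm

theorem lintegral_eq_tsum_Ioc (g : ℝ → ℝ≥0∞) :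
    ∫⁻ t, g t = ∑' k : ℤ, ∫⁻ t in Set.Ioc (0 : ℝ) 1, g (t + k) := by
  have h1 : ∫⁻ t, g t = ∑' k : ℤ, ∫⁻ t in Set.Ioc (k : ℝ) (k + 1), g t := by
    rw [← lintegral_iUnion (fun _ => measurableSet_Ioc) (Set.pairwise_disjoint_Ioc_intCast ℝ),
      iUnion_Ioc_intCast, Measure.restrict_univ]
  rw [h1]
  refine tsum_congr fun k => ?_
  have hm : MeasurePreserving (fun t : ℝ => t + k) := measurePreserving_add_right volume (k : ℝ)
  rw [← hm.setLIntegral_comp_preimage_emb (measurableEmbedding_addRight _)]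
  congr 2
  ext t
  simp

/-- The sum of the fiberwise Fourier coefficients over free orbits of `ℤ`. -/
theorem tsum_coeff_orbits (h : P.IsIntegral Γ) (hf : RightInvariant Γ f) (hc : Continuous f)
    {ι : Type*} {Z : Set (Fin d → ℤ)} (σ : ι × ℤ ≃ Z) (z : ι → Fin d → ℤ)
    (hσ : ∀ i k v, intDual (σ (i, k)).1 (P.A.map k v) = intDual (z i) v) :
    ∑' y : Z, ∫⁻ t in Set.Ioc (0 : ℝ) 1, ‖P.coeff f y (P.e t)‖ₑ ^ 2 =
      ∑' i, ∫⁻ t, ‖P.coeff f (z i) (P.e t)‖ₑ ^ 2 := by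
  rw [← σ.tsum_eq]
  refine (ENNReal.tsum_prod (f := fun i k =>
    ∫⁻ t in Set.Ioc (0 : ℝ) 1, ‖P.coeff f (σ (i, k)) (P.e t)‖ₑ ^ 2)).trans ?_
  refine tsum_congr fun i => ?_
  -- The line is cut into unit intervals; on the `k`-th one the coefficient of `z i` equals that of
  -- the `k`-th point of its orbit on `(0, 1]`.
  rw [lintegral_eq_tsum_Ioc]
  refine tsum_congr fun k => lintegral_congr fun t => ?_
  rw [P.e_add, coeff_mul_e h hf hc (hσ i k)]

/-- Parseval's identity in the direction transversal to the fibers. -/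
theorem tsum_coeff_fixed (h : P.IsIntegral Γ) (hf : RightInvariant Γ f) (hc : Continuous f)
    {z : Fin d → ℤ} (hz : ∀ t v, intDual z (P.A.map t v) = intDual z v) :
    ∫⁻ t in Set.Ioc (0 : ℝ) 1, ‖P.coeff f z (P.e t)‖ₑ ^ 2 =
      ∑' j : ℤ, ‖∫ t in Set.Ioc (0 : ℝ) 1,
        P.coeff f z (P.e t) * (Circle.exp (2 * Real.pi * (j * t)) : ℂ)‖ₑ ^ 2 := by
  refine (tsum_enorm_sq_circleCoeff (h := fun t => P.coeff f z (P.e t))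
    ((P.continuous_coeff hc z).comp P.continuous_e) fun t k => ?_).symm
  rw [P.e_add, coeff_mul_e h hf hc (hz k)]

end SemidirectCoords

end Coeff

end Nilmanifold
end

/-! ### The induced representation space as `L²` of the line. -/

noncomputable section

namespace Nilmanifold

section LTwo

theorem enorm_sq_eq_lintegral {α : Type*} [MeasurableSpace α] {μ : Measure α} (f : Lp ℂ 2 μ) :
    ‖f‖ₑ ^ 2 = ∫⁻ x, ‖f x‖ₑ ^ 2 ∂μ := by
  rw [Lp.enorm_def, eLpNorm_eq_lintegral_rpow_enorm_toReal (by norm_num) (by norm_num)]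
  simp only [ENNReal.toReal_ofNat, ENNReal.rpow_ofNat]
  rw [← ENNReal.rpow_natCast, ← ENNReal.rpow_mul]
  norm_num

theorem enorm_toLp_sq {α : Type*} [MeasurableSpace α] {μ : Measure α} {f : α → ℂ}
    (hf : MemLp f 2 μ) : ‖hf.toLp f‖ₑ ^ 2 = ∫⁻ x, ‖f x‖ₑ ^ 2 ∂μ := by
  rw [enorm_sq_eq_lintegral]
  refine lintegral_congr_ae ?_
  filter_upwards [hf.coeFn_toLp] with x hx
  rw [hx]

theorem memLp_two_of_lintegral_lt_top {α : Type*} [MeasurableSpace α] {μ : Measure α} {f : α → ℂ}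
    (hf : AEStronglyMeasurable f μ) (h : ∫⁻ x, ‖f x‖ₑ ^ 2 ∂μ < (⊤ : ℝ≥0∞)) : MemLp f 2 μ := by
  refine ⟨hf, ?_⟩
  rw [eLpNorm_eq_lintegral_rpow_enorm_toReal (by norm_num) (by norm_num)]
  simp only [ENNReal.toReal_ofNat, ENNReal.rpow_ofNat]
  exact ENNReal.rpow_lt_top_of_nonneg (by norm_num) h.ne

theorem tendsto_of_enorm_sub_sq {E : Type*} [NormedAddCommGroup E] {u : ℕ → E} {a : E} :
    Tendsto u atTop (𝓝 a) ↔ Tendsto (fun k => ‖a - u k‖ₑ ^ 2) atTop (𝓝 0) := by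
  rw [tendsto_iff_edist_tendsto_0]
  have h1 : ∀ k, edist (u k) a = ‖a - u k‖ₑ := fun k => by
    rw [edist_comm, edist_eq_enorm_sub]
  simp only [h1]
  constructor
  · intro h
    have := (ENNReal.continuous_pow 2).tendsto 0 |>.comp h
    simpa [Function.comp_def] using this
  · intro h
    have := (ENNReal.continuous_rpow_const (y := (1 / 2 : ℝ))).tendsto 0 |>.comp h
    refine (this.congr fun k => ?_).trans (by simp)
    simp only [Function.comp_apply]
    rw [← ENNReal.rpow_natCast, ← ENNReal.rpow_mul]
    norm_num

end LTwo

section InducedLine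

variable {d : ℕ} {G : Type*} [Group G] [TopologicalSpace G] [IsTopologicalGroup G]
  [T2Space G] [MeasurableSpace G] [BorelSpace G] {P : SemidirectCoords d G} {M : Subgroup G}
  (hM : P.IsFiber M) {χ : M → Circle} {z : Fin d → ℤ}
  {μ : Measure (G ⧸ M)} [IsFiniteMeasureOnCompacts μ] [SMulInvariantMeasure G (G ⧸ M) μ]

theorem Covariant.rightInvariant_enorm_sub {F F' : G → ℂ} (hF : Covariant M χ F)
    (hF' : Covariant M χ F') : RightInvariant M fun g => ‖F g - F' g‖ₑ ^ 2 := by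
  intro g h hh
  have h1 := hF g ⟨h, hh⟩
  have h2 := hF' g ⟨h, hh⟩
  simp only at h1 h2
  simp only [h1, h2, ← mul_sub, enorm_mul]
  have : ‖((χ (⟨h, hh⟩ : M)⁻¹ : Circle) : ℂ)‖ₑ = 1 := by
    rw [← ofReal_norm, Circle.norm_coe, ENNReal.ofReal_one]
  rw [this, one_mul]

theorem lintegral_descend_eq (hμ : μ = (volume : Measure ℝ).map hM.lineEquiv) {f : G → ℝ≥0∞}
    (hf : RightInvariant M f) : ∫⁻ x, descend M f x ∂μ = ∫⁻ t, f (P.e t) := by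
  rw [hμ]
  exact hM.lintegral_eq hf

theorem integrable_comp_e (hμ : μ = (volume : Measure ℝ).map hM.lineEquiv) {f : G → ℂ}
    (hf : RightInvariant M f) (hi : Integrable (descend M f) μ) :
    Integrable fun t => f (P.e t) := by
  rw [hμ, integrable_map_equiv] at hi
  refine hi.congr (Eventually.of_forall fun t => ?_)
  simp only [Function.comp_apply, hM.lineEquiv_apply, descend_mk hf]

theorem memLp_comp_e (hμ : μ = (volume : Measure ℝ).map hM.lineEquiv) (φ : IndPre M χ μ) :
    MemLp (fun t => φ.fn (P.e t)) 2 volume := by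
  have hc : Continuous fun t => φ.fn (P.e t) := φ.2.1.comp P.continuous_e
  rw [memLp_two_iff_integrable_sq_norm hc.aestronglyMeasurable]
  have h1 := integrable_comp_e hM hμ (φ.covariant.rightInvariant_inner φ.covariant)
    (φ.integrable_inner φ)
  refine h1.norm.congr (Eventually.of_forall fun t => ?_)
  simp only [norm_mul, RCLike.norm_conj, sq]

/-- Restriction of sections to the transversal line. -/
def restrictLine (hμ : μ = (volume : Measure ℝ).map hM.lineEquiv) :
    IndPre M χ μ →ₗᵢ[ℂ] Lp ℂ 2 (volume : Measure ℝ) where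
  toFun φ := (memLp_comp_e hM hμ φ).toLp _
  map_add' _ _ := rfl
  map_smul' _ _ := rfl
  norm_map' φ := by
    have hinv := φ.covariant.rightInvariant_inner φ.covariant
    change ‖(memLp_comp_e hM hμ φ).toLp _‖ = _
    rw [@norm_eq_sqrt_re_inner ℂ, L2.inner_def, IndPre.norm_def]
    congr 2
    have h1 : ∫ x, descend M (fun g => starRingEnd ℂ (φ.fn g) * φ.fn g) x ∂μ =
        ∫ t, starRingEnd ℂ (φ.fn (P.e t)) * φ.fn (P.e t) := by
      conv_lhs => rw [hμ]
      exact hM.integral_eq hinv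
    rw [h1]
    refine integral_congr_ae ?_
    filter_upwards [(memLp_comp_e hM hμ φ).coeFn_toLp] with t ht
    rw [ht, RCLike.inner_apply, mul_comm]

theorem fiberMk_inv (v : Fin d → ℝ) : (P.fiberMk hM v)⁻¹ = P.fiberMk hM (-v) :=
  Subtype.ext (P.m_neg v).symm

variable (hχ : ∀ v, χ (P.fiberMk hM v) = intChar z v)

include hχ in
theorem covariant_iff {F : G → ℂ} :
    Covariant M χ F ↔ ∀ g v, F (g * P.m v) = (intChar z (-v) : ℂ) * F g := by
  constructor
  · intro h g v
    have := h g (P.fiberMk hM v)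
    rwa [fiberMk_inv, hχ] at this
  · intro h g x
    obtain ⟨v, rfl⟩ := (P.fiberHomeo hM).surjective x
    rw [P.fiberHomeo_apply, fiberMk_inv, hχ]
    exact h g v

-- A function on the transversal extends uniquely by covariance, `F(e t * m v) = g(t) χ_z(-v)`. Its
-- support modulo `M` lies in the image of the support of `g`.
include hχ in
theorem exists_section {g : ℝ → ℂ} (hg : Continuous g) (hs : HasCompactSupport g) :
    ∃ φ : IndPre M χ μ, ∀ t, φ.fn (P.e t) = g t := by
  set F : G → ℂ := fun x => g (P.homeo.symm x).1 * (intChar z (-(P.homeo.symm x).2) : ℂ) with hF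
  have hFh : ∀ p, F (P.homeo p) = g p.1 * (intChar z (-p.2) : ℂ) := fun p => by simp [hF]
  have hcov : Covariant M χ F := by
    rw [covariant_iff hM hχ]
    intro x w
    obtain ⟨⟨t, v⟩, rfl⟩ := P.homeo.surjective x
    have : P.homeo (t, v) * P.m w = P.homeo (t, v + w) := by
      simp [P.homeo_apply, P.m_add, mul_assoc]
    rw [this, hFh, hFh, neg_add, intChar_add, Circle.coe_mul]
    ring
  have hcont : Continuous F :=
    (hg.comp (by fun_prop)).mul
      (continuous_subtype_val.comp ((continuous_intChar z).comp (by fun_prop)))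
  have hinv : RightInvariant M fun g => (P.homeo.symm g).1 := by
    intro g x hx
    obtain ⟨w, rfl⟩ := (hM _).1 hx
    obtain ⟨⟨t, v⟩, rfl⟩ := P.homeo.surjective g
    have : P.homeo (t, v) * P.m w = P.homeo (t, v + w) := by
      simp [P.homeo_apply, P.m_add, mul_assoc]
    simp [this]
  have hi : Continuous (descend M fun g => (P.homeo.symm g).1) :=
    continuous_descend hinv (by fun_prop)
  have hq : Continuous hM.lineEquiv := by
    have h1 : Continuous fun t => (P.e t : G ⧸ M) :=
      QuotientGroup.continuous_mk.comp P.continuous_e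
    exact h1
  refine ⟨⟨F, hcont, hcov, ?_⟩, fun t => ?_⟩
  · refine (hs.isCompact.image hq).of_isClosed_subset isClosed_closure (closure_minimal ?_ ?_)
    · rintro _ ⟨x, hx, rfl⟩
      obtain ⟨⟨t, v⟩, rfl⟩ := P.homeo.surjective x
      refine ⟨t, subset_tsupport _ fun h0 => hx ?_, ?_⟩
      · rw [hFh, h0, zero_mul]
      · exact (QuotientGroup.mk_mul_of_mem _ (hM.m_mem v)).symm
    · rw [MeasurableEquiv.image_eq_preimage_symm]
      exact (isClosed_tsupport g).preimage hi
  · change F (P.e t) = g t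
    have : P.e t = P.homeo (t, 0) := by simp [P.homeo_apply, P.m_zero]
    rw [this, hFh]
    simp [intChar]

include hχ in
theorem denseRange_restrictLine (hμ : μ = (volume : Measure ℝ).map hM.lineEquiv) :
    DenseRange (restrictLine (χ := χ) hM hμ) := by
  intro f
  rw [EMetric.mem_closure_iff]
  intro ε hε
  obtain ⟨δ, hδ, hδε⟩ := exists_between hε
  obtain ⟨g, hs, hle, hc, hgL⟩ := (Lp.memLp f).exists_hasCompactSupport_eLpNorm_sub_le
    (by norm_num) hδ.ne'
  obtain ⟨φ, hφ⟩ := exists_section (μ := μ) hM hχ hc hs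
  refine ⟨_, ⟨φ, rfl⟩, lt_of_le_of_lt ?_ hδε⟩
  have : restrictLine hM hμ φ = hgL.toLp g := by
    change (memLp_comp_e hM hμ φ).toLp _ = _
    congr 1
    exact funext hφ
  rw [this, Lp.edist_def]
  refine (eLpNorm_congr_ae ?_).le.trans hle
  filter_upwards [hgL.coeFn_toLp] with t ht
  simp [ht]

/-- The induced representation space is `L²` of the transversal line. -/
def indEquiv (hμ : μ = (volume : Measure ℝ).map hM.lineEquiv) :
    IndSpace M χ μ ≃ₗᵢ[ℂ] Lp ℂ 2 (volume : Measure ℝ) :=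
  let T : IndSpace M χ μ →L[ℂ] Lp ℂ 2 (volume : Measure ℝ) :=
    (restrictLine (χ := χ) hM hμ).toContinuousLinearMap.extend
      (UniformSpace.Completion.toComplL (𝕜 := ℂ) (E := IndPre M χ μ))
  have hT : ∀ φ : IndPre M χ μ, T φ = restrictLine hM hμ φ := fun φ =>
    ContinuousLinearMap.extend_eq _ UniformSpace.Completion.denseRange_coe
      (UniformSpace.Completion.isUniformInducing_coe _) φ
  let Ψ : IndSpace M χ μ →ₗᵢ[ℂ] Lp ℂ 2 (volume : Measure ℝ) :=
    { T.toLinearMap with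
      norm_map' := fun v => by
        change ‖T v‖ = ‖v‖
        induction v using UniformSpace.Completion.induction_on with
        | hp => exact isClosed_eq (by fun_prop) (by fun_prop)
        | ih φ => rw [hT, LinearIsometry.norm_map, UniformSpace.Completion.norm_coe] }
  LinearIsometryEquiv.ofSurjective Ψ (by
    have h1 : IsClosed (Set.range Ψ) := Ψ.isometry.isClosedEmbedding.isClosed_range
    have h2 : Dense (Set.range Ψ) := by
      refine (denseRange_restrictLine hM hχ hμ).mono ?_
      rintro _ ⟨φ, rfl⟩
      exact ⟨φ, hT φ⟩
    rw [← Set.range_eq_univ, ← h1.closure_eq, h2.closure_eq])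

theorem indEquiv_coe (hμ : μ = (volume : Measure ℝ).map hM.lineEquiv) (φ : IndPre M χ μ) :
    indEquiv hM hχ hμ φ = restrictLine hM hμ φ :=
  ContinuousLinearMap.extend_eq _ UniformSpace.Completion.denseRange_coe
    (UniformSpace.Completion.isUniformInducing_coe _) φ

/-- Turns the approximation condition in `Represents` into convergence in `L²(ℝ)`. -/
theorem lintegral_descend_sub_eq (hμ : μ = (volume : Measure ℝ).map hM.lineEquiv) {F : G → ℂ}
    (hF : Covariant M χ F) (hL : MemLp (fun t => F (P.e t)) 2 volume) (φ : IndPre M χ μ) :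
    ∫⁻ x, descend M (fun g => ‖F g - φ.fn g‖ₑ ^ 2) x ∂μ =
      ‖hL.toLp _ - restrictLine hM hμ φ‖ₑ ^ 2 := by
  rw [lintegral_descend_eq hM hμ (hF.rightInvariant_enorm_sub φ.covariant)]
  exact (enorm_toLp_sq (hL.sub (memLp_comp_e hM hμ φ))).symm

/-- Any sequence of sections converging to the vector in the completion also converges, after
restriction to the line, to the class of `F` there. -/
theorem represents_symm_toLp (hμ : μ = (volume : Measure ℝ).map hM.lineEquiv) {F : G → ℂ}
    (hFm : Measurable F) (hF : Covariant M χ F) (hL : MemLp (fun t => F (P.e t)) 2 volume) :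
    Represents ((indEquiv hM hχ hμ).symm (hL.toLp _)) F := by
  refine ⟨hFm, hF, ?_⟩
  set v := (indEquiv hM hχ hμ).symm (hL.toLp _) with hv
  obtain ⟨u, hu, hlim⟩ := mem_closure_iff_seq_limit.1
    (UniformSpace.Completion.denseRange_coe (α := IndPre M χ μ) v)
  choose φ hφ using hu
  have hlim' : Tendsto (fun k => (φ k : IndSpace M χ μ)) atTop (𝓝 v) := by
    simpa only [hφ] using hlim
  refine ⟨φ, ?_, hlim'⟩
  simp only [lintegral_descend_sub_eq hM hμ hF hL]
  rw [← tendsto_of_enorm_sub_sq]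
  have h1 := ((indEquiv hM hχ hμ).continuous.tendsto v).comp hlim'
  rw [hv, LinearIsometryEquiv.apply_symm_apply] at h1
  refine h1.congr fun k => ?_
  exact indEquiv_coe hM hχ hμ (φ k)

-- A represented vector is determined by the class in `L²(ℝ)` of `t ↦ F(e t)`. Hence equality of
-- components can be tested on functions.
include hχ in
theorem Represents.unique (hμ : μ = (volume : Measure ℝ).map hM.lineEquiv) {F : G → ℂ}
    {v w : IndSpace M χ μ} (hv : Represents v F) (hw : Represents w F) : v = w := by
  obtain ⟨hFm, hF, φ, h1, h2⟩ := hv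
  have hL : MemLp (fun t => F (P.e t)) 2 volume := by
    -- A single approximant at finite distance suffices for square-integrability, since sections
    -- themselves are square-integrable on the line.
    obtain ⟨k, hk⟩ := (h1.eventually (gt_mem_nhds (zero_lt_one (α := ℝ≥0∞)))).exists
    have h3 : ∫⁻ t, ‖F (P.e t) - (φ k).fn (P.e t)‖ₑ ^ 2 < (⊤ : ℝ≥0∞) := by
      rw [← lintegral_descend_eq hM hμ (hF.rightInvariant_enorm_sub (φ k).covariant)]
      exact hk.trans ENNReal.one_lt_top
    have hm : AEStronglyMeasurable (fun t => F (P.e t)) volume :=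
      (hFm.comp P.continuous_e.measurable).aestronglyMeasurable
    have h4 := memLp_two_of_lintegral_lt_top
      (hm.sub (memLp_comp_e hM hμ (φ k)).aestronglyMeasurable) h3
    simpa using h4.add (memLp_comp_e hM hμ (φ k))
  have key : ∀ v' : IndSpace M χ μ, Represents v' F → indEquiv hM hχ hμ v' = hL.toLp _ := by
    rintro v' ⟨-, -, φ, h1, h2⟩
    simp only [lintegral_descend_sub_eq hM hμ hF hL] at h1
    rw [← tendsto_of_enorm_sub_sq] at h1
    refine tendsto_nhds_unique ?_ h1
    refine (((indEquiv hM hχ hμ).continuous.tendsto v').comp h2).congr fun k => ?_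
    exact indEquiv_coe hM hχ hμ (φ k)
  exact (indEquiv hM hχ hμ).injective
    ((key v ⟨hFm, hF, φ, h1, h2⟩).trans (key w hw).symm)

theorem Represents.translate {F : G → ℂ} {v : IndSpace M χ μ} (hv : Represents v F) (a : G) :
    Represents (indRep M χ μ a v) fun g => F (a⁻¹ * g) := by
  obtain ⟨hFm, hF, φ, h1, h2⟩ := hv
  have hF' : Covariant M χ fun g => F (a⁻¹ * g) := fun g h => by
    have := hF (a⁻¹ * g) h
    rwa [mul_assoc] at this
  refine ⟨hFm.comp (measurable_const_mul _), hF', fun k => indTranslate a (φ k), ?_, ?_⟩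
  · refine h1.congr fun k => ?_
    have hinv := hF.rightInvariant_enorm_sub (φ k).covariant
    have hm : Measurable (descend M fun g => ‖F g - (φ k).fn g‖ₑ ^ 2) := by
      refine measurable_from_quotient.2 ?_
      have : (descend M fun g => ‖F g - (φ k).fn g‖ₑ ^ 2) ∘ Quotient.mk'' =
          fun g => ‖F g - (φ k).fn g‖ₑ ^ 2 := funext fun g => descend_mk hinv g
      rw [this]
      exact (hFm.sub (φ k).2.1.measurable).enorm.pow_const 2
    rw [← (measurePreserving_smul a⁻¹ μ).lintegral_comp hm]
    refine lintegral_congr fun x => ?_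
    induction x using QuotientGroup.induction_on with
    | H g =>
      rw [descend_mk (hF'.rightInvariant_enorm_sub (indTranslate a (φ k)).covariant)]
      exact descend_mk hinv (a⁻¹ * g)
  · simp only [← indRep_coe]
    exact ((indRep M χ μ a).continuous.tendsto v).comp h2

end InducedLine

end Nilmanifold
end

/-! ### Orbits of integral functionals, and the cross-section. -/

noncomputable section

namespace Nilmanifold

section Orbits

/-- Shifting the index of the exponential series factors out `tD`. As `nilExpMean` is surjective,
functionals fixed by the flow at one time `t ≠ 0` must kill the image of `D`. -/
theorem nilExp_sub_self {V : Type*} [AddCommGroup V] [Module ℝ V] {D : V →ₗ[ℝ] V} {N : ℕ}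
    (hD : D ^ N = 0) (t : ℝ) (v : V) :
    nilExp D N t v - v = t • D (nilExpMean D N t v) := by
  have h1 : nilExp D N t v =
      ∑ k ∈ Finset.range (N + 1), (t ^ k / k.factorial) • (D ^ k) v := by
    rw [nilExp_apply, Finset.sum_range_succ, hD]
    simp
  rw [h1, Finset.sum_range_succ', nilExpMean_apply, map_sum, Finset.smul_sum]
  simp only [pow_zero, Nat.factorial_zero, Nat.cast_one, div_one, one_smul, Module.End.one_apply,
    add_sub_cancel_right]
  refine Finset.sum_congr rfl fun k _ => ?_
  rw [map_smul, smul_smul, pow_succ' D, Module.End.mul_apply]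
  congr 1
  ring

namespace LieSplitting

variable {n d : ℕ} {G : Type*} [TopologicalSpace G] [ChartedSpace (EuclideanSpace ℝ (Fin n)) G]
  [Group G] [LieGroup (𝓡 n) ∞ G] [T2Space G] [SimplyConnectedSpace G] (L : LieSplitting n d G)

/-- The action of `ℤ` on functionals is free away from the functionals killed by `D`. -/
theorem eq_zero_of_nilExp_fixed {f : (Fin d → ℝ) →ₗ[ℝ] ℝ} {t : ℝ} (ht : t ≠ 0)
    (hf : ∀ v, f (nilExp L.D L.N t v) = f v) (v : Fin d → ℝ) : f (L.D v) = 0 := by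
  obtain ⟨w, rfl⟩ := L.surjective_nilExpMean t v
  have h1 := congrArg f (nilExp_sub_self L.pow_D t w)
  rw [map_sub, hf, sub_self, map_smul, smul_eq_mul, eq_comm] at h1
  exact (mul_eq_zero.1 h1).resolve_left ht

variable {L} {Γ : Subgroup G}

/-- The flow at integer times maps `ℤᵈ` to itself, so composition with it keeps functionals
integral. -/
theorem exists_intDual_comp (h : L.coords.IsIntegral Γ) (z : Fin d → ℤ) (k : ℤ) :
    ∃ y, ∀ v, intDual y v = intDual z (nilExp L.D L.N k v) := by
  choose c hc using fun i : Fin d => h.map_intVec k (Pi.single i 1)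
  refine ⟨fun i => ∑ j, z j * c i j, fun v => ?_⟩
  have h1 : ∀ i : Fin d, Pi.single i (1 : ℝ) = intVec (Pi.single i 1) := fun i => by
    funext k
    by_cases hk : k = i <;> simp [intVec, hk]
  conv_rhs => rw [pi_eq_sum_univ' v, map_sum, map_sum]
  rw [intDual_apply]
  refine Finset.sum_congr rfl fun i _ => ?_
  have h2 : nilExp L.D L.N k (Pi.single i (1 : ℝ)) = intVec (c i) := by
    rw [h1]
    exact hc i
  rw [map_smul, map_smul, h2, intDual_apply, smul_eq_mul, mul_comm]
  push_cast
  rfl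

/-- The functionals in general position. -/
def generic (L : LieSplitting n d G) : Set (Fin d → ℤ) := {z | ∃ v, intDual z (L.D v) ≠ 0}

theorem notMem_generic_iff {z : Fin d → ℤ} : z ∉ L.generic ↔ ∀ v, intDual z (L.D v) = 0 := by
  change (¬ ∃ v, intDual z (L.D v) ≠ 0) ↔ _
  push Not
  rfl

theorem intDual_nilExp {z : Fin d → ℤ} (hz : z ∉ L.generic) (t : ℝ) (v : Fin d → ℝ) :
    intDual z (nilExp L.D L.N t v) = intDual z v :=
  L.apply_nilExp (notMem_generic_iff.1 hz) t v

/-- A nongeneric functional is fixed by the flow; were `y` nongeneric, it would therefore coincide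
with `z`. -/
theorem mem_generic_of_comp {y z : Fin d → ℤ} (hz : z ∈ L.generic) {t : ℝ}
    (hyz : ∀ v, intDual y v = intDual z (nilExp L.D L.N t v)) : y ∈ L.generic := by
  by_contra hy
  have h1 : ∀ v, intDual y v = intDual z v := fun v => by
    have := hyz (nilExp L.D L.N (-t) v)
    rwa [intDual_nilExp hy, ← L.nilExp_add, add_neg_cancel, L.nilExp_zero] at this
  exact hy (intDual_injective (LinearMap.ext h1) ▸ hz)

/-- A cross-section parametrizes the functionals in general position. -/
theorem exists_orbit_equiv (h : L.coords.IsIntegral Γ) {ι : Type*} (z : ι → Fin d → ℤ)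
    (hz : ∀ i, z i ∈ L.generic)
    (hex : ∀ y ∈ L.generic, ∃ i, ∃ k : ℤ, ∀ v, intDual y v = intDual (z i) (nilExp L.D L.N (-k) v))
    (huniq : ∀ y ∈ L.generic, ∀ i j, ∀ k l : ℤ,
      (∀ v, intDual y v = intDual (z i) (nilExp L.D L.N (-k) v)) →
      (∀ v, intDual y v = intDual (z j) (nilExp L.D L.N (-l) v)) → i = j) :
    ∃ σ : ι × ℤ ≃ L.generic, ∀ i (k : ℤ) v,
      intDual (σ (i, k)).1 (L.coords.A.map k v) = intDual (z i) v := by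
  choose y hy using fun p : ι × ℤ => exists_intDual_comp h (z p.1) (-p.2)
  simp only [Int.cast_neg] at hy
  have hyg : ∀ p, y p ∈ L.generic := fun p => mem_generic_of_comp (hz p.1) (hy p)
  have hinj : Function.Injective fun p => (⟨y p, hyg p⟩ : L.generic) := by
    rintro ⟨i, k⟩ ⟨j, l⟩ hp
    have h1 : y (i, k) = y (j, l) := congrArg Subtype.val hp
    have h2 := hy (i, k)
    have h3 := hy (j, l)
    rw [← h1] at h3
    obtain rfl := huniq _ (hyg _) i j k l h2 h3
    by_contra hne
    -- If two times gave the same point of the orbit, `z i` would be fixed by the flow at the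
    -- nonzero time `k - l`, hence would kill the image of `D` and not be generic.
    have hkl : ((k : ℝ) - l) ≠ 0 := by
      intro h0
      have : (k : ℝ) = l := by linarith
      exact hne (by rw [Int.cast_injective this])
    obtain ⟨v, hv⟩ := hz i
    refine hv (L.eq_zero_of_nilExp_fixed hkl (fun w => ?_) v)
    have h4 := (h2 (nilExp L.D L.N k w)).symm.trans (h3 (nilExp L.D L.N k w))
    simp only at h4
    rw [← L.nilExp_add, ← L.nilExp_add, neg_add_cancel, L.nilExp_zero] at h4
    rw [h4, sub_eq_neg_add]
  have hsurj : Function.Surjective fun p => (⟨y p, hyg p⟩ : L.generic) := by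
    rintro ⟨x, hx⟩
    obtain ⟨i, k, hik⟩ := hex x hx
    refine ⟨(i, k), Subtype.ext (intDual_injective (LinearMap.ext fun v => ?_))⟩
    rw [hik]
    exact hy (i, k) v
  refine ⟨Equiv.ofBijective _ ⟨hinj, hsurj⟩, fun i k v => ?_⟩
  refine (hy (i, k) _).trans ?_
  congr 1
  exact L.coords.A.map_neg_map k v

end LieSplitting

end Orbits

section Duals

variable {𝔤 : Type*} [LieRing 𝔤] [LieAlgebra ℝ 𝔤] {d : ℕ} (X : Module.Basis (Fin (d + 1)) ℝ 𝔤)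

/-- The functional with given coordinates. -/
def malcevDual (z : Fin d → ℤ) (j : ℤ) : Module.Dual ℝ 𝔤 :=
  intDual z ∘ₗ LinearMap.pi (fun i => X.coord (Fin.castSucc i)) + (j : ℝ) • X.coord (Fin.last d)

theorem malcevDual_flagMap (z : Fin d → ℤ) (j : ℤ) (v : Fin d → ℝ) :
    malcevDual X z j (flagMap X v) = intDual z v := by
  rw [malcevDual, LinearMap.add_apply, LinearMap.smul_apply, coord_last_flagMap, smul_zero,
    add_zero, LinearMap.comp_apply]
  congr 1
  funext i
  exact coord_castSucc_flagMap X v i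

theorem malcevDual_last (z : Fin d → ℤ) (j : ℤ) :
    malcevDual X z j (X (Fin.last d)) = j := by
  have : LinearMap.pi (fun i => X.coord (Fin.castSucc i)) (X (Fin.last d)) = 0 := by
    funext i
    simp
  rw [malcevDual, LinearMap.add_apply, LinearMap.comp_apply, this]
  simp

variable {X}

theorem dual_ext {l l' : Module.Dual ℝ 𝔤} (h1 : ∀ v, l (flagMap X v) = l' (flagMap X v))
    (h2 : l (X (Fin.last d)) = l' (X (Fin.last d))) : l = l' := by
  refine LinearMap.ext fun y => ?_
  rw [eq_smul_add_flagMap X y, map_add, map_add, map_smul, map_smul, h1, h2]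

/-- Coordinates on the functionals that vanish on the commutator. -/
theorem exists_nonGeneric_equiv {𝔪 : LieIdeal ℝ 𝔤} (hX𝔪 : flag X d = 𝔪.toSubmodule)
    (hab : IsLieAbelian 𝔪) {p : ℕ}
    (hXp : flag X p = (⁅(⊤ : LieIdeal ℝ 𝔤), (⊤ : LieIdeal ℝ 𝔤)⁆).toSubmodule)
    {Z : Set (Fin d → ℤ)} (hZ : ∀ z, z ∈ Z ↔ ∀ v, intDual z (flagAd X v) = 0) :
    ∃ σ : nonGenericSet X p ≃ Z × ℤ, ∀ l, (∀ v, l.1 (flagMap X v) = intDual (σ l).1.1 v) ∧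
      l.1 (X (Fin.last d)) = (σ l).2 := by
  have key := mem_nonGenericSet_iff hX𝔪 hab hXp
  have h1 : ∀ p : Z × ℤ, malcevDual X p.1.1 p.2 ∈ nonGenericSet X _ := fun q => by
    refine (key _).2 ⟨⟨q.1.1, fun v => ?_⟩, ⟨q.2, malcevDual_last X _ _⟩, fun v => ?_⟩
    · rw [malcevDual_flagMap, intDual_apply]
    · rw [malcevDual_flagMap]
      exact (hZ _).1 q.1.2 v
  have h2 : Function.Bijective fun q : Z × ℤ => (⟨_, h1 q⟩ : nonGenericSet X p) := by
    constructor
    · rintro ⟨⟨y, hy⟩, i⟩ ⟨⟨z, hz⟩, j⟩ hq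
      have h3 : malcevDual X y i = malcevDual X z j := congrArg Subtype.val hq
      have h4 : (i : ℝ) = j := by rw [← malcevDual_last X y i, h3, malcevDual_last]
      have h5 : intDual y = intDual z := LinearMap.ext fun v => by
        rw [← malcevDual_flagMap X y i, h3, malcevDual_flagMap]
      obtain rfl := intDual_injective h5
      obtain rfl := Int.cast_injective h4
      rfl
    · rintro ⟨l, hl⟩
      obtain ⟨⟨z, hz⟩, ⟨j, hj⟩, h0⟩ := (key l).1 hl
      refine ⟨(⟨z, (hZ z).2 fun v => ?_⟩, j), Subtype.ext (dual_ext (X := X) (fun v => ?_) ?_)⟩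
      · rw [intDual_apply, ← hz, h0]
      · rw [hz, malcevDual_flagMap, intDual_apply]
      · rw [hj, malcevDual_last]
  refine ⟨(Equiv.ofBijective _ h2).symm, fun l => ?_⟩
  obtain ⟨q, rfl⟩ := (Equiv.ofBijective _ h2).surjective l
  rw [Equiv.symm_apply_apply]
  exact ⟨malcevDual_flagMap X _ _, malcevDual_last X _ _⟩

end Duals

section CrossSection

variable {d : ℕ} {G : Type*} [TopologicalSpace G] [T2Space G]
  [ChartedSpace (EuclideanSpace ℝ (Fin (d + 1))) G] [Group G] [LieGroup (𝓡 (d + 1)) ∞ G]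
  [SimplyConnectedSpace G] {𝔪 : LieIdeal ℝ (GroupLieAlgebra (𝓡 (d + 1)) G)}
  {X : Module.Basis (Fin (d + 1)) ℝ (GroupLieAlgebra (𝓡 (d + 1)) G)}
  (hX𝔪 : flag X d = 𝔪.toSubmodule) (hab : IsLieAbelian 𝔪)
  (hn : LieRing.IsNilpotent (GroupLieAlgebra (𝓡 (d + 1)) G))
  {Γ : Subgroup G} {S : Set (Module.Dual ℝ (GroupLieAlgebra (𝓡 (d + 1)) G))}

/-- The integral coordinates of the functionals in a cross-section, and the orbits they span. -/
theorem exists_crossSection_equiv (hΓ : (malcevSplitting hX𝔪 hab hn).coords.IsIntegral Γ)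
    (hS : IsCrossSection X 𝔪 Γ S) :
    ∃ z : S → Fin d → ℤ, (∀ l v, l.1 (flagMap X v) = intDual (z l) v) ∧
      ∃ σ : S × ℤ ≃ (malcevSplitting hX𝔪 hab hn).generic, ∀ i (k : ℤ) v,
        intDual (σ (i, k)).1 ((malcevSplitting hX𝔪 hab hn).coords.A.map k v) =
          intDual (z i) v := by
  set L := malcevSplitting hX𝔪 hab hn with hL
  have key := mem_genericSet_iff hX𝔪 hab
  choose z hz using fun l : S => ((key l.1).1 (hS.1 l.2)).1
  have hz' : ∀ l v, l.1 (flagMap X v) = intDual (z l) v := fun l v => by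
    rw [hz, intDual_apply]
  have hzg : ∀ l, z l ∈ L.generic := fun l => by
    obtain ⟨v, hv⟩ := ((key l.1).1 (hS.1 l.2)).2.2
    exact ⟨v, by rwa [← hz']⟩
  have hgen : ∀ y ∈ L.generic, malcevDual X y 0 ∈ genericSet X := by
    rintro y ⟨v, hv⟩
    refine (key _).2 ⟨⟨y, fun v => ?_⟩, ?_, v, ?_⟩
    · rw [malcevDual_flagMap, intDual_apply]
    · rw [malcevDual_last, Int.cast_zero]
    · rw [malcevDual_flagMap]
      exact hv
  -- The fiber coordinate `w` of the group element drops out, so the `Γ`-orbit relation on `𝔪` is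
  -- the `ℤ`-orbit relation on coordinates.
  have horb : ∀ (y : Fin d → ℤ) (s : S) (k : ℤ) (w : Fin d → ℝ),
      (∀ Y ∈ 𝔪, malcevDual X y 0 Y = s.1 (lieAd (L.e k * L.m w)⁻¹ Y)) ↔
        ∀ v, intDual y v = intDual (z s) (nilExp L.D L.N (-k) v) := by
    intro y s k w
    have h1 : ∀ v, lieAd (L.e k * L.m w)⁻¹ (flagMap X v) = flagMap X (nilExp L.D L.N (-k) v) :=
      L.lieAd_inv k w
    constructor
    · intro h v
      have := h _ (flagMap_mem hX𝔪 v)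
      rwa [malcevDual_flagMap, h1, hz'] at this
    · intro h Y hY
      obtain ⟨v, rfl⟩ := exists_flagMap_eq hX𝔪 hY
      rw [malcevDual_flagMap, h1, hz', h]
  refine ⟨z, hz', LieSplitting.exists_orbit_equiv hΓ z hzg ?_ ?_⟩
  · intro y hy
    obtain ⟨s, ⟨hs, γ, hγ, h1⟩, -⟩ := hS.2 _ (hgen y hy)
    obtain ⟨k, w, rfl⟩ := (hΓ γ).1 hγ
    exact ⟨⟨s, hs⟩, k, (horb y ⟨s, hs⟩ k (intVec w)).1 h1⟩
  · intro y hy i j k l hi hj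
    have hm : ∀ k : ℤ, L.e k * L.m 0 ∈ Γ := fun k => by
      rw [L.m_zero, mul_one]
      exact hΓ.e_mem k
    exact Subtype.ext ((hS.2 _ (hgen y hy)).unique ⟨i.2, _, hm k, (horb y i k 0).2 hi⟩
      ⟨j.2, _, hm l, (horb y j l 0).2 hj⟩)

end CrossSection

end Nilmanifold
end

/-! ### The components of `U` as Fourier coefficients. -/

noncomputable section

namespace Nilmanifold

section Components

theorem rightInvariant_mk {G : Type*} [Group G] [TopologicalSpace G] {Γ : Subgroup G}
    (ξ : C(G ⧸ Γ, ℂ)) : RightInvariant Γ fun g : G => ξ (g : G ⧸ Γ) := fun g h hh => by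
  simp only [QuotientGroup.mk_mul_of_mem g hh]

theorem continuous_mk {G : Type*} [Group G] [TopologicalSpace G] [IsTopologicalGroup G]
    {Γ : Subgroup G} (ξ : C(G ⧸ Γ, ℂ)) : Continuous fun g : G => ξ (g : G ⧸ Γ) :=
  ξ.continuous.comp QuotientGroup.continuous_mk

variable {n d : ℕ} {G : Type*} [TopologicalSpace G] [ChartedSpace (EuclideanSpace ℝ (Fin n)) G]
  [Group G] [LieGroup (𝓡 n) ∞ G] [T2Space G] [SimplyConnectedSpace G] [IsTopologicalGroup G]
  [MeasurableSpace G] [BorelSpace G] {L : LieSplitting n d G} {Γ M : Subgroup G}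
  {l : Module.Dual ℝ (GroupLieAlgebra (𝓡 n) G)}

namespace LieSplitting

/-- A functional that vanishes on the commutator defines a character. -/
theorem chi_mul (hl : ∀ v, l (L.b (L.D v)) = 0) (g h : G) : chi l (g * h) = chi l g * chi l h := by
  obtain ⟨s, v, rfl⟩ := L.coords.exists_coords g
  obtain ⟨t, w, rfl⟩ := L.coords.exists_coords h
  have h1 : L.coords.e s * L.coords.m v * (L.coords.e t * L.coords.m w) =
      L.e (s + t) * L.m (nilExp L.D L.N (-t) v + w) := by
    have h2 : L.m v * L.e t = L.e t * L.m (nilExp L.D L.N (-t) v) := L.coords.m_mul_e t v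
    change L.e s * L.m v * (L.e t * L.m w) = _
    rw [L.e_add, L.m_add]
    simp only [mul_assoc]
    rw [← mul_assoc (L.m v), h2, mul_assoc]
  rw [h1, L.chi_e_mul_m hl]
  change _ = chi l (L.e s * L.m v) * chi l (L.e t * L.m w)
  rw [L.chi_e_mul_m hl, L.chi_e_mul_m hl, ← Circle.exp_add, map_add, map_add]
  have h3 : l (L.b (nilExp L.D L.N (-t) v)) = l (L.b v) :=
    L.apply_nilExp (f := l ∘ₗ L.b) hl (-t) v
  rw [h3]
  congr 1
  ring

theorem chi_one (hl : ∀ v, l (L.b (L.D v)) = 0) : chi l (1 : G) = 1 := by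
  simpa using chi_mul hl 1 1

theorem chi_inv (hl : ∀ v, l (L.b (L.D v)) = 0) (g : G) : chi l g⁻¹ = (chi l g)⁻¹ :=
  eq_inv_of_mul_eq_one_left (by rw [← chi_mul hl, inv_mul_cancel, chi_one hl])

theorem continuous_chi (hl : ∀ v, l (L.b (L.D v)) = 0) : Continuous (chi l : G → Circle) := by
  have h1 : (chi l : G → Circle) = (fun p : ℝ × (Fin d → ℝ) =>
      Circle.exp (2 * Real.pi * (p.1 * l L.T + (l ∘ₗ L.b) p.2))) ∘ L.coords.homeo.symm := by
    funext g
    obtain ⟨⟨t, v⟩, rfl⟩ := L.coords.homeo.surjective g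
    rw [Function.comp_apply, Homeomorph.symm_apply_apply]
    exact L.chi_e_mul_m hl t v
  have h2 : Continuous (l ∘ₗ L.b) := LinearMap.continuous_of_finiteDimensional _
  rw [h1]
  exact Continuous.comp (by fun_prop) L.coords.homeo.symm.continuous

variable {z : Fin d → ℤ}

theorem chi_m_eq_intChar (hz : ∀ v, l (L.b v) = intDual z v) (v : Fin d → ℝ) :
    chi l (L.m v) = intChar z v := by
  rw [L.chi_m, hz, intChar_eq]

theorem chiOn_fiberMk (hM : L.coords.IsFiber M) (hz : ∀ v, l (L.b v) = intDual z v)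
    (v : Fin d → ℝ) : chiOn M l (L.coords.fiberMk hM v) = intChar z v :=
  chi_m_eq_intChar hz v

theorem rightInvariant_integrand_fiber (hM : L.coords.IsFiber M) (hΓ : L.coords.IsIntegral Γ)
    (hz : ∀ v, l (L.b v) = intDual z v) (ξ : C(G ⧸ Γ, ℂ)) (g : G) :
    RightInvariant (Γ.subgroupOf M) fun m : M => integrand ξ l g m := by
  intro x y hy
  obtain ⟨v, rfl⟩ := (L.coords.fiberHomeo hM).surjective x
  obtain ⟨w, rfl⟩ := (L.coords.fiberHomeo hM).surjective y
  obtain ⟨k, rfl⟩ := hΓ.of_m_mem hy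
  change integrand ξ l g (L.m v * L.m (intVec k)) = integrand ξ l g (L.m v)
  rw [integrand, integrand, ← L.m_add, chi_m_eq_intChar hz, chi_m_eq_intChar hz,
    intChar_add_intVec, L.m_add, ← mul_assoc]
  congr 1
  exact rightInvariant_mk ξ _ _ (hΓ.m_mem k)

theorem rightInvariant_integrand (hΓ : L.coords.IsIntegral Γ)
    (hz : ∀ v, l (L.b v) = intDual z v) {j : ℤ} (hj : l L.T = j)
    (hl : ∀ v, l (L.b (L.D v)) = 0) (ξ : C(G ⧸ Γ, ℂ)) (g : G) :
    RightInvariant Γ (integrand ξ l g) := by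
  intro x y hy
  have h1 : chi l y = 1 := by
    obtain ⟨k, w, rfl⟩ := (hΓ y).1 hy
    refine (L.chi_e_mul_m hl _ _).trans ?_
    rw [hz, hj, mul_add, Circle.exp_add, ← intChar_eq, intChar_intVec, mul_one]
    exact_mod_cast circleExp_two_pi_mul_int (k * j)
  rw [integrand, integrand, chi_mul hl, h1, mul_one, ← mul_assoc]
  congr 1
  exact rightInvariant_mk ξ _ _ hy

/-- `U(ξ)(l)` is a partial Fourier coefficient. -/
theorem uGeneric_eq_coeff (hM : L.coords.IsFiber M) (hΓ : L.coords.IsIntegral Γ)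
    [DiscreteTopology Γ] (κ : Measure (M ⧸ Γ.subgroupOf M)) [IsProbabilityMeasure κ]
    [SMulInvariantMeasure M (M ⧸ Γ.subgroupOf M) κ] (hz : ∀ v, l (L.b v) = intDual z v)
    (ξ : C(G ⧸ Γ, ℂ)) (g : G) :
    uGeneric M κ ξ l g = L.coords.coeff (fun g => ξ (g : G ⧸ Γ)) z g := by
  have hinv := rightInvariant_integrand_fiber hM hΓ hz ξ g
  have hform : ∀ v, integrand ξ l g (L.coords.fiberMk hM v : M) =
      ξ ((g * L.coords.m v : G) : G ⧸ Γ) * (intChar z v : ℂ) := fun v => by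
    rw [← chi_m_eq_intChar hz]
    rfl
  have hmeas : Continuous fun m : M => integrand ξ l g m := by
    rw [← (L.coords.fiberHomeo hM).comp_continuous_iff']
    have h1 : (fun m : M => integrand ξ l g m) ∘ L.coords.fiberHomeo hM =
      fun v => ξ ((g * L.coords.m v : G) : G ⧸ Γ) * (intChar z v : ℂ) := funext hform
    rw [h1]
    exact SemidirectCoords.continuous_mul_intChar
      (SemidirectCoords.continuous_comp_mul_m (continuous_mk ξ) g) z
  have hmk : Measurable fun v => ((L.coords.fiberMk hM v : M) : M ⧸ Γ.subgroupOf M) := by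
    have h1 : Measurable (QuotientGroup.mk : M → M ⧸ Γ.subgroupOf M) :=
      measurable_from_quotient.1 measurable_id
    exact h1.comp (L.coords.fiberHomeo hM).measurable
  rw [uGeneric, hM.measure_eq hΓ κ, integral_map hmk.aemeasurable
    (continuous_descend hinv hmeas).measurable.aestronglyMeasurable]
  refine integral_congr_ae (Eventually.of_forall fun v => ?_)
  simp only
  rw [descend_mk hinv, hform]

/-- Invariance of `ν` under `g` together with multiplicativity of `chi l`: this component of `U` is
determined by its value at `1`, a single complex number. -/
theorem uNonGeneric_eq (hΓ : L.coords.IsIntegral Γ)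
    (hz : ∀ v, l (L.b v) = intDual z v) {j : ℤ} (hj : l L.T = j)
    (hl : ∀ v, l (L.b (L.D v)) = 0) (ν : Measure (G ⧸ Γ)) [SMulInvariantMeasure G (G ⧸ Γ) ν]
    (ξ : C(G ⧸ Γ, ℂ)) (g : G) :
    uNonGeneric ν ξ l g = (chi l g : ℂ)⁻¹ * uNonGeneric ν ξ l 1 := by
  have hinv := rightInvariant_integrand hΓ hz hj hl ξ
  rw [uNonGeneric, uNonGeneric, ← integral_smul_eq_self (descend Γ (integrand ξ l 1)) (g := g),
    ← integral_const_mul]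
  refine integral_congr_ae (Eventually.of_forall fun x => ?_)
  induction x using QuotientGroup.induction_on with
  | H x =>
    simp only
    have h1 : g • (x : G ⧸ Γ) = ((g * x : G) : G ⧸ Γ) := rfl
    rw [h1, descend_mk (hinv g), descend_mk (hinv 1), integrand, integrand, chi_mul hl, one_mul,
      Circle.coe_mul]
    have := Circle.coe_ne_zero (chi l g)
    field_simp

/-- Fubini on the fundamental domain: the character is a product of a fiber character and `exp(2πi j
t)`. The inner integral is a fiber coefficient and the outer one a Fourier coefficient on the
circle. -/
theorem uNonGeneric_one (hΓ : L.coords.IsIntegral Γ) [DiscreteTopology Γ]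
    (hz : ∀ v, l (L.b v) = intDual z v) {j : ℤ} (hj : l L.T = j)
    (hl : ∀ v, l (L.b (L.D v)) = 0) (ν : Measure (G ⧸ Γ)) [IsProbabilityMeasure ν]
    [SMulInvariantMeasure G (G ⧸ Γ) ν] [CompactSpace (G ⧸ Γ)] (ξ : C(G ⧸ Γ, ℂ)) :
    uNonGeneric ν ξ l 1 = ∫ t in Set.Ioc (0 : ℝ) 1,
      L.coords.coeff (fun g => ξ (g : G ⧸ Γ)) z (L.coords.e t) *
        (Circle.exp (2 * Real.pi * (j * t)) : ℂ) := by
  have hinv := rightInvariant_integrand hΓ hz hj hl ξ 1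
  have hc : Continuous (integrand ξ l 1 : G → ℂ) := by
    refine Continuous.mul ?_ (continuous_subtype_val.comp (continuous_chi hl))
    simpa only [one_mul] using continuous_mk ξ
  have hmk : Measurable fun p => ((L.coords.homeo p : G) : G ⧸ Γ) := by
    have h1 : Measurable (QuotientGroup.mk : G → G ⧸ Γ) := measurable_from_quotient.1 measurable_id
    exact h1.comp L.coords.homeo.measurable
  rw [uNonGeneric, hΓ.measure_eq ν, integral_map hmk.aemeasurable
    (continuous_descend hinv hc).measurable.aestronglyMeasurable, Measure.volume_eq_prod,
    setIntegral_prod]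
  · refine integral_congr_ae (Eventually.of_forall fun t => ?_)
    simp only
    rw [SemidirectCoords.coeff, cubeCoeff, ← integral_mul_const]
    refine integral_congr_ae (Eventually.of_forall fun v => ?_)
    simp only
    rw [descend_mk hinv, integrand, one_mul]
    have h1 : chi l (L.coords.homeo (t, v)) = intChar z v * Circle.exp (2 * Real.pi * (j * t)) := by
      refine (L.chi_e_mul_m hl t v).trans ?_
      rw [hz, hj, intChar_eq, ← Circle.exp_add]
      congr 1
      ring
    rw [h1, Circle.coe_mul]
    exact (mul_assoc (ξ ((L.coords.homeo (t, v) : G) : G ⧸ Γ)) _ _).symm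
  · refine Measure.integrableOn_of_bounded (M := ‖ξ‖) ?_ ?_ ?_
    · rw [Measure.prod_prod, volume_unitCube]
      simp
    · exact ((continuous_descend hinv hc).measurable.comp hmk).aestronglyMeasurable
    · refine Eventually.of_forall fun p => ?_
      rw [descend_mk hinv, integrand, norm_mul, Circle.norm_coe, mul_one]
      exact ξ.norm_coe_le_norm _

end LieSplitting

end Components

end Nilmanifold
end

/-! ### Hilbert sums, extension of isometries, and density of continuous functions. -/

noncomputable section

namespace Nilmanifold

section HilbertSum

theorem ofReal_norm_sq {E : Type*} [SeminormedAddCommGroup E] (x : E) :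
    ENNReal.ofReal (‖x‖ ^ 2) = ‖x‖ₑ ^ 2 := by
  rw [ENNReal.ofReal_pow (norm_nonneg _), ofReal_norm]

variable {ι : Type*} {H : ι → Type*} [∀ i, NormedAddCommGroup (H i)]

theorem memℓp_two_of_tsum_enorm {f : ∀ i, H i} (hf : ∑' i, ‖f i‖ₑ ^ 2 ≠ (⊤ : ℝ≥0∞)) :
    Memℓp f 2 := by
  refine memℓp_gen ?_
  have h1 := ENNReal.summable_toReal hf
  simpa using h1

theorem enorm_sq_lp (f : lp H 2) : ‖f‖ₑ ^ 2 = ∑' i, ‖f i‖ₑ ^ 2 := by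
  have h1 := lp.norm_rpow_eq_tsum (by norm_num) f
  have h2 := (lp.memℓp f).summable (by norm_num)
  simp only [ENNReal.toReal_ofNat, Real.rpow_ofNat] at h1 h2
  rw [← ofReal_norm_sq, h1, ENNReal.ofReal_tsum_of_nonneg (fun _ => by positivity) h2]
  simp only [ofReal_norm_sq]

theorem enorm_sq_prod {E F : Type*} [NormedAddCommGroup E] [NormedAddCommGroup F]
    (x : WithLp 2 (E × F)) : ‖x‖ₑ ^ 2 = ‖x.fst‖ₑ ^ 2 + ‖x.snd‖ₑ ^ 2 := by
  rw [← ofReal_norm_sq, WithLp.prod_norm_sq_eq_of_L2,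
    ENNReal.ofReal_add (by positivity) (by positivity), ofReal_norm_sq, ofReal_norm_sq]

/-- A linear map into a Hilbert sum with given components. -/
theorem exists_linearMap_hilbertSum [∀ i, NormedSpace ℂ (H i)] {κ E E' : Type*} [AddCommGroup E]
    [Module ℂ E] [NormedAddCommGroup E'] (T : E → E') (a : ∀ i, E →ₗ[ℂ] H i) (c : κ → E →ₗ[ℂ] ℂ)
    (h : ∀ x, ∑' i, ‖a i x‖ₑ ^ 2 + ∑' j, ‖c j x‖ₑ ^ 2 = ‖T x‖ₑ ^ 2) :
    ∃ U : E →ₗ[ℂ] WithLp 2 (lp H 2 × lp (fun _ : κ => ℂ) 2), (∀ x i, (U x).fst i = a i x) ∧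
      (∀ x j, (U x).snd j = c j x) ∧ ∀ x, ‖U x‖ = ‖T x‖ := by
  -- The Parseval identity itself provides the square-summability that places the components in the
  -- Hilbert sum.
  have hfin : ∀ x, ∑' i, ‖a i x‖ₑ ^ 2 + ∑' j, ‖c j x‖ₑ ^ 2 ≠ (⊤ : ℝ≥0∞) := fun x => by
    rw [h]
    exact ENNReal.pow_ne_top enorm_ne_top
  have ha : ∀ x, Memℓp (fun i => a i x) 2 := fun x =>
    memℓp_two_of_tsum_enorm (ne_top_of_le_ne_top (hfin x) le_self_add)
  have hc : ∀ x, Memℓp (fun j => c j x) 2 := fun x =>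
    memℓp_two_of_tsum_enorm (ne_top_of_le_ne_top (hfin x) le_add_self)
  let U : E →ₗ[ℂ] WithLp 2 (lp H 2 × lp (fun _ : κ => ℂ) 2) :=
    { toFun := fun x => WithLp.toLp 2 (⟨_, ha x⟩, ⟨_, hc x⟩)
      map_add' := fun x y => by
        refine WithLp.ofLp_injective 2 (Prod.ext (lp.ext ?_) (lp.ext ?_))
        · funext i
          exact map_add (a i) x y
        · funext j
          exact map_add (c j) x y
      map_smul' := fun r x => by
        refine WithLp.ofLp_injective 2 (Prod.ext (lp.ext ?_) (lp.ext ?_))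
        · funext i
          exact map_smul (a i) r x
        · funext j
          exact map_smul (c j) r x }
  refine ⟨U, fun _ _ => rfl, fun _ _ => rfl, fun x => ?_⟩
  have h1 : ‖U x‖ₑ ^ 2 = ‖T x‖ₑ ^ 2 := by
    rw [enorm_sq_prod, enorm_sq_lp, enorm_sq_lp, ← h x]
    rfl
  rw [← ofReal_norm_sq, ← ofReal_norm_sq,
    ENNReal.ofReal_eq_ofReal_iff (by positivity) (by positivity)] at h1
  exact (sq_eq_sq₀ (norm_nonneg _) (norm_nonneg _)).1 h1

/-- A linear map which is isometric with respect to a dense map extends to an isometry. -/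
theorem exists_isometry_extension {E E' F : Type*} [AddCommGroup E] [Module ℂ E]
    [NormedAddCommGroup E'] [NormedSpace ℂ E'] [NormedAddCommGroup F] [NormedSpace ℂ F]
    [CompleteSpace F] (U : E →ₗ[ℂ] F) (T : E →ₗ[ℂ] E') (hT : DenseRange T)
    (h : ∀ x, ‖U x‖ = ‖T x‖) : ∃ V : E' →ₗᵢ[ℂ] F, ∀ x, V (T x) = U x := by
  have h1 : ∀ x, U.extendOfNorm T (T x) = U x :=
    LinearMap.extendOfNorm_eq hT ⟨1, fun x => by rw [one_mul, h]⟩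
  refine ⟨{ (U.extendOfNorm T).toLinearMap with
    norm_map' := fun y => ?_ }, h1⟩
  change ‖U.extendOfNorm T y‖ = ‖y‖
  refine hT.induction_on y (isClosed_eq (by fun_prop) (by fun_prop)) fun x => ?_
  rw [h1, h]

end HilbertSum

section Density

variable {d : ℕ} {G : Type*} [Group G] [TopologicalSpace G] [IsTopologicalGroup G] [T2Space G]
  [MeasurableSpace G] [BorelSpace G]

/-- `toL2` as a linear map. -/
def toL2Linear {Γ : Subgroup G} [CompactSpace (G ⧸ Γ)] (ν : Measure (G ⧸ Γ)) [IsFiniteMeasure ν] :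
    C(G ⧸ Γ, ℂ) →ₗ[ℂ] Lp ℂ 2 ν where
  toFun := toL2 ν
  map_add' _ _ := rfl
  map_smul' _ _ := rfl

/-- The coordinates make `G` Polish, and `Γ` is closed. So the quotient `σ`-algebra on `G ⧸ Γ` is
the Borel one of a metrizable space, where continuous functions are dense in `L²`. -/
theorem denseRange_toL2 (P : SemidirectCoords d G) {Γ : Subgroup G} [DiscreteTopology Γ]
    [CompactSpace (G ⧸ Γ)] (ν : Measure (G ⧸ Γ)) [IsFiniteMeasure ν] :
    DenseRange (toL2Linear ν) := by
  have := P.secondCountableTopology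
  have : PolishSpace G := P.homeo.symm.isClosedEmbedding.polishSpace
  have : IsClosed (Γ : Set G) := Subgroup.isClosed_of_discrete
  have : SecondCountableTopology (G ⧸ Γ) := inferInstance
  have : BorelSpace (G ⧸ Γ) := CosetSpace.borelSpace
  have : TopologicalSpace.MetrizableSpace (G ⧸ Γ) :=
    TopologicalSpace.metrizableSpace_of_t3_secondCountable _
  exact ContinuousMap.toLp_denseRange ℂ ν ℂ (p := 2) (by norm_num)

end Density

end Nilmanifold
end

/-! ### Assembly: Parseval for `U`, its isometric extension, and intertwining. -/

noncomputable section

namespace Nilmanifold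

theorem withLp_prod_ext {A B : Type*} {u v : WithLp 2 (A × B)} (h1 : u.fst = v.fst)
    (h2 : u.snd = v.snd) : u = v :=
  WithLp.ofLp_injective 2 (Prod.ext h1 h2)

/-- Two continuous operators intertwined by an isometry on a dense subset are intertwined. -/
theorem intertwines_of_denseRange {α H K : Type*} [NormedAddCommGroup H] [NormedSpace ℂ H]
    [NormedAddCommGroup K] [NormedSpace ℂ K] {ι : α → H} (hι : DenseRange ι) {V : H →ₗᵢ[ℂ] K}
    {U : α → K} (hV : ∀ x, V (ι x) = U x) {A : H →ₗᵢ[ℂ] H} {B : K →L[ℂ] K} {σ : α → α}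
    (hA : ∀ x, A (ι x) = ι (σ x)) (hB : ∀ x, U (σ x) = B (U x)) (f : H) : V (A f) = B (V f) := by
  refine hι.induction_on f (isClosed_eq (V.continuous.comp A.continuous)
    (B.continuous.comp V.continuous)) fun x => ?_
  rw [hA, hV, hV, hB]

section Assembly

variable {n d : ℕ} {G : Type*} [TopologicalSpace G] [ChartedSpace (EuclideanSpace ℝ (Fin n)) G]
  [Group G] [LieGroup (𝓡 n) ∞ G] [T2Space G] [SimplyConnectedSpace G] [IsTopologicalGroup G]
  [MeasurableSpace G] [BorelSpace G] {L : LieSplitting n d G} {Γ M : Subgroup G}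
  {l : Module.Dual ℝ (GroupLieAlgebra (𝓡 n) G)}

namespace LieSplitting

variable [CompactSpace (G ⧸ Γ)]

theorem integrableOn_mul_intChar (P : SemidirectCoords d G) (ξ : C(G ⧸ Γ, ℂ)) (z : Fin d → ℤ)
    (g : G) : IntegrableOn (fun v => ξ ((g * P.m v : G) : G ⧸ Γ) * (intChar z v : ℂ))
      (unitCube d) := by
  refine Measure.integrableOn_of_bounded (M := ‖ξ‖) (by rw [volume_unitCube]; simp) ?_ ?_
  · exact (SemidirectCoords.continuous_mul_intChar
      (SemidirectCoords.continuous_comp_mul_m (continuous_mk ξ) g) z).aestronglyMeasurable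
  · refine Eventually.of_forall fun v => ?_
    rw [norm_mul, Circle.norm_coe, mul_one]
    exact ξ.norm_coe_le_norm _

theorem coeff_add (P : SemidirectCoords d G) (ξ η : C(G ⧸ Γ, ℂ)) (z : Fin d → ℤ) (g : G) :
    P.coeff (fun g => (ξ + η) (g : G ⧸ Γ)) z g =
      P.coeff (fun g => ξ (g : G ⧸ Γ)) z g + P.coeff (fun g => η (g : G ⧸ Γ)) z g := by
  rw [SemidirectCoords.coeff, SemidirectCoords.coeff, SemidirectCoords.coeff, cubeCoeff, cubeCoeff,
    cubeCoeff, ← integral_add (integrableOn_mul_intChar P ξ z g)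
      (integrableOn_mul_intChar P η z g)]
  simp only [ContinuousMap.add_apply, add_mul]

theorem coeff_smul (P : SemidirectCoords d G) (c : ℂ) (ξ : C(G ⧸ Γ, ℂ)) (z : Fin d → ℤ) (g : G) :
    P.coeff (fun g => (c • ξ) (g : G ⧸ Γ)) z g = c * P.coeff (fun g => ξ (g : G ⧸ Γ)) z g := by
  rw [SemidirectCoords.coeff, SemidirectCoords.coeff, cubeCoeff, cubeCoeff, ← integral_const_mul]
  simp only [ContinuousMap.smul_apply, smul_eq_mul, mul_assoc]

variable [DiscreteTopology Γ] (ν : Measure (G ⧸ Γ)) [IsProbabilityMeasure ν]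
  [SMulInvariantMeasure G (G ⧸ Γ) ν]

/-- Parseval's identity for the operator `U`. -/
theorem tsum_components (hΓ : L.coords.IsIntegral Γ) {ι κ : Type*} {z : ι → Fin d → ℤ}
    (σ : ι × ℤ ≃ L.generic)
    (hσ : ∀ i (k : ℤ) v, intDual (σ (i, k)).1 (L.coords.A.map k v) = intDual (z i) v)
    (τ : κ ≃ (L.genericᶜ : Set _) × ℤ) (ξ : C(G ⧸ Γ, ℂ)) :
    (∑' i, ∫⁻ t, ‖L.coords.coeff (fun g => ξ (g : G ⧸ Γ)) (z i) (L.coords.e t)‖ₑ ^ 2) +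
      ∑' l, ‖∫ t in Set.Ioc (0 : ℝ) 1,
        L.coords.coeff (fun g => ξ (g : G ⧸ Γ)) (τ l).1.1 (L.coords.e t) *
          (Circle.exp (2 * Real.pi * ((τ l).2 * t)) : ℂ)‖ₑ ^ 2 = ‖toL2 ν ξ‖ₑ ^ 2 := by
  have hf := rightInvariant_mk ξ
  have hc := continuous_mk ξ
  have h1 : ‖toL2 ν ξ‖ₑ ^ 2 = ∫⁻ x, ‖descend Γ (fun g => ξ (g : G ⧸ Γ)) x‖ₑ ^ 2 ∂ν := by
    refine (enorm_toLp_sq _).trans (lintegral_congr fun x => ?_)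
    induction x using QuotientGroup.induction_on with
    | H g => rw [descend_mk hf]
  -- The sum over `ℤᵈ` splits into generic coefficients, regrouped along free orbits, and
  -- flow-invariant ones, each expanded on the circle.
  rw [h1, SemidirectCoords.lintegral_eq_tsum_coeff hΓ ν hf hc,
    ← Summable.tsum_add_tsum_compl (s := L.generic) ENNReal.summable ENNReal.summable]
  congr 1
  · exact (SemidirectCoords.tsum_coeff_orbits hΓ hf hc σ z hσ).symm
  · refine (τ.tsum_eq fun q : (L.genericᶜ : Set _) × ℤ => ‖∫ t in Set.Ioc (0 : ℝ) 1,
        L.coords.coeff (fun g => ξ (g : G ⧸ Γ)) q.1.1 (L.coords.e t) *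
          (Circle.exp (2 * Real.pi * (q.2 * t)) : ℂ)‖ₑ ^ 2).trans ?_
    refine (ENNReal.tsum_prod (f := fun (y : (L.genericᶜ : Set _)) (j : ℤ) =>
      ‖∫ t in Set.Ioc (0 : ℝ) 1, L.coords.coeff (fun g => ξ (g : G ⧸ Γ)) y.1 (L.coords.e t) *
          (Circle.exp (2 * Real.pi * (j * t)) : ℂ)‖ₑ ^ 2)).trans ?_
    refine tsum_congr fun y => ?_
    exact (SemidirectCoords.tsum_coeff_fixed hΓ hf hc fun t v => intDual_nilExp y.2 t v).symm

/-- The components of `U` in the induced representations. -/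
def genericComponent {z : Fin d → ℤ} (hM : L.coords.IsFiber M) {χ : M → Circle}
    (hχ : ∀ v, χ (L.coords.fiberMk hM v) = intChar z v)
    {μ : Measure (G ⧸ M)} [IsFiniteMeasureOnCompacts μ] [SMulInvariantMeasure G (G ⧸ M) μ]
    (hμ : μ = (volume : Measure ℝ).map hM.lineEquiv)
    (hL : ∀ ξ : C(G ⧸ Γ, ℂ),
      MemLp (fun t => L.coords.coeff (fun g => ξ (g : G ⧸ Γ)) z (L.coords.e t)) 2 volume) :
    C(G ⧸ Γ, ℂ) →ₗ[ℂ] IndSpace M χ μ where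
  toFun ξ := (indEquiv hM hχ hμ).symm ((hL ξ).toLp _)
  map_add' ξ η := by
    rw [← map_add, ← MemLp.toLp_add]
    congr 2
    funext t
    exact coeff_add _ ξ η z _
  map_smul' c ξ := by
    rw [RingHom.id_apply, ← map_smul, ← MemLp.toLp_const_smul]
    congr 2
    funext t
    exact coeff_smul _ c ξ z _

theorem enorm_genericComponent_sq {z : Fin d → ℤ} (hM : L.coords.IsFiber M) {χ : M → Circle}
    (hχ : ∀ v, χ (L.coords.fiberMk hM v) = intChar z v)
    {μ : Measure (G ⧸ M)} [IsFiniteMeasureOnCompacts μ] [SMulInvariantMeasure G (G ⧸ M) μ]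
    (hμ : μ = (volume : Measure ℝ).map hM.lineEquiv)
    (hL : ∀ ξ : C(G ⧸ Γ, ℂ),
      MemLp (fun t => L.coords.coeff (fun g => ξ (g : G ⧸ Γ)) z (L.coords.e t)) 2 volume)
    (ξ : C(G ⧸ Γ, ℂ)) : ‖genericComponent hM hχ hμ hL ξ‖ₑ ^ 2 =
      ∫⁻ t, ‖L.coords.coeff (fun g => ξ (g : G ⧸ Γ)) z (L.coords.e t)‖ₑ ^ 2 := by
  rw [← ofReal_norm_sq]
  change ENNReal.ofReal (‖(indEquiv hM hχ hμ).symm ((hL ξ).toLp _)‖ ^ 2) = _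
  rw [LinearIsometryEquiv.norm_map, ofReal_norm_sq, enorm_toLp_sq]

theorem represents_genericComponent {z : Fin d → ℤ} (hM : L.coords.IsFiber M)
    (hΓ : L.coords.IsIntegral Γ) {χ : M → Circle}
    (hχ : ∀ v, χ (L.coords.fiberMk hM v) = intChar z v)
    {μ : Measure (G ⧸ M)} [IsFiniteMeasureOnCompacts μ] [SMulInvariantMeasure G (G ⧸ M) μ]
    (hμ : μ = (volume : Measure ℝ).map hM.lineEquiv)
    (hL : ∀ ξ : C(G ⧸ Γ, ℂ),
      MemLp (fun t => L.coords.coeff (fun g => ξ (g : G ⧸ Γ)) z (L.coords.e t)) 2 volume)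
    (ξ : C(G ⧸ Γ, ℂ)) : Represents (genericComponent hM hχ hμ hL ξ)
      (L.coords.coeff (fun g => ξ (g : G ⧸ Γ)) z) := by
  refine represents_symm_toLp hM hχ hμ (L.coords.continuous_coeff (continuous_mk ξ) z).measurable
    ((covariant_iff hM hχ).2 fun g v => ?_) (hL ξ)
  exact SemidirectCoords.coeff_mul_m hΓ (rightInvariant_mk ξ) (continuous_mk ξ) z g v

/-- The components of `U` in the characters of `G`. -/
def nonGenericComponent (hΓ : L.coords.IsIntegral Γ) {z : Fin d → ℤ}
    (hz : ∀ v, l (L.b v) = intDual z v) {j : ℤ} (hj : l L.T = j)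
    (hl : ∀ v, l (L.b (L.D v)) = 0) : C(G ⧸ Γ, ℂ) →ₗ[ℂ] ℂ :=
  have hi : ∀ ξ : C(G ⧸ Γ, ℂ), Integrable (descend Γ (integrand ξ l 1)) ν := fun ξ => by
    have hinv := rightInvariant_integrand hΓ hz hj hl ξ 1
    have hc : Continuous (integrand ξ l 1 : G → ℂ) := by
      refine Continuous.mul ?_ (continuous_subtype_val.comp (continuous_chi hl))
      simpa only [one_mul] using continuous_mk ξ
    refine Integrable.of_bound (continuous_descend hinv hc).measurable.aestronglyMeasurable ‖ξ‖
      (Eventually.of_forall fun x => ?_)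
    rw [descend, integrand, norm_mul, Circle.norm_coe, mul_one]
    exact ξ.norm_coe_le_norm _
  { toFun := fun ξ => uNonGeneric ν ξ l 1
    map_add' := fun ξ η => by
      rw [uNonGeneric, uNonGeneric, uNonGeneric, ← integral_add (hi ξ) (hi η)]
      simp only [descend, integrand, ContinuousMap.add_apply, add_mul]
    map_smul' := fun c ξ => by
      rw [RingHom.id_apply, uNonGeneric, uNonGeneric, smul_eq_mul, ← integral_const_mul]
      simp only [descend, integrand, ContinuousMap.smul_apply, smul_eq_mul, mul_assoc] }

end LieSplitting

/-- The translate of a continuous function on `G ⧸ Γ`. -/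
def translateFun (a : G) (ξ : C(G ⧸ Γ, ℂ)) : C(G ⧸ Γ, ℂ) :=
  ξ.comp ⟨fun x => a⁻¹ • x, continuous_const_smul _⟩

theorem uGeneric_translateFun (κ : Measure (M ⧸ Γ.subgroupOf M)) (a : G) (ξ : C(G ⧸ Γ, ℂ)) (g : G) :
    uGeneric M κ (translateFun a ξ) l g = uGeneric M κ ξ l (a⁻¹ * g) := by
  have h : ∀ m : M, integrand (translateFun a ξ) l g m = integrand ξ l (a⁻¹ * g) m := fun m => by
    rw [integrand, integrand, mul_assoc]
    rfl
  rw [uGeneric, uGeneric]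
  simp only [h]

theorem uNonGeneric_translateFun (ν : Measure (G ⧸ Γ)) (a : G) (ξ : C(G ⧸ Γ, ℂ)) (g : G) :
    uNonGeneric ν (translateFun a ξ) l g = uNonGeneric ν ξ l (a⁻¹ * g) := by
  have h : integrand (translateFun a ξ) l g = integrand ξ l (a⁻¹ * g) := funext fun m => by
    rw [integrand, integrand, mul_assoc]
    rfl
  rw [uNonGeneric, uNonGeneric, h]

theorem quasiRegular_toL2 [CompactSpace (G ⧸ Γ)] (ν : Measure (G ⧸ Γ)) [IsFiniteMeasure ν]
    [SMulInvariantMeasure G (G ⧸ Γ) ν] (a : G) (ξ : C(G ⧸ Γ, ℂ)) :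
    quasiRegular ν a (toL2 ν ξ) = toL2 ν (translateFun a ξ) :=
  Lp.toLp_compMeasurePreserving _ _

set_option maxHeartbeats 2000000 in
/-- An operator with components `U(ξ)(l)` commutes with left translations. -/
theorem LieSplitting.map_translateFun [CompactSpace (G ⧸ Γ)]
    (ν : Measure (G ⧸ Γ))
    (κ : Measure (M ⧸ Γ.subgroupOf M)) {μ : Measure (G ⧸ M)} [IsFiniteMeasureOnCompacts μ]
    [SMulInvariantMeasure G (G ⧸ M) μ] (hF : L.coords.IsFiber M)
    (hμ' : μ = (volume : Measure ℝ).map hF.lineEquiv)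
    {S N : Set (Module.Dual ℝ (GroupLieAlgebra (𝓡 n) G))} {z : S → Fin d → ℤ}
    (hz : ∀ (l : S) v, l.1 (L.b v) = intDual (z l) v)
    (hl : ∀ (l : N) v, l.1 (L.b (L.D v)) = 0) (U : C(G ⧸ Γ, ℂ) →ₗ[ℂ] RhoSpace M μ S N)
    (hUrep : ∀ (ξ : C(G ⧸ Γ, ℂ)) (l : S), Represents ((U ξ).fst l) (uGeneric M κ ξ l.1))
    (hUnon : ∀ (ξ : C(G ⧸ Γ, ℂ)) (l : N) (g : G),
      uNonGeneric ν ξ l.1 g = (chi l.1 g : ℂ)⁻¹ * (U ξ).snd l) (a : G) (ξ : C(G ⧸ Γ, ℂ)) :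
    U (translateFun a ξ) = rho M μ S N a (U ξ) := by
  have hfst : (U (translateFun a ξ)).fst = (rho M μ S N a (U ξ)).fst := by
    refine lp.ext (funext fun l => ?_)
    have h2 := (hUrep ξ l).translate a
    have h3 : (fun g => uGeneric M κ ξ l.1 (a⁻¹ * g)) = uGeneric M κ (translateFun a ξ) l.1 :=
      funext fun g => (uGeneric_translateFun κ a ξ g).symm
    rw [h3] at h2
    rw [rho_fst]
    exact Represents.unique hF (LieSplitting.chiOn_fiberMk hF (hz l)) hμ'
      (hUrep (translateFun a ξ) l) h2
  have hsnd : (U (translateFun a ξ)).snd = (rho M μ S N a (U ξ)).snd := by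
    refine lp.ext (funext fun l => ?_)
    -- Evaluation at `1`: translation by `a` evaluates the old component at `a⁻¹`, and the inverse
    -- of `χ_l(a⁻¹)` is `χ_l(a)`.
    have h2 := hUnon (translateFun a ξ) l 1
    rw [uNonGeneric_translateFun, hUnon, LieSplitting.chi_one (hl l), mul_one,
      LieSplitting.chi_inv (hl l), Circle.coe_inv, inv_inv, Circle.coe_one, inv_one, one_mul] at h2
    rw [rho_snd]
    exact h2.symm
  exact withLp_prod_ext hfst hsnd

set_option maxHeartbeats 2000000 in
/-- An isometric operator commuting with left translations extends to an isometric intertwining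
operator. -/
theorem LieSplitting.exists_intertwiner [CompactSpace (G ⧸ Γ)] [DiscreteTopology Γ]
    (L : LieSplitting n d G)
    (ν : Measure (G ⧸ Γ)) [IsProbabilityMeasure ν] [SMulInvariantMeasure G (G ⧸ Γ) ν]
    {μ : Measure (G ⧸ M)} [IsFiniteMeasureOnCompacts μ]
    [SMulInvariantMeasure G (G ⧸ M) μ] 
    {S N : Set (Module.Dual ℝ (GroupLieAlgebra (𝓡 n) G))} 
    (U : C(G ⧸ Γ, ℂ) →ₗ[ℂ] RhoSpace M μ S N)
    (hU : ∀ (a : G) (ξ : C(G ⧸ Γ, ℂ)), U (translateFun a ξ) = rho M μ S N a (U ξ))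
    (hUn : ∀ ξ : C(G ⧸ Γ, ℂ), ‖U ξ‖ = ‖toL2 ν ξ‖) :
    ∃ V : Lp ℂ 2 ν →ₗᵢ[ℂ] RhoSpace M μ S N, (∀ ξ : C(G ⧸ Γ, ℂ), V (toL2 ν ξ) = U ξ) ∧
      ∀ (a : G) (f : Lp ℂ 2 ν), V (quasiRegular ν a f) = rho M μ S N a (V f) := by
  have hdense := denseRange_toL2 L.coords ν
  obtain ⟨V, hV⟩ := exists_isometry_extension U (toL2Linear ν) hdense hUn
  refine ⟨V, hV, fun a => intertwines_of_denseRange hdense hV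
    (quasiRegular_toL2 ν a) (hU a)⟩

end Assembly

end Nilmanifold
end

/-! ### The operator `U` in the coordinates of a splitting. -/

noncomputable section

namespace Nilmanifold

section Assembly

variable {n d : ℕ} {G : Type*} [TopologicalSpace G] [ChartedSpace (EuclideanSpace ℝ (Fin n)) G]
  [Group G] [LieGroup (𝓡 n) ∞ G] [T2Space G] [SimplyConnectedSpace G] [IsTopologicalGroup G]
  [MeasurableSpace G] [BorelSpace G] {L : LieSplitting n d G} {Γ M : Subgroup G}
  {l : Module.Dual ℝ (GroupLieAlgebra (𝓡 n) G)}


set_option maxHeartbeats 2000000 in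
/-- The operator `U` and its extension to an isometric intertwining operator, in the coordinates
of a splitting. -/
theorem LieSplitting.exists_isometric_operator [CompactSpace (G ⧸ Γ)] [DiscreteTopology Γ]
    (ν : Measure (G ⧸ Γ)) [IsProbabilityMeasure ν] [SMulInvariantMeasure G (G ⧸ Γ) ν]
    (κ : Measure (M ⧸ Γ.subgroupOf M)) [IsProbabilityMeasure κ]
    [SMulInvariantMeasure M (M ⧸ Γ.subgroupOf M) κ]
    {μ : Measure (G ⧸ M)} [IsFiniteMeasureOnCompacts μ] [SMulInvariantMeasure G (G ⧸ M) μ]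
    (hΓ : L.coords.IsIntegral Γ) (hF : L.coords.IsFiber M)
    (hμ' : μ = (volume : Measure ℝ).map hF.lineEquiv)
    {S N : Set (Module.Dual ℝ (GroupLieAlgebra (𝓡 n) G))} {z : S → Fin d → ℤ}
    (hz : ∀ (l : S) v, l.1 (L.b v) = intDual (z l) v) (σ : S × ℤ ≃ L.generic)
    (hσ : ∀ i (k : ℤ) v, intDual (σ (i, k)).1 (L.coords.A.map k v) = intDual (z i) v)
    (τ : N ≃ (L.genericᶜ : Set _) × ℤ)
    (hτ : ∀ l : N, (∀ v, l.1 (L.b v) = intDual (τ l).1.1 v) ∧ l.1 L.T = (τ l).2)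
    (hl : ∀ (l : N) v, l.1 (L.b (L.D v)) = 0) :
    ∃ U : C(G ⧸ Γ, ℂ) →ₗ[ℂ] RhoSpace M μ S N,
      (∀ (ξ : C(G ⧸ Γ, ℂ)) (l : S), Represents ((U ξ).fst l) (uGeneric M κ ξ l.1)) ∧
      (∀ (ξ : C(G ⧸ Γ, ℂ)) (l : N) (g : G),
        uNonGeneric ν ξ l.1 g = (chi l.1 g : ℂ)⁻¹ * (U ξ).snd l) ∧
      (∀ ξ : C(G ⧸ Γ, ℂ), ‖U ξ‖ = ‖toL2 ν ξ‖) ∧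
      ∃ V : Lp ℂ 2 ν →ₗᵢ[ℂ] RhoSpace M μ S N, (∀ ξ : C(G ⧸ Γ, ℂ), V (toL2 ν ξ) = U ξ) ∧
        ∀ (a : G) (f : Lp ℂ 2 ν), V (quasiRegular ν a f) = rho M μ S N a (V f) := by
  have hχ : ∀ (l : S) v, chiOn M l.1 (L.coords.fiberMk hF v) = intChar (z l) v := fun l =>
    LieSplitting.chiOn_fiberMk hF (hz l)
  have htot := LieSplitting.tsum_components ν hΓ σ hσ τ
  have hmem : ∀ (l : S) (ξ : C(G ⧸ Γ, ℂ)), MemLp (fun t =>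
      L.coords.coeff (fun g => ξ (g : G ⧸ Γ)) (z l) (L.coords.e t)) 2 volume := by
    intro l ξ
    refine memLp_two_of_lintegral_lt_top
      ((L.coords.continuous_coeff (continuous_mk ξ) (z l)).comp
        L.coords.continuous_e).aestronglyMeasurable ?_
    -- Each generic coefficient is one term of the total sum `‖ξ‖²`, hence square-integrable on the
    -- line.
    refine lt_of_le_of_lt ?_ (ENNReal.pow_lt_top (n := 2) (enorm_lt_top (x := toL2 ν ξ)))
    rw [← htot ξ]
    exact (ENNReal.le_tsum l).trans le_self_add
  let a : ∀ l : S, C(G ⧸ Γ, ℂ) →ₗ[ℂ] IndSpace M (chiOn M l.1) μ := fun l =>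
    LieSplitting.genericComponent hF (hχ l) hμ' (hmem l)
  let c : N → C(G ⧸ Γ, ℂ) →ₗ[ℂ] ℂ := fun l =>
    LieSplitting.nonGenericComponent ν hΓ (hτ l).1 (hτ l).2 (hl l)
  obtain ⟨U, hUa, hUc, hUn⟩ := exists_linearMap_hilbertSum (toL2 ν) a c fun ξ => by
    rw [← htot ξ]
    congr 1
    · exact tsum_congr fun l => LieSplitting.enorm_genericComponent_sq hF (hχ l) hμ' (hmem l) ξ
    · refine tsum_congr fun l => ?_
      rw [← LieSplitting.uNonGeneric_one hΓ (hτ l).1 (hτ l).2 (hl l) ν ξ]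
      rfl
  have hUrep : ∀ (ξ : C(G ⧸ Γ, ℂ)) (l : S),
      Represents ((U ξ).fst l) (uGeneric M κ ξ l.1) := fun ξ l => by
    rw [hUa, funext (LieSplitting.uGeneric_eq_coeff hF hΓ κ (hz l) ξ)]
    exact LieSplitting.represents_genericComponent hF hΓ (hχ l) hμ' (hmem l) ξ
  have hUnon : ∀ (ξ : C(G ⧸ Γ, ℂ)) (l : N) (g : G),
      uNonGeneric ν ξ l.1 g = (chi l.1 g : ℂ)⁻¹ * (U ξ).snd l := fun ξ l g => by
    rw [hUc]
    exact LieSplitting.uNonGeneric_eq hΓ (hτ l).1 (hτ l).2 (hl l) ν ξ g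
  exact ⟨U, hUrep, hUnon, hUn, L.exists_intertwiner ν U
    (LieSplitting.map_translateFun ν κ hF hμ' hz hl U hUrep hUnon) hUn⟩

end Assembly

end Nilmanifold
end

/-! ### The theorem, for the splitting given by the Malcev basis. -/

open Nilmanifold
theorem theorem5p3 {d : ℕ} {G : Type*} [TopologicalSpace G] [T2Space G]
    [ChartedSpace (EuclideanSpace ℝ (Fin (d + 1))) G] [Group G] [LieGroup (𝓡 (d + 1)) ∞ G]
    [IsTopologicalGroup G] [SimplyConnectedSpace G] [MeasurableSpace G] [BorelSpace G]
    -- `G` is a connected, simply connected one-parameter metabelian nilpotent Lie group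
    (hG : IsOneParameterMetabelian (GroupLieAlgebra (𝓡 (d + 1)) G))
    -- `Γ` is a discrete uniform subgroup
    (Γ : Subgroup G) [DiscreteTopology Γ] [CompactSpace (G ⧸ Γ)]
    -- `𝔪` is a rational abelian ideal of codimension one, and `M = exp 𝔪`
    (𝔪 : LieIdeal ℝ (GroupLieAlgebra (𝓡 (d + 1)) G)) (h𝔪_ab : IsLieAbelian 𝔪)
    (h𝔪_codim : Module.finrank ℝ (GroupLieAlgebra (𝓡 (d + 1)) G ⧸ 𝔪.toSubmodule) = 1)
    (h𝔪_rat : IsRationalSubspace Γ 𝔪.toSubmodule)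
    (M : Subgroup G)
    (hM : (M : Set G) = lieExp '' (𝔪 : Set (GroupLieAlgebra (𝓡 (d + 1)) G)))
    -- `X` is a strong Malcev basis strongly based on `Γ`, passing through `[𝔤, 𝔤]` and `𝔪`
    (X : Module.Basis (Fin (d + 1)) ℝ (GroupLieAlgebra (𝓡 (d + 1)) G))
    (hX : IsStrongMalcev X) (hXΓ : IsStronglyBasedOn X Γ)
    (p : ℕ)
    (hXp : flag X p = (⁅(⊤ : LieIdeal ℝ (GroupLieAlgebra (𝓡 (d + 1)) G)),
      (⊤ : LieIdeal ℝ (GroupLieAlgebra (𝓡 (d + 1)) G))⁆).toSubmodule)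
    (hX𝔪 : flag X d = 𝔪.toSubmodule)
    -- the invariant probability measures on `G/Γ` and `M/(M ∩ Γ)`
    (ν : Measure (G ⧸ Γ)) [IsProbabilityMeasure ν] [SMulInvariantMeasure G (G ⧸ Γ) ν]
    (κ : Measure (M ⧸ Γ.subgroupOf M)) [IsProbabilityMeasure κ]
    [SMulInvariantMeasure M (M ⧸ Γ.subgroupOf M) κ]
    -- the invariant measure on `G/M`, giving mass one to `{exp (t Xₙ) M : 0 ≤ t < 1}`
    (μ : Measure (G ⧸ M)) [IsFiniteMeasureOnCompacts μ] [SMulInvariantMeasure G (G ⧸ M) μ]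
    (hμ : μ ((fun t : ℝ => ((lieExp (t • X (Fin.last d)) : G) : G ⧸ M)) '' Set.Ico 0 1) = 1)
    -- `S` is a cross-section for the `Γ`-orbits in the set of generic integral functionals
    (S : Set (Module.Dual ℝ (GroupLieAlgebra (𝓡 (d + 1)) G))) (hS : IsCrossSection X 𝔪 Γ S) :
    -- the integrands are well defined on `M/(M ∩ Γ)` and `G/Γ`
    (∀ l ∈ S, ∀ (ξ : C(G ⧸ Γ, ℂ)) (g : G),
      RightInvariant (Γ.subgroupOf M) (fun m : M => integrand ξ l g m)) ∧
    (∀ l ∈ nonGenericSet X p, ∀ (ξ : C(G ⧸ Γ, ℂ)) (g : G),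
      RightInvariant Γ (integrand ξ l g)) ∧
    -- `U` is a linear operator with values in the space of `ρ`
    ∃ U : C(G ⧸ Γ, ℂ) →ₗ[ℂ] RhoSpace M μ S (nonGenericSet X p),
      (∀ (ξ : C(G ⧸ Γ, ℂ)) (l : S), Represents ((U ξ).fst l) (uGeneric M κ ξ l.1)) ∧
      (∀ (ξ : C(G ⧸ Γ, ℂ)) (l : nonGenericSet X p) (g : G),
        uNonGeneric ν ξ l.1 g = (chi l.1 g : ℂ)⁻¹ * (U ξ).snd l) ∧
      -- it is isometric
      (∀ ξ : C(G ⧸ Γ, ℂ), ‖U ξ‖ = ‖toL2 ν ξ‖) ∧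
      -- and it extends to an isometric intertwining operator on `L²(G/Γ)`
      ∃ V : Lp ℂ 2 ν →ₗᵢ[ℂ] RhoSpace M μ S (nonGenericSet X p),
        (∀ ξ : C(G ⧸ Γ, ℂ), V (toL2 ν ξ) = U ξ) ∧
        ∀ (a : G) (f : Lp ℂ 2 ν),
          V (quasiRegular ν a f) = rho M μ S (nonGenericSet X p) a (V f) := by
  have hΓ := isIntegral_malcevSplitting hX𝔪 h𝔪_ab hG.1 hXΓ
  have hF := isFiber_malcevSplitting hX𝔪 h𝔪_ab hG.1 hM
  have hμ' : μ = (volume : Measure ℝ).map hF.lineEquiv := by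
    refine hF.measure_quotient_eq μ (Eq.trans ?_ hμ)
    congr 2
    funext t
    exact congrArg QuotientGroup.mk (lieExp_smul (X (Fin.last d)) t).symm
  refine Exists.elim (exists_crossSection_equiv hX𝔪 h𝔪_ab hG.1 hΓ hS) fun z h1 => ?_
  refine Exists.elim h1.2 fun σ hσ => ?_
  have hz := h1.1
  refine Exists.elim (exists_nonGeneric_equiv hX𝔪 h𝔪_ab hXp
    (Z := (malcevSplitting hX𝔪 h𝔪_ab hG.1).genericᶜ) fun y => LieSplitting.notMem_generic_iff)
    fun τ hτ => ?_
  have hl := fun l : nonGenericSet X p =>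
    ((mem_nonGenericSet_iff hX𝔪 h𝔪_ab hXp l.1).1 l.2).2.2
  exact ⟨fun l hlS => LieSplitting.rightInvariant_integrand_fiber hF hΓ (hz ⟨l, hlS⟩),
    fun l hlN => LieSplitting.rightInvariant_integrand hΓ (hτ ⟨l, hlN⟩).1 (hτ ⟨l, hlN⟩).2
      (hl ⟨l, hlN⟩), LieSplitting.exists_isometric_operator ν κ hΓ hF hμ' hz σ hσ τ hτ hl⟩
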